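/- **Setting.** Let $G=(V,E,\omega)$ be a connected undirected graph on $n\ge 2$ nodes with positive integer edge weights. Nodes have distinct identifiers in $\{0,\dots,n^{a}\}$ for a constant $a$; node $1$ is the node of smallest identifier. In a synchronous time slot (round of communication) every node may send one message over each incident edge. Let $\omega(u,v)$ be the least weight of a $u$-$v$-path, $D_\omega=\max_{u,v}\omega(u,v)$, $\sigma_{st}$ the number of $s$-$t$-paths of weight $\omega(s,t)$, $\sigma_{st}(v)$ the number of those that contain $v$, and $$\delta_{s*}(v)=\sum_{t\in V,\ t\ne v\ne s}\frac{\sigma_{st}(v)}{\sigma_{st}}\qquad(\text{so }\delta_{s*}(s)=0).$$ The directed leveled graph $\mathcal L_s$ has the edges $(u,v)$ with $\{u,v\}\in E$ and $\omega(s,v)=\omega(s,u)+\omega(u,v)$; then $u$ is a parent of $v$ and $v$ a child of $u$. **Algorithm BCsetup.** When its rounds begin, every node knows $n$, the constant $c$, the thresholds $\tau_c$ and $\hat n$, its neighbours and the weights of its incident edges, its parent and its children in a breadth-first search tree $T_1$ rooted in node $1$, and $D_\omega'=2\max_v\omega(1,v)$ and $D_h'=2\max_v d(1,v)$, where $d$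 is the hop distance. In round $i=0,1,\dots$: 1. Node 1 broadcasts $p_s=\min(1,t/n)$ with $t=2^{\lfloor\log_2 D_h'\rfloor+i}$ on $T_1$. Every node not sampled before gets sampled with probability $p_s$; $S_i$ is the set of nodes sampled now. $|S_i|$ is summed up on $T_1$ and broadcast. 2. DLGcomp runs in slots $t=0,\dots,|S_i|+D_\omega'$. An edge of weight $k$ is treated as a chain of $k$ unit links, the $k-1$ inner vertices being relays simulated by the endpoint of smaller identifier. Every $s\in S_i$ starts an $s$-message, which spreads through the chains. A node or relay sends over each link, in each slot, the message of the smallest root that it still has to send there and that is not delayed. If two messages meet on a link, only the one of smaller root is accepted and the other is sent again. Of the roots first heard of in a slot and those in the delay queue, all but the smallest are in the delay queue in the next slot. A new root is passed on through all links through which it was not accepted in that slot; it ceases to be pending on a link once it has been accepted from there. If a received distance is at most $D_\omega'$ and not larger than the first one received for that root, the sender counts as a parent, and the slot is recorded. An $s$-message contains $s$, the distance of the receiver from $s$, and the sender's number $\mathit{tsp}$ of shortest paths from $s$, which is $1$ at $s$ and otherwise the sum of the numbers received from parents. 3. DLGagr runs the recorded schedule backwards: in slot $|S_i|+D_\omega'-\tau$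 an answer is sent to each parent whose $s$-message was received in slot $\tau$ of DLGcomp. A node $u\ne s$ computes $\tilde\delta_s(u)$ as the sum of $\frac{\mathit{tsp}(u)}{\mathit{tsp}_w}(1+\tilde\delta_w)$ over the answers $(\tilde\delta_w,\mathit{tsp}_w)$ received from its children $w$ in $\mathcal L_s$; $\tilde\delta_s(s)=0$; relays pass answers on unchanged. 4. Each node adds its new dependencies to a running sum $s_{BC}$. If for the first time $s_{BC}\ge n\tau_c$, it sets its centrality estimate to $n\,s_{BC}/(2k)$, where $k$ is the number of samples so far, and reports this to node 1 through $T_1$ (the reports are added up). When at least $\hat n$ nodes have reported, node 1 broadcasts "terminate". Numbers $\mathit{tsp}$ and dependencies are sent in floating-point form $b\cdot2^E$, rounded down to the $\lceil(3+c)\log_2 n\rceil$ most significant bits. **Lemma.** There is an absolute constant $A$, and for all $c\ge0$ and $a\in\mathbb N$ there is a constant $B$, such that for every network as above, every choice of $\tau_c\in\mathbb Q$ and $\hat n$, every outcome of the random choices and every round $i$ that is executed (i.e. the algorithm has not been terminated before): * all nodes complete the round after at most $A\,(|S_i|+D_\omega)$ slots; * then every node $u$ holds for every $s\in S_i$ a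 value $\tilde\delta_s(u)$ with $$\Bigl(1-\frac1{n^c}\Bigr)\delta_{s*}(u)\ \le\ \tilde\delta_s(u)\ \le\ \Bigl(1+\frac1{n^c}\Bigr)\delta_{s*}(u);$$ * every message sent in the round has at most $B\,(\log_2 n+\log_2 D_\omega)$ bits, with both logarithms rounded down (which is $O(\log n)$ for unweighted graphs and for polynomially bounded weights). -/

import Mathlib

/-!
# Betweenness dependencies in the CONGEST model

Part 1: weighted graphs, shortest paths and dependencies.
Part 2: floating-point numbers and messages.
Part 3: the synchronous message-passing model.
Part 4: one processor of `DLGcomp` / `DLGagr` with the plug-ins `A_BC` / `A'_BC`.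
Part 5: the program of a node in `BCsetup`.
Part 6: the network and the execution of `BCsetup` on it.
-/

namespace BCSetup

/-! ## Part 1: shortest paths and dependencies -/

section Graph

variable {V : Type*} [Fintype V]

/-- The weight of a walk. -/
def walkWeight {G : SimpleGraph V} (w : Sym2 V → ℕ) {u v : V} (p : G.Walk u v) : ℕ :=
  (p.edges.map w).sum

/-- The weighted distance `ω(u,v)`: the least weight of a `u`-`v`-path. -/
noncomputable def wdist (G : SimpleGraph V) (w : Sym2 V → ℕ) (u v : V) : ℕ :=
  sInf {k : ℕ | ∃ p : G.Walk u v, p.IsPath ∧ walkWeight w p = k}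

/-- The shortest weighted `s`-`t`-paths. -/
def shortestPaths (G : SimpleGraph V) (w : Sym2 V → ℕ) (s t : V) : Set (G.Walk s t) :=
  {p | p.IsPath ∧ walkWeight w p = wdist G w s t}

/-- `σ_{st}`, the number of shortest `s`-`t`-paths. -/
noncomputable def sigma (G : SimpleGraph V) (w : Sym2 V → ℕ) (s t : V) : ℕ :=
  (shortestPaths G w s t).ncard

/-- `σ_{st}(v)`, the number of shortest `s`-`t`-paths that contain `v`. -/
noncomputable def sigmaThrough (G : SimpleGraph V) (w : Sym2 V → ℕ) (s t v : V) : ℕ :=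
  {p ∈ shortestPaths G w s t | v ∈ p.support}.ncard

open Classical in
/-- The dependency `δ_{s*}(v) = ∑_{t ≠ v ≠ s} σ_{st}(v) / σ_{st}`; for `v = s` the sum is empty. -/
noncomputable def dependency (G : SimpleGraph V) (w : Sym2 V → ℕ) (s v : V) : ℝ :=
  ∑ t ∈ Finset.univ.filter (fun t => t ≠ v ∧ v ≠ s),
    (sigmaThrough G w s t v : ℝ) / (sigma G w s t : ℝ)

/-- The weighted eccentricity. -/
noncomputable def wecc (G : SimpleGraph V) (w : Sym2 V → ℕ) (u : V) : ℕ :=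
  Finset.univ.sup fun v => wdist G w u v

/-- The weighted diameter `D_ω`. -/
noncomputable def wdiam (G : SimpleGraph V) (w : Sym2 V → ℕ) : ℕ :=
  Finset.univ.sup fun u => wecc G w u

/-- The hop eccentricity. -/
noncomputable def hopEcc (G : SimpleGraph V) (u : V) : ℕ :=
  Finset.univ.sup fun v => G.dist u v

end Graph

/-! ## Part 2: floating-point numbers and messages -/

/-- A floating-point number `mant · 2 ^ exp`. -/
structure Flt where
  mant : ℕ
  exp : ℤ

/-- The rational number represented by a floating-point number. -/
def Flt.val (x : Flt) : ℚ := (x.mant : ℚ) * (2 : ℚ) ^ x.exp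

/-- Number of bits: mantissa, exponent, sign of the exponent. -/
def Flt.bits (x : Flt) : ℕ := x.mant.size + x.exp.natAbs.size + 1

/-- Keep the `β` most significant bits of `x` (zero if `x ≤ 0`). -/
def Flt.round (β : ℕ) (x : ℚ) : Flt :=
  if x ≤ 0 then ⟨0, 0⟩
  else ⟨⌊x / (2 : ℚ) ^ (Int.log 2 x + 1 - (β : ℤ))⌋₊, Int.log 2 x + 1 - (β : ℤ)⟩

/-- The messages of `BCsetup`. -/
inductive Msg (V : Type*) where
  /-- broadcast of the sampling probability `p_s = t / n` -/
  | prob (t : ℕ)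
  /-- partial sum travelling towards node 1 -/
  | count (m : ℕ)
  /-- broadcast of `|S_i|` -/
  | total (m : ℕ)
  /-- `DLGcomp`: root `r`, distance of the receiver, number of shortest paths -/
  | wave (r : V) (d : ℕ) (tsp : Flt)
  /-- `DLGagr`: root `r`, dependency and number of shortest paths of the sender -/
  | back (r : V) (dep : Flt) (tsp : Flt)
  /-- broadcast of "terminate" -/
  | halt

/-- Number of bits of a message, where node `v` has the identifier `ident v`; three bits tell which
of the six kinds of message it is. -/
def Msg.bits {V : Type*} (ident : V → ℕ) : Msg V → ℕ
  | .prob t => 3 + t.size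
  | .count m => 3 + m.size
  | .total m => 3 + m.size
  | .wave r d tsp => 3 + (ident r).size + d.size + tsp.bits
  | .back r dep tsp => 3 + (ident r).size + dep.bits + tsp.bits
  | .halt => 3

/-! ## Part 3: the synchronous message-passing model -/

/-- A program in the CONGEST model.  A node sees its local input `I`, its state `Q` and the
messages received in the present slot from its neighbours (which it knows by their identifiers
in `V`), and nothing else. -/
structure Program (V I M Q : Type*) where
  /-- the message to a given neighbour in the present slot -/
  send : I → Q → V → Option M
  /-- the state after the slot, given the messages received from the neighbours -/
  step : I → Q → (V → Option M) → Q

open Classical in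
/-- One synchronous slot: messages travel over the edges of `G`, then all nodes update. -/
noncomputable def Program.slot {V I M Q : Type*} (P : Program V I M Q) (G : SimpleGraph V)
    (inp : V → I) (q : V → Q) : V → Q :=
  fun u => P.step (inp u) (q u) fun v => if G.Adj v u then P.send (inp v) (q v) u else none

/-! ## Part 4: one processor of `DLGcomp` and `DLGagr`

The processors of the two subroutines are the nodes of the network and, in order to delay a message
on an edge according to its weight, relays: an edge of weight `k` is a chain of `k` unit links with
`k - 1` relays.  The relays of an edge are simulated by its endpoint of smaller identifier, so that
one link of the chain is the edge of the network itself and the others are internal to that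
endpoint.  The ports of a node are its neighbours, the ports of a relay are the two endpoints of its
edge.  -/

section Proc

variable {V : Type*} [LinearOrder V]

/-- The variables of a processor. -/
structure Proc (V : Type*) where
  /-- `L`: the roots known so far -/
  known : Finset V
  /-- `L_delay` -/
  delayed : Finset V
  /-- `L_p`: the roots still to be sent through port `p` -/
  pending : V → Finset V
  /-- `ω[r]` (meaningful for known roots; infinite for the others) -/
  dist : V → ℕ
  /-- schedule: `sched r p = some t` if in slot `t` a valid `r`-message came through port `p`;
  then `p` leads to a parent in the leveled graph of `r` -/
  sched : V → V → Option ℕ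
  /-- `total_sp[r]` -/
  tsp : V → ℚ
  /-- `δ_BC[r]` -/
  dep : V → ℚ
  /-- the `DLGagr` message of root `r` that a relay has received and has to pass on -/
  fwd : V → Option (Flt × Flt)

/-- A processor that is not a root. -/
def Proc.idle : Proc V :=
  ⟨∅, ∅, fun _ => ∅, fun _ => 0, fun _ _ => none, fun _ => 0, fun _ => 0, fun _ => none⟩

/-- A root `s` at the start of `DLGcomp`. -/
def Proc.source (s : V) (ports : Finset V) : Proc V :=
  { (Proc.idle : Proc V) with
    known := {s}
    pending := fun p => if p ∈ ports then {s} else ∅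
    tsp := fun r => if r = s then 1 else 0 }

/-- The roots that may be sent through port `p` now. -/
def Proc.ready (P : Proc V) (p : V) : Finset V := P.pending p \ P.delayed

/-- The smallest root that is ready for port `p`, as a set with at most one element. -/
def Proc.sent (P : Proc V) (p : V) : Finset V :=
  (P.ready p).filter fun r => (P.ready p).min = (r : WithTop V)

/-- `DLGcomp`: the message sent through port `p` belongs to the smallest root that is ready. -/
def Proc.waveOut (β : ℕ) (P : Proc V) (p : V) : Option (Msg V) :=
  if h : (P.ready p).Nonempty then
    some (.wave ((P.ready p).min' h) (P.dist ((P.ready p).min' h) + 1)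
      (Flt.round β (P.tsp ((P.ready p).min' h))))
  else none

/-- `DLGcomp`: the content of the message received through port `p` if its root is smaller than the
root that is sent through `p` in the same slot; otherwise the received message is ignored
(its sender will repeat it). -/
def Proc.accept (P : Proc V) (inc : V → Option (Msg V)) (p : V) : Option (V × ℕ × Flt) :=
  match inc p with
  | some (.wave r d tsp) => if (r : WithTop V) < (P.ready p).min then some (r, d, tsp) else none
  | _ => none

/-- The ports through which an `r`-message is accepted in this slot. -/
def Proc.acceptPorts (P : Proc V) (ports : Finset V) (inc : V → Option (Msg V)) (r : V) :
    Finset V :=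
  ports.filter fun p => (P.accept inc p).map (fun m => m.1) = some r

/-- The roots that are heard of for the first time in this slot. -/
def Proc.newRoots (P : Proc V) (ports : Finset V) (inc : V → Option (Msg V)) : Finset V :=
  (ports.biUnion fun p => ((P.accept inc p).map fun m => m.1).toFinset) \ P.known

/-- The distance in the message accepted through port `p`. -/
def Proc.acceptDist (P : Proc V) (inc : V → Option (Msg V)) (p : V) : ℕ :=
  ((P.accept inc p).map fun m => m.2.1).getD 0

/-- The number of shortest paths in the message accepted through port `p`. -/
def Proc.acceptTsp (P : Proc V) (inc : V → Option (Msg V)) (p : V) : ℚ :=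
  ((P.accept inc p).map fun m => m.2.2.val).getD 0

/-- `ω[r]` after the slot: it is set when `r` is heard of for the first time. -/
def Proc.newDist (P : Proc V) (ports : Finset V) (inc : V → Option (Msg V)) (r : V) : ℕ :=
  if r ∈ P.known then P.dist r
  else if h : (P.acceptPorts ports inc r).Nonempty then
    (P.acceptPorts ports inc r).inf' h (P.acceptDist inc)
  else P.dist r

/-- The ports through which a valid `r`-message comes in this slot: the sender is a parent in the
leveled graph of `r`, and the receiver is at distance at most `k` from `r`. -/
def Proc.validPorts (k : ℕ) (P : Proc V) (ports : Finset V) (inc : V → Option (Msg V)) (r : V) :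
    Finset V :=
  (P.acceptPorts ports inc r).filter fun p =>
    P.acceptDist inc p ≤ P.newDist ports inc r ∧ P.acceptDist inc p ≤ k

/-- `DLGcomp` with parameter `k` and plug-in `A_BC`: the update in slot `t`.
* A new root is scheduled for all ports through which it was not received.
* Of the new roots and those in `L_delay`, all but the smallest are delayed for one more slot.
* A root is no longer pending for a port through which it was received, or was sent without
  meeting a message of smaller root.
* `A_BC` adds up the numbers of shortest paths that arrive from the parents. -/
def Proc.waveIn (k t : ℕ) (ports : Finset V) (inc : V → Option (Msg V)) (P : Proc V) : Proc V :=
  { P with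
    known := P.known ∪ P.newRoots ports inc
    delayed := (P.delayed ∪ P.newRoots ports inc).filter fun r =>
      (P.delayed ∪ P.newRoots ports inc).min ≠ (r : WithTop V)
    pending := fun p =>
      if p ∈ ports then
        match P.accept inc p with
        | some m => (P.pending p ∪ P.newRoots ports inc).erase m.1
        | none => (P.pending p ∪ P.newRoots ports inc) \ P.sent p
      else ∅
    dist := P.newDist ports inc
    sched := fun r p => if p ∈ P.validPorts k ports inc r then some t else P.sched r p
    tsp := fun r => P.tsp r + ∑ p ∈ P.validPorts k ports inc r, P.acceptTsp inc p }

/-- `DLGagr`: the message sent through port `p` in the slot that mirrors slot `t` of `DLGcomp`. If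
the processor received a valid `r`-message through `p` in slot `t`, it now answers with its
dependency and its number of shortest paths for root `r`. A relay passes on what it got from its
child. -/
def Proc.backOut (β : ℕ) (relay : Bool) (t : ℕ) (P : Proc V) (p : V) : Option (Msg V) :=
  if h : (P.known.filter fun r => P.sched r p = some t).Nonempty then
    if relay then
      (P.fwd ((P.known.filter fun r => P.sched r p = some t).min' h)).map fun m =>
        .back ((P.known.filter fun r => P.sched r p = some t).min' h) m.1 m.2
    else
      some (.back ((P.known.filter fun r => P.sched r p = some t).min' h)
        (Flt.round β (P.dep ((P.known.filter fun r => P.sched r p = some t).min' h)))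
        (Flt.round β (P.tsp ((P.known.filter fun r => P.sched r p = some t).min' h))))
  else none

/-- `A'_BC`: what the message received by node `u` through port `p` contributes to `δ_BC[r]`, namely
`(total_sp[r] / tsp_c) · (1 + δ_c)`. The root itself does not count. -/
def Proc.contrib (u : V) (P : Proc V) (inc : V → Option (Msg V)) (r p : V) : ℚ :=
  match inc p with
  | some (.back r' dep tsp) =>
      if r' = r ∧ r ≠ u then P.tsp r / tsp.val * (1 + dep.val) else 0
  | _ => 0

/-- `DLGagr` with plug-in `A'_BC`: the update of node `u`. -/
def Proc.backIn (u : V) (ports : Finset V) (inc : V → Option (Msg V)) (P : Proc V) : Proc V :=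
  { P with dep := fun r => P.dep r + ∑ p ∈ ports, P.contrib u inc r p }

/-- `DLGagr`: the update of a relay between the nodes `u` and `v`. -/
def Proc.relayIn (u v : V) (inc : V → Option (Msg V)) (P : Proc V) : Proc V :=
  { P with
    fwd := fun r =>
      match inc u, inc v with
      | some (.back r' dep tsp), m =>
          if r' = r then some (dep, tsp)
          else match m with
            | some (.back r'' dep' tsp') => if r'' = r then some (dep', tsp') else P.fwd r
            | _ => P.fwd r
      | _, some (.back r' dep tsp) => if r' = r then some (dep, tsp) else P.fwd r
      | _, _ => P.fwd r }

end Proc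

/-! ## Part 5: the program of a node -/

/-- What a node knows when the rounds of `BCsetup` begin. -/
structure View (V : Type*) where
  /-- its identifier -/
  id : V
  /-- the number `n` of nodes -/
  size : ℕ
  /-- its neighbours -/
  nbrs : Finset V
  /-- the weights of its incident edges -/
  wt : V → ℕ
  /-- whether it is node 1 -/
  isNode1 : Bool
  /-- its parent in `T_1` (irrelevant for node 1) -/
  treeParent : V
  /-- its children in `T_1` -/
  treeChildren : Finset V
  /-- `D_ω'` -/
  diam : ℕ
  /-- `D_h'` -/
  hopDiam : ℕ
  /-- number of bits of a mantissa -/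
  prec : ℕ
  /-- the threshold criterion `τ_c` -/
  thr : ℚ
  /-- `n̂`, the number of nodes that have to reach the threshold -/
  nhat : ℕ
  /-- the outcome of its coin (of bias `p_s`) in each round -/
  coin : ℕ → Bool

/-- The state of a node. -/
structure State (V : Type*) where
  /-- number of completed rounds -/
  round : ℕ
  /-- `is_sampled` -/
  isSampled : Bool
  /-- `s_BC` -/
  sBC : ℚ
  /-- `k`, the number of samples so far -/
  numSamples : ℕ
  /-- `BC(u)`, or undefined -/
  bc : Option ℚ
  /-- `n_BC` (used by node 1) -/
  nBC : ℕ
  /-- whether the node knows that the algorithm terminates -/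
  terminated : Bool
  /-- slot within the round -/
  clock : ℕ
  /-- the round is completed -/
  done : Bool
  /-- `t = n · p_s`, when known -/
  prob : Option ℕ
  /-- `gets_sampled` -/
  getsSampled : Bool
  /-- partial sum on its way to node 1 -/
  acc : ℕ
  /-- `|S_i|`, when known -/
  total : Option ℕ
  /-- the processor of the node itself -/
  self : Proc V
  /-- the simulated relays: `relay v j` is at distance `j` from the node, on the edge to `v` -/
  relay : V → ℕ → Proc V

section Node

variable {V : Type*} [LinearOrder V]

/-- The state before the first round. -/
def State.init : State V :=
  { round := 0, isSampled := false, sBC := 0, numSamples := 0, bc := none, nBC := 0,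
    terminated := false, clock := 0, done := true, prob := none, getsSampled := false, acc := 0,
    total := none, self := Proc.idle, relay := fun _ _ => Proc.idle }

/-- The number of relays simulated by the node on its edge to `v`. -/
def View.relays (x : View V) (v : V) : ℕ := if x.id < v then x.wt v - 1 else 0

/-- The start of a round. Node 1 sets `p_s = t / n` with `t = 2 ^ T`, where `T` runs through
`log D_h', log D_h' + 1, …` (and `p_s ≤ 1`). -/
def State.newRound (x : View V) (q : State V) : State V :=
  { q with
    clock := 0
    done := false
    prob := if x.isNode1 then some (min (2 ^ (Nat.log 2 x.hopDiam + q.round)) x.size) else none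
    getsSampled := false
    acc := 0
    total := none
    self := Proc.idle
    relay := fun _ _ => Proc.idle }

/-- The number `|S_i| + D_ω'`, the last slot of `DLGcomp` and of `DLGagr` (both start at `0`). -/
def State.last (x : View V) (q : State V) : ℕ := q.total.getD 0 + x.diam

/-- The message of a hosted processor (the node itself or a relay) through port `p`. -/
def State.emit (x : View V) (q : State V) (relay : Bool) (P : Proc V) (p : V) : Option (Msg V) :=
  if q.clock < 4 * x.diam then none
  else if q.clock ≤ 4 * x.diam + q.last x then P.waveOut x.prec p
  else if q.clock ≤ 4 * x.diam + 2 * q.last x + 1 then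
    P.backOut x.prec relay (4 * x.diam + 2 * q.last x + 1 - q.clock) p
  else none

/-- The message sent over the edge to `v` in the two subroutines, by the hosted processor that is
next to `v`. -/
def State.emitEdge (x : View V) (q : State V) (v : V) : Option (Msg V) :=
  if x.relays v = 0 then q.emit x false q.self v else q.emit x true (q.relay v (x.relays v)) v

/-- What the processor of the node receives through port `v`. -/
def State.selfInc (x : View V) (q : State V) (inc : V → Option (Msg V)) (v : V) :
    Option (Msg V) :=
  if x.relays v = 0 then inc v else q.emit x true (q.relay v 1) x.id

/-- What the relay at distance `j` on the edge to `v` receives through its port `p`. -/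
def State.relayInc (x : View V) (q : State V) (inc : V → Option (Msg V)) (v : V) (j : ℕ) (p : V) :
    Option (Msg V) :=
  if p = x.id then
    if j = 1 then q.emit x false q.self v else q.emit x true (q.relay v (j - 1)) v
  else
    if j = x.relays v then inc v else q.emit x true (q.relay v (j + 1)) x.id

/-- The schedule of a round, with `D = D_ω'` and `K = |S_i| + D_ω'`:
* slots `0, …, D - 1`: `p_s` is broadcast on `T_1`;
* slots `D, …, 3 D - 1`: the number of samples is summed up towards node 1;
* slots `3 D, …, 4 D - 1`: `|S_i|` is broadcast on `T_1`;
* slots `4 D, …, 4 D + K`: `DLGcomp`;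
* slots `4 D + K + 1, …, 4 D + 2 K + 1`: `DLGagr`;
* the next `D` slots: the number of nodes that reached the threshold is summed up;
* the next `D` slots: "terminate" is broadcast if `n̂` nodes have reached the threshold.

This is the message to the neighbour `v`. -/
def send (x : View V) (q : State V) (v : V) : Option (Msg V) :=
  if q.done then none
  else if q.clock < x.diam then
    if v ∈ x.treeChildren then q.prob.map Msg.prob else none
  else if q.clock < 3 * x.diam then
    if ¬ x.isNode1 ∧ v = x.treeParent ∧ 0 < q.acc then some (.count q.acc) else none
  else if q.clock < 4 * x.diam then
    if v ∈ x.treeChildren then q.total.map Msg.total else none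
  else if q.clock ≤ 4 * x.diam + 2 * q.last x + 1 then
    q.emitEdge x v
  else if q.clock < 5 * x.diam + 2 * q.last x + 2 then
    if ¬ x.isNode1 ∧ v = x.treeParent ∧ 0 < q.acc then some (.count q.acc) else none
  else
    if v ∈ x.treeChildren ∧ q.terminated then some .halt else none

/-- Broadcast of `p_s`; in the last slot of this phase the node, if it has not been sampled in an
earlier round, gets sampled according to its coin. -/
def State.stepProb (x : View V) (q : State V) (inc : V → Option (Msg V)) : State V :=
  let prob := if x.isNode1 then q.prob else
    match inc x.treeParent with
    | some (.prob t) => some t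
    | _ => q.prob
  let s := x.coin q.round && !q.isSampled && prob.isSome
  if q.clock + 1 = x.diam then
    { q with prob := prob, getsSampled := s, acc := if s then 1 else 0 }
  else { q with prob := prob }

/-- Summation towards node 1: a node passes on what it has, and keeps what arrives. -/
def State.stepCount (x : View V) (q : State V) (inc : V → Option (Msg V)) : State V :=
  { q with
    acc := (if x.isNode1 then q.acc else 0) + ∑ v ∈ x.treeChildren,
      match inc v with
      | some (.count m) => m
      | _ => 0 }

/-- Broadcast of `|S_i|`; in the last slot of this phase `DLGcomp` is initialized. -/
def State.stepTotal (x : View V) (q : State V) (inc : V → Option (Msg V)) : State V :=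
  let total := if x.isNode1 then some q.acc else
    match inc x.treeParent with
    | some (.total m) => some m
    | _ => q.total
  if q.clock + 1 = 4 * x.diam then
    { q with
      total := total
      self := if q.getsSampled then Proc.source x.id x.nbrs else Proc.idle
      relay := fun _ _ => Proc.idle }
  else { q with total := total }

/-- A slot of `DLGcomp`. -/
def State.stepWave (x : View V) (q : State V) (inc : V → Option (Msg V)) : State V :=
  { q with
    self := q.self.waveIn x.diam (q.clock - 4 * x.diam) x.nbrs (q.selfInc x inc)
    relay := fun v j =>
      if v ∈ x.nbrs ∧ 1 ≤ j ∧ j ≤ x.relays v then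
        (q.relay v j).waveIn x.diam (q.clock - 4 * x.diam) {x.id, v} (q.relayInc x inc v j)
      else Proc.idle }

/-- The last slot of `DLGagr` is followed by the test of the threshold. -/
def State.testThreshold (x : View V) (q : State V) : State V :=
  let k := q.numSamples + q.total.getD 0
  let new : Bool := decide ((x.size : ℚ) * x.thr ≤ q.sBC) && q.bc.isNone
  { q with
    numSamples := k
    isSampled := q.isSampled || q.getsSampled
    bc := if new then some ((x.size : ℚ) * q.sBC / (2 * (k : ℚ))) else q.bc
    acc := if new then 1 else 0 }

/-- A slot of `DLGagr`. -/
def State.stepBack (x : View V) (q : State V) (inc : V → Option (Msg V)) : State V :=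
  let q' : State V :=
    { q with
      self := q.self.backIn x.id x.nbrs (q.selfInc x inc)
      sBC := q.sBC + ∑ p ∈ x.nbrs, match q.selfInc x inc p with
        | some (.back r _ _) => q.self.contrib x.id (q.selfInc x inc) r p
        | _ => 0
      relay := fun v j =>
        if v ∈ x.nbrs ∧ 1 ≤ j ∧ j ≤ x.relays v then
          (q.relay v j).relayIn x.id v (q.relayInc x inc v j)
        else Proc.idle }
  if q.clock = 4 * x.diam + 2 * q.last x + 1 then q'.testThreshold x else q'

/-- Summation of the number of nodes that reached the threshold; in the last slot of this phase,
node 1 decides whether to terminate. -/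
def State.stepReport (x : View V) (q : State V) (inc : V → Option (Msg V)) : State V :=
  let q' := q.stepCount x inc
  if q.clock + 1 = 5 * x.diam + 2 * q.last x + 2 ∧ x.isNode1 then
    { q' with
      nBC := q.nBC + q'.acc
      terminated := q.terminated || decide (x.nhat ≤ q.nBC + q'.acc) }
  else q'

/-- Broadcast of "terminate". -/
def State.stepHalt (x : View V) (q : State V) (inc : V → Option (Msg V)) : State V :=
  let q' : State V :=
    match inc x.treeParent with
    | some .halt => { q with terminated := q.terminated || !x.isNode1 }
    | _ => q
  if q.clock + 1 = 6 * x.diam + 2 * q.last x + 2 then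
    { q' with done := true, round := q.round + 1 }
  else q'

/-- The state of a node after a slot. -/
def step (x : View V) (q : State V) (inc : V → Option (Msg V)) : State V :=
  if q.done then q
  else
    let q' :=
      if q.clock < x.diam then q.stepProb x inc
      else if q.clock < 3 * x.diam then q.stepCount x inc
      else if q.clock < 4 * x.diam then q.stepTotal x inc
      else if q.clock ≤ 4 * x.diam + q.last x then q.stepWave x inc
      else if q.clock ≤ 4 * x.diam + 2 * q.last x + 1 then q.stepBack x inc
      else if q.clock < 5 * x.diam + 2 * q.last x + 2 then q.stepReport x inc
      else q.stepHalt x inc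
    { q' with clock := q.clock + 1 }

/-- The program that every node executes in a round of `BCsetup`. -/
def program (V : Type*) [LinearOrder V] : Program V (View V) (Msg V) (State V) where
  send := send
  step := step

end Node

/-! ## Part 6: the network and the execution -/

/-- A connected network with positive symmetric edge weights, the node of smallest identifier
("node 1"), and a breadth-first search tree `T_1` rooted in it. The order on `V` is the order of the
identifiers. -/
structure Network (V : Type*) [Fintype V] [LinearOrder V] where
  graph : SimpleGraph V
  weight : Sym2 V → ℕ
  connected : graph.Connected
  weight_pos : ∀ e ∈ graph.edgeSet, 0 < weight e
  node1 : V
  node1_le : ∀ v, node1 ≤ v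
  /-- the parent in `T_1` of every node but node 1 -/
  treeParent : V → V
  treeParent_adj : ∀ v, v ≠ node1 → graph.Adj v (treeParent v)
  treeParent_dist : ∀ v, v ≠ node1 → graph.dist node1 v = graph.dist node1 (treeParent v) + 1

section Execution

variable {V : Type*} [Fintype V] [LinearOrder V]

/-- The weighted diameter `D_ω` of the network. -/
noncomputable def Network.diam (N : Network V) : ℕ := wdiam N.graph N.weight

open Classical in
/-- The local input of node `u`: `D_ω' = 2 · ecc_ω(node 1)`, `D_h' = 2 · ecc_h(node 1)`;
`β` is the length of the mantissas, `thr` is `τ_c`, `nhat` is `n̂`, and `coin i u` is the outcome of the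
coin of `u` in round `i`. -/
noncomputable def Network.view (N : Network V) (β : ℕ) (thr : ℚ) (nhat : ℕ) (coin : ℕ → V → Bool)
    (u : V) : View V where
  id := u
  size := Fintype.card V
  nbrs := Finset.univ.filter fun v => N.graph.Adj u v
  wt := fun v => if N.graph.Adj u v then N.weight s(u, v) else 0
  isNode1 := decide (u = N.node1)
  treeParent := N.treeParent u
  treeChildren := Finset.univ.filter fun v => v ≠ N.node1 ∧ N.treeParent v = u
  diam := 2 * wecc N.graph N.weight N.node1
  hopDiam := 2 * hopEcc N.graph N.node1
  prec := β
  thr := thr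
  nhat := nhat
  coin := fun i => coin i u

/-- The global state after `t` slots of a round that is started in the global state `q`. -/
noncomputable def Network.during (N : Network V) (x : V → View V) (q : V → State V) (t : ℕ) :
    V → State V :=
  ((program V).slot N.graph x)^[t] fun u => (q u).newRound (x u)

/-- The number of slots of a round that is started in the global state `q`: the first time when all
nodes have completed the round. -/
noncomputable def Network.duration (N : Network V) (x : V → View V) (q : V → State V) : ℕ :=
  sInf {t | ∀ u, (N.during x q t u).done = true}

/-- The global state before round `i` of `BCsetup` (rounds are numbered from `0`). Round `i` is really
executed if in this state no node has learned that the algorithm terminates. -/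
noncomputable def Network.before (N : Network V) (x : V → View V) : ℕ → V → State V
  | 0 => fun _ => State.init
  | i + 1 => N.during x (N.before x i) (N.duration x (N.before x i))

/-- `S_i`: the nodes whose coin selects them in round `i` and in no earlier round. -/
def sampleSet (coin : ℕ → V → Bool) (i : ℕ) : Finset V :=
  Finset.univ.filter fun u => coin i u = true ∧ ∀ j < i, coin j u = false

end Execution

end BCSetup

/-! `DLGcomp` is a local priority protocol; to bound its length and to reverse it, its trace must be
known exactly. The proof rests on a closed form for the whole execution. In the graph of nodes and
relays, neighbouring sites differ by at most 1 in their distance from any root. In increasing order,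
give every root r the d-th slot (counted from 0) that no smaller root has taken. If d is the
distance of r from a site, this is the slot from which the site sends r (`Network.release`); if d is
the smaller of the distances of the two ends of a link, it is the slot in which r crosses the link
(`Network.cross`).

Two greedy schedules whose indices differ by 0 or 1 interleave (`IsSchedule.card_interleave`). Hence
a root crosses every link from a closer site before the farther site releases it, and it crosses
every other link of a site no earlier than its release there. A root that waits, in a delay queue or
for a link, waits in each slot for a smaller root that has its turn in that very slot. The rules of
the protocol produce exactly this, so the closed form is preserved by every slot
(`Network.accept_iff`, `Network.waveIn_delayed`, `Network.waveIn_waveState`), and every relevant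
crossing happens within |S| + D slots.

At a site, a root comes in from the parents before it goes out to the children. In reversed time all
answers of children are therefore in before an answer to a parent is due
(`Network.backState_backOut_iff`). Rounding is idempotent and relays pass on what they get, so the
computed values satisfy recursions over the nodes alone (`Network.tspVal_node`,
`Network.depVal_eq_sum`).

Divided by the number of shortest paths, the exact dependency satisfies the recursion
`relDep_eq_sum`. A rounding costs at most a factor q = 1 - 2^(1-β), and chains of parents have fewer
than n edges. So the result is at least q^(n-1) times the truth, and at most the truth divided by
q^(2(n-1)) (`Network.depVal_bounds`). Bernoulli's inequality and the length of the mantissa turn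
this into 1 ± n^(-c).

It remains to follow the program of a node through the phases of a round. The tree phases are long
enough because hop distances are at most weighted ones, and each node hosts its relays faithfully
(`Hosts.selfInc`, `Hosts.relayInc`). Messages are short because all numbers sent are 0 or between
n^(-n) and n^(n+1), so that even the exponents have O(log n) bits. -/

namespace BCSetup

/-! ### Greedy slot schedules and how they interleave. -/

section Schedule

variable {V : Type*} [LinearOrder V]

/-- The number of elements of `S` below `r` that get a slot before `t`. -/
def countBelow (S : Finset V) (f : V → ℕ) (r : V) (t : ℕ) : ℕ :=
  (S.filter fun r' => r' < r ∧ f r' < t).card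

/-- Greedy slots: in increasing order, `r` takes the `idx r`-th slot (counted from `0`) that is not
taken by a smaller element. -/
structure IsSchedule (S : Finset V) (idx f : V → ℕ) : Prop where
  inj : ∀ r ∈ S, ∀ r' ∈ S, f r = f r' → r = r'
  eq : ∀ r ∈ S, f r = idx r + countBelow S f r (f r)

theorem countBelow_insert_of_lt {S : Finset V} {f : V → ℕ} {r m : V} (h : r ≤ m) (t : ℕ) :
    countBelow (insert m S) f r t = countBelow S f r t := by
  unfold countBelow
  rw [Finset.filter_insert, if_neg (fun h' => absurd h'.1 (not_lt.2 h))]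

theorem countBelow_congr {S : Finset V} {f g : V → ℕ} (r : V) (t : ℕ) (h : ∀ r' ∈ S, f r' = g r') :
    countBelow S f r t = countBelow S g r t := by
  unfold countBelow
  congr 1
  apply Finset.filter_congr
  intro x hx
  rw [h x hx]

/-- Take the least `x` for which `d` plus the number of values up to `x` is at most `x`. Minimality
bounds `x` by the same expression with values below `x`; the two counts then agree, so `x` is not a
value and exactly `d` free slots precede it. -/
theorem exists_free_slot {V : Type*} (S : Finset V) (f : V → ℕ) (d : ℕ) :
    ∃ x, (∀ r ∈ S, f r ≠ x) ∧ x = d + (S.filter fun r => f r < x).card := by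
  have hex : ∃ x, d + (S.filter fun r => f r ≤ x).card ≤ x :=
    ⟨d + S.card, Nat.add_le_add_left (Finset.card_filter_le _ _) _⟩
  classical
  set x := Nat.find hex with hx
  have h1 : d + (S.filter fun r => f r ≤ x).card ≤ x := Nat.find_spec hex
  have hle : (S.filter fun r => f r < x) ⊆ S.filter fun r => f r ≤ x :=
    Finset.monotone_filter_right _ fun _ _ h => le_of_lt h
  have h2 : x ≤ d + (S.filter fun r => f r < x).card := by
    rcases Nat.eq_zero_or_pos x with h0 | hpos
    · omega
    · have := Nat.find_min hex (m := x - 1) (by omega)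
      have h3 : (S.filter fun r => f r ≤ x - 1) = S.filter fun r => f r < x := by
        apply Finset.filter_congr; intros; omega
      rw [h3] at this
      omega
  have h4 := Finset.card_le_card hle
  have h5 : (S.filter fun r => f r < x) = S.filter fun r => f r ≤ x :=
    Finset.eq_of_subset_of_card_le hle (by omega)
  refine ⟨x, fun r hr he => ?_, by omega⟩
  have : r ∈ S.filter fun r => f r ≤ x := by simp [hr, he]
  rw [← h5] at this
  simp [he] at this

/-- A new maximum does not disturb the slots of smaller elements, so it can simply be given its free
slot. -/
theorem IsSchedule.exists (S : Finset V) (idx : V → ℕ) : ∃ f, IsSchedule S idx f := by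
  induction S using Finset.induction_on_max with
  | empty => exact ⟨fun _ => 0, by simp, by simp⟩
  | insert m S hm ih =>
    obtain ⟨f, hf⟩ := ih
    obtain ⟨x, hx1, hx2⟩ := exists_free_slot S f (idx m)
    have hne : ∀ r ∈ S, r ≠ m := fun r hr => (hm r hr).ne
    have hg : ∀ r ∈ S, Function.update f m x r = f r := fun r hr => by
      simp [Function.update_of_ne (hne r hr)]
    refine ⟨Function.update f m x, ?_, ?_⟩
    · intro r hr r' hr' he
      rcases Finset.mem_insert.1 hr with rfl | hrS <;> rcases Finset.mem_insert.1 hr' with rfl | hrS'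
      · rfl
      · rw [hg _ hrS', Function.update_self] at he
        exact absurd he.symm (hx1 _ hrS')
      · rw [hg _ hrS, Function.update_self] at he
        exact absurd he (hx1 _ hrS)
      · rw [hg _ hrS, hg _ hrS'] at he
        exact hf.inj _ hrS _ hrS' he
    · intro r hr
      rcases Finset.mem_insert.1 hr with rfl | hrS
      · rw [countBelow_insert_of_lt le_rfl, countBelow_congr _ _ hg, Function.update_self]
        have : countBelow S f r x = (S.filter fun r => f r < x).card := by
          unfold countBelow
          congr 1
          apply Finset.filter_congr
          intro a ha
          simp [hm a ha]
        rw [this]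
        exact hx2
      · rw [countBelow_insert_of_lt (hm r hrS).le, countBelow_congr _ _ hg, hg r hrS]
        exact hf.eq r hrS

theorem IsSchedule.countBelow_succ_le {S : Finset V} {idx f : V → ℕ} (hf : IsSchedule S idx f)
    (r : V) (t : ℕ) : countBelow S f r (t + 1) ≤ countBelow S f r t + 1 := by
  unfold countBelow
  have : (S.filter fun r' => r' < r ∧ f r' < t + 1) ⊆
      (S.filter fun r' => r' < r ∧ f r' < t) ∪ S.filter fun r' => f r' = t := by
    intro a ha
    simp only [Finset.mem_union, Finset.mem_filter] at ha ⊢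
    have := ha.2.2
    rcases Nat.lt_succ_iff_lt_or_eq.1 this with h | h
    · exact Or.inl ⟨ha.1, ha.2.1, h⟩
    · exact Or.inr ⟨ha.1, h⟩
  have h1 : (S.filter fun r' => f r' = t).card ≤ 1 := by
    apply Finset.card_le_one.2
    intro a ha b hb
    simp only [Finset.mem_filter] at ha hb
    exact hf.inj _ ha.1 _ hb.1 (ha.2.trans hb.2.symm)
  have h2 := Finset.card_le_card this
  have h3 := Finset.card_union_le (S.filter fun r' => r' < r ∧ f r' < t) (S.filter fun r' => f r' = t)
  omega

theorem IsSchedule.countBelow_le {S : Finset V} {idx f : V → ℕ} (hf : IsSchedule S idx f)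
    (r : V) (t s : ℕ) : countBelow S f r (t + s) ≤ countBelow S f r t + s := by
  induction s with
  | zero => simp
  | succ s ih =>
    have := hf.countBelow_succ_le r (t + s)
    rw [← add_assoc]
    omega

theorem countBelow_succ_of_forall_ne {S : Finset V} {f : V → ℕ} {r : V} {t : ℕ}
    (h : ∀ r' ∈ S, r' < r → f r' ≠ t) : countBelow S f r (t + 1) = countBelow S f r t := by
  unfold countBelow
  congr 1
  apply Finset.filter_congr
  intro a ha
  constructor
  · rintro ⟨h1, h2⟩
    exact ⟨h1, by have := h a ha h1; omega⟩
  · rintro ⟨h1, h2⟩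
    exact ⟨h1, by omega⟩

/-- The number `t - countBelow S f r t` of slots before `t` left free by smaller elements is
nondecreasing in `t`. It equals `idx r` at `t = f r` and is larger just after, since slot `f r` is
not taken by a smaller element. This replaces the fixed-point equation by a test at an arbitrary
time. -/
theorem IsSchedule.lt_iff {S : Finset V} {idx f : V → ℕ} (hf : IsSchedule S idx f)
    {r : V} (hr : r ∈ S) (t : ℕ) : f r < t ↔ idx r + countBelow S f r t < t := by
  have he := hf.eq r hr
  have h0 : countBelow S f r (f r + 1) = countBelow S f r (f r) :=
    countBelow_succ_of_forall_ne fun r' hr' hlt h => hlt.ne (hf.inj _ hr' _ hr h)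
  constructor
  · intro h
    have := hf.countBelow_le r (f r + 1) (t - (f r + 1))
    rw [show f r + 1 + (t - (f r + 1)) = t by omega] at this
    omega
  · intro h
    by_contra hlt
    have := hf.countBelow_le r t (f r - t)
    rw [show t + (f r - t) = f r by omega] at this
    omega

theorem IsSchedule.of_insert {S : Finset V} {m : V} {idx f : V → ℕ}
    (hf : IsSchedule (insert m S) idx f) (hm : ∀ x ∈ S, x < m) : IsSchedule S idx f where
  inj r hr r' hr' := hf.inj r (Finset.mem_insert_of_mem hr) r' (Finset.mem_insert_of_mem hr')
  eq r hr := by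
    rw [← countBelow_insert_of_lt (hm r hr).le]
    exact hf.eq r (Finset.mem_insert_of_mem hr)

theorem IsSchedule.filter_lt {S : Finset V} {idx f : V → ℕ}
    (hf : IsSchedule S idx f) (q : V) : IsSchedule (S.filter (· < q)) idx f where
  inj r hr r' hr' := hf.inj r (Finset.mem_of_mem_filter _ hr) r' (Finset.mem_of_mem_filter _ hr')
  eq r hr := by
    have h1 := hf.eq r (Finset.mem_of_mem_filter _ hr)
    have h2 : countBelow (S.filter (· < q)) f r (f r) = countBelow S f r (f r) := by
      unfold countBelow
      rw [Finset.filter_filter]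
      congr 1
      apply Finset.filter_congr
      intro a _
      have := (Finset.mem_filter.1 hr).2
      constructor
      · exact fun h => h.2
      · exact fun h => ⟨h.1.trans this, h⟩
    rw [h2]
    exact h1

/-- Raising indices by at most 1 delays the counting function by at most one slot. In the induction
the maximum adds at most 1 to each count, so an inequality can only fail where it was tight before;
with equal counts, `IsSchedule.lt_iff` compares just the indices of the maximum. -/
theorem IsSchedule.card_interleave {S : Finset V} {idx idx' f f' : V → ℕ}
    (hf : IsSchedule S idx f) (hf' : IsSchedule S idx' f')
    (h1 : ∀ r ∈ S, idx r ≤ idx' r) (h2 : ∀ r ∈ S, idx' r ≤ idx r + 1) (t : ℕ) :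
    (S.filter fun r => f' r < t).card ≤ (S.filter fun r => f r < t).card ∧
    (S.filter fun r => f r < t).card ≤ (S.filter fun r => f' r < t + 1).card := by
  induction S using Finset.induction_on_max with
  | empty => simp
  | insert m S hm ih =>
    have hmS : m ∉ S := fun h => lt_irrefl _ (hm m h)
    obtain ⟨i1, i2⟩ := ih (hf.of_insert hm) (hf'.of_insert hm)
      (fun r hr => h1 r (Finset.mem_insert_of_mem hr))
      (fun r hr => h2 r (Finset.mem_insert_of_mem hr))
    have hc : ∀ (g : V → ℕ) (t : ℕ), countBelow (insert m S) g m t =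
        (S.filter fun r => g r < t).card := fun g t => by
      rw [countBelow_insert_of_lt le_rfl]
      unfold countBelow
      congr 1
      apply Finset.filter_congr
      intro a ha
      simp [hm a ha]
    have hi : ∀ (g : V → ℕ) (t : ℕ), ((insert m S).filter fun r => g r < t).card =
        (S.filter fun r => g r < t).card + if g m < t then 1 else 0 := fun g t => by
      rw [Finset.filter_insert]
      split_ifs
      · rw [Finset.card_insert_of_notMem (by simp [hmS])]
      · simp
    have hm' := Finset.mem_insert_self m S
    have a1 := hf.lt_iff hm' t
    have a2 := hf'.lt_iff hm' t
    have a3 := hf'.lt_iff hm' (t + 1)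
    have a4 := h1 m hm'
    have a5 := h2 m hm'
    rw [hc] at a1 a2 a3
    rw [hi, hi, hi]
    constructor <;> split_ifs <;> omega

theorem IsSchedule.countBelow_interleave {S : Finset V} {idx idx' f f' : V → ℕ}
    (hf : IsSchedule S idx f) (hf' : IsSchedule S idx' f')
    (h1 : ∀ r ∈ S, idx r ≤ idx' r) (h2 : ∀ r ∈ S, idx' r ≤ idx r + 1) (r : V) (t : ℕ) :
    countBelow S f' r t ≤ countBelow S f r t ∧
    countBelow S f r t ≤ countBelow S f' r (t + 1) := by
  have := (hf.filter_lt r).card_interleave (hf'.filter_lt r)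
    (fun r hr => h1 r (Finset.mem_of_mem_filter _ hr))
    (fun r hr => h2 r (Finset.mem_of_mem_filter _ hr)) t
  simpa only [countBelow, Finset.filter_filter] using this

/-- The greedy schedule. -/
noncomputable def schedule (S : Finset V) (idx : V → ℕ) : V → ℕ :=
  (IsSchedule.exists S idx).choose

theorem schedule_spec (S : Finset V) (idx : V → ℕ) : IsSchedule S idx (schedule S idx) :=
  (IsSchedule.exists S idx).choose_spec

variable {S : Finset V} {idx idx' : V → ℕ} {r : V}

theorem le_schedule (hr : r ∈ S) : idx r ≤ schedule S idx r := by
  have := (schedule_spec S idx).eq r hr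
  omega

theorem schedule_lt (hr : r ∈ S) : schedule S idx r < idx r + S.card := by
  have h := (schedule_spec S idx).eq r hr
  have : countBelow S (schedule S idx) r (schedule S idx r) < S.card := by
    apply Finset.card_lt_card
    rw [Finset.filter_ssubset]
    exact ⟨r, hr, by simp⟩
  omega

theorem schedule_inj {r' : V} (hr : r ∈ S) (hr' : r' ∈ S)
    (h : schedule S idx r = schedule S idx r') : r = r' :=
  (schedule_spec S idx).inj r hr r' hr' h

theorem schedule_eq_zero (hr : r ∈ S) (h0 : idx r = 0) (h : ∀ r' ∈ S, r' < r → idx r' ≠ 0) :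
    schedule S idx r = 0 := by
  have h1 := ((schedule_spec S idx).lt_iff hr 1).2
  have h2 : countBelow S (schedule S idx) r 1 = 0 := by
    apply Finset.card_eq_zero.2
    rw [Finset.filter_eq_empty_iff]
    rintro r' hr' ⟨hlt, h3⟩
    have := le_schedule (idx := idx) hr'
    have := h r' hr' hlt
    omega
  omega

/-- With the larger index, `r` is served in a slot by the end of which the smaller elements have
taken at least as many slots as the first schedule gives them strictly before it. -/
theorem schedule_lt_schedule (h1 : ∀ r ∈ S, idx r ≤ idx' r) (h2 : ∀ r ∈ S, idx' r ≤ idx r + 1)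
    (hr : r ∈ S) (h : idx' r = idx r + 1) : schedule S idx r < schedule S idx' r := by
  have hf := schedule_spec S idx
  have hf' := schedule_spec S idx'
  rw [hf.lt_iff hr]
  have a := (hf'.lt_iff hr (schedule S idx' r + 1)).1 (Nat.lt_succ_self _)
  have b := (hf.countBelow_interleave hf' h1 h2 r (schedule S idx' r)).2
  omega

/-- Larger indices only delay the competitors, so `r` itself, whose index stays the same, finds at
least as many free slots at any time. -/
theorem schedule_le_schedule (h1 : ∀ r ∈ S, idx r ≤ idx' r) (h2 : ∀ r ∈ S, idx' r ≤ idx r + 1)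
    (hr : r ∈ S) (h : idx' r = idx r) : schedule S idx' r ≤ schedule S idx r := by
  have hf := schedule_spec S idx
  have hf' := schedule_spec S idx'
  rw [← Nat.lt_succ_iff, Nat.succ_eq_add_one, hf'.lt_iff hr]
  have a := (hf.lt_iff hr (schedule S idx r + 1)).1 (Nat.lt_succ_self _)
  have b := (hf.countBelow_interleave hf' h1 h2 r (schedule S idx r + 1)).1
  omega

/-- If slot `t` were free of smaller elements in the later schedule, the interleaved counts would
already give `r` its turn by slot `t`. This justifies the delay queue: whoever has arrived but is
not released sees a smaller root being released. -/
theorem exists_schedule_eq_of_waiting {t : ℕ} (h1 : ∀ r ∈ S, idx r ≤ idx' r)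
    (h2 : ∀ r ∈ S, idx' r ≤ idx r + 1)
    (hr : r ∈ S) (h : idx' r = idx r + 1) (hlt : schedule S idx r < t)
    (hgt : t < schedule S idx' r) : ∃ r' ∈ S, r' < r ∧ schedule S idx' r' = t := by
  by_contra! hne
  have hf := schedule_spec S idx
  have hf' := schedule_spec S idx'
  have a := (hf.lt_iff hr t).1 hlt
  have b := mt (hf'.lt_iff hr (t + 1)).2 (by omega)
  rw [countBelow_succ_of_forall_ne hne] at b
  have := (hf.countBelow_interleave hf' h1 h2 r t).1
  omega

/-- The counterpart of `exists_schedule_eq_of_waiting` for a link: whoever is released but has not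
crossed sees a smaller root crossing, possibly in the opposite direction. -/
theorem exists_schedule_eq_of_blocked {t : ℕ} (h1 : ∀ r ∈ S, idx r ≤ idx' r)
    (h2 : ∀ r ∈ S, idx' r ≤ idx r + 1)
    (hr : r ∈ S) (h : idx' r = idx r) (hle : schedule S idx' r ≤ t)
    (hgt : t < schedule S idx r) : ∃ r' ∈ S, r' < r ∧ schedule S idx r' = t := by
  by_contra! hne
  have hf := schedule_spec S idx
  have hf' := schedule_spec S idx'
  have a := (hf'.lt_iff hr (t + 1)).1 (by omega)
  have b := mt (hf.lt_iff hr (t + 1)).2 (by omega)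
  rw [countBelow_succ_of_forall_ne hne] at b
  have := (hf.countBelow_interleave hf' h1 h2 r t).2
  omega

end Schedule

end BCSetup

/-! ### Weighted distances, counting shortest paths, and the recursion for dependencies. -/

namespace BCSetup

section Metric

variable {V : Type*} {G : SimpleGraph V} {w : Sym2 V → ℕ}

theorem walkWeight_concat {u v x : V} (p : G.Walk u v) (h : G.Adj v x) :
    walkWeight w (p.concat h) = walkWeight w p + w s(v, x) := by
  simp [walkWeight, SimpleGraph.Walk.edges_concat]

theorem walkWeight_append {u v x : V} (p : G.Walk u v) (q : G.Walk v x) :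
    walkWeight w (p.append q) = walkWeight w p + walkWeight w q := by
  simp [walkWeight, SimpleGraph.Walk.edges_append]

theorem walkWeight_reverse {u v : V} (p : G.Walk u v) :
    walkWeight w p.reverse = walkWeight w p := by
  simp [walkWeight, SimpleGraph.Walk.edges_reverse, List.sum_reverse]

/-- Cutting out the cycles of a walk cannot increase its weight. The distance thus bounds all walks,
which unlike paths can be joined freely. -/
theorem wdist_le_walkWeight {u v : V} (p : G.Walk u v) : wdist G w u v ≤ walkWeight w p := by
  classical
  refine le_trans (Nat.sInf_le ⟨p.bypass, p.bypass_isPath, rfl⟩) ?_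
  exact List.Sublist.sum_le_sum ((p.edges_bypass_sublist_edges).map w) (by simp)

theorem exists_shortest (hG : G.Connected) (u v : V) :
    ∃ p : G.Walk u v, p.IsPath ∧ walkWeight w p = wdist G w u v := by
  classical
  obtain ⟨p⟩ := hG.preconnected u v
  exact Nat.sInf_mem (s := {k : ℕ | ∃ p : G.Walk u v, p.IsPath ∧ walkWeight w p = k})
    ⟨_, p.bypass, p.bypass_isPath, rfl⟩

theorem wdist_self (u : V) : wdist G w u u = 0 :=
  Nat.le_zero.1 (wdist_le_walkWeight (SimpleGraph.Walk.nil : G.Walk u u))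

theorem wdist_comm (hG : G.Connected) (u v : V) : wdist G w u v = wdist G w v u := by
  have key : ∀ u v, wdist G w u v ≤ wdist G w v u := fun u v => by
    obtain ⟨p, _, hp⟩ := exists_shortest (w := w) hG v u
    rw [← hp, ← walkWeight_reverse]
    exact wdist_le_walkWeight _
  exact le_antisymm (key _ _) (key _ _)

theorem wdist_triangle (hG : G.Connected) (u v x : V) :
    wdist G w u x ≤ wdist G w u v + wdist G w v x := by
  obtain ⟨p, _, hp⟩ := exists_shortest (w := w) hG u v
  obtain ⟨q, _, hq⟩ := exists_shortest (w := w) hG v x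
  rw [← hp, ← hq, ← walkWeight_append]
  exact wdist_le_walkWeight _

theorem wdist_le_add (hG : G.Connected) (s : V) {u v : V} (h : G.Adj u v) :
    wdist G w s v ≤ wdist G w s u + w s(u, v) := by
  obtain ⟨p, _, hp⟩ := exists_shortest (w := w) hG s u
  rw [← hp, ← walkWeight_concat p h]
  exact wdist_le_walkWeight _

theorem length_le_walkWeight (hw : ∀ e ∈ G.edgeSet, 0 < w e) {u v : V} (p : G.Walk u v) :
    p.length ≤ walkWeight w p := by
  rw [walkWeight, ← p.length_edges, ← List.length_map (f := w)]
  apply List.length_le_sum_of_one_le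
  intro i hi
  obtain ⟨e, he, rfl⟩ := List.mem_map.1 hi
  exact hw e (p.edges_subset_edgeSet he)

theorem dist_le_wdist (hG : G.Connected) (hw : ∀ e ∈ G.edgeSet, 0 < w e) (u v : V) :
    G.dist u v ≤ wdist G w u v := by
  obtain ⟨p, _, hp⟩ := exists_shortest (w := w) hG u v
  rw [← hp]
  exact (SimpleGraph.dist_le p).trans (length_le_walkWeight hw p)

theorem wdist_eq_zero_iff (hG : G.Connected) (hw : ∀ e ∈ G.edgeSet, 0 < w e) {u v : V} :
    wdist G w u v = 0 ↔ u = v := by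
  constructor
  · intro h
    have := dist_le_wdist (w := w) hG hw u v
    exact hG.dist_eq_zero_iff.1 (by omega)
  · rintro rfl
    exact wdist_self u

/-- `p` is a parent of `v` in the leveled graph of `s`. -/
def IsParent (G : SimpleGraph V) (w : Sym2 V → ℕ) (s p v : V) : Prop :=
  G.Adj p v ∧ wdist G w s v = wdist G w s p + w s(p, v)

theorem IsParent.wdist_lt (hw : ∀ e ∈ G.edgeSet, 0 < w e) {s p v : V} (h : IsParent G w s p v) :
    wdist G w s p < wdist G w s v := by
  have := hw s(p, v) h.1
  have := h.2
  omega

theorem isParent_of_concat_shortest (hG : G.Connected) {s p v : V} {q : G.Walk s p}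
    {h : G.Adj p v} (hq : q.concat h ∈ shortestPaths G w s v) :
    IsParent G w s p v ∧ q ∈ shortestPaths G w s p := by
  obtain ⟨h1, h2⟩ := hq
  rw [walkWeight_concat] at h2
  have h3 := wdist_le_walkWeight (w := w) q
  have h4 := wdist_le_add (w := w) hG s h
  exact ⟨⟨h, by omega⟩, ((SimpleGraph.Walk.concat_isPath_iff h).1 h1).1, by omega⟩

theorem exists_isParent (hG : G.Connected) {s v : V} (h : v ≠ s) : ∃ p, IsParent G w s p v := by
  obtain ⟨q, hq⟩ := exists_shortest (w := w) hG s v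
  have hn : ¬ q.Nil := fun hn => h hn.eq.symm
  have ha := q.adj_penultimate hn
  have := SimpleGraph.Walk.concat_dropLast ha
  exact ⟨_, (isParent_of_concat_shortest hG (q := q.dropLast) (h := ha) (by rw [this]; exact hq)).1⟩

/-- A shortest path split at `v` yields two walks no lighter than the respective distances, which
forces equality in the triangle inequality. -/
theorem wdist_le_of_mem_support (hG : G.Connected) {s t v : V} {q : G.Walk s t}
    (hq : q ∈ shortestPaths G w s t) (hv : v ∈ q.support) :
    wdist G w s t = wdist G w s v + wdist G w v t := by
  classical
  have h1 := q.take_spec hv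
  have h2 := hq.2
  rw [← h1, walkWeight_append] at h2
  have h3 := wdist_le_walkWeight (w := w) (q.takeUntil v hv)
  have h4 := wdist_le_walkWeight (w := w) (q.dropUntil v hv)
  have := wdist_triangle (w := w) hG s v t
  omega

theorem concat_mem_shortestPaths (hG : G.Connected) (hw : ∀ e ∈ G.edgeSet, 0 < w e) {s p v : V}
    (h : IsParent G w s p v) {q : G.Walk s p} (hq : q ∈ shortestPaths G w s p) :
    q.concat h.1 ∈ shortestPaths G w s v := by
  refine ⟨hq.1.concat (fun hv => ?_) h.1, by rw [walkWeight_concat, hq.2, h.2]⟩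
  have := wdist_le_of_mem_support hG hq hv
  have := h.wdist_lt hw
  omega

theorem sigmaThrough_self (s t : V) : sigmaThrough G w s t t = sigma G w s t := by
  simp [sigmaThrough, sigma]

theorem sigma_self (s : V) :
    sigma G w s s = 1 := by
  unfold sigma
  rw [Set.ncard_eq_one]
  refine ⟨SimpleGraph.Walk.nil, ?_⟩
  ext q
  simp only [Set.mem_singleton_iff, shortestPaths, Set.mem_ofPred_eq, wdist_self]
  constructor
  · rintro ⟨h, _⟩
    exact (SimpleGraph.Walk.isPath_iff_nil.1 h).eq_nil
  · rintro rfl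
    simp [walkWeight]

theorem sigmaThrough_eq_zero (hG : G.Connected) (hw : ∀ e ∈ G.edgeSet, 0 < w e) {s t v : V}
    (hv : v ≠ t) (h : wdist G w s t ≤ wdist G w s v) : sigmaThrough G w s t v = 0 := by
  have he : {p ∈ shortestPaths G w s t | v ∈ p.support} = ∅ := by
    rw [Set.eq_empty_iff_forall_notMem]
    rintro q ⟨h1, h2⟩
    have := wdist_le_of_mem_support hG h1 h2
    exact hv ((wdist_eq_zero_iff (w := w) hG hw).1 (by omega))
  rw [sigmaThrough, he, Set.ncard_empty]

variable [Fintype V]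

theorem finite_shortestPaths (s t : V) : (shortestPaths G w s t).Finite := by
  classical
  refine (Set.finite_range fun p : G.Path s t => (p : G.Walk s t)).subset ?_
  intro q hq
  exact ⟨⟨q, hq.1⟩, rfl⟩

open Classical in
-- Removing the last edge is a bijection onto the shortest paths to the parents of `t`. The property
-- `P`, insensitive to the last edge, lets one bijection serve both for all paths and for those
-- through a given node.
theorem ncard_shortestPaths_eq_sum (hG : G.Connected) (hw : ∀ e ∈ G.edgeSet, 0 < w e) {s t : V}
    (hst : t ≠ s) (P : ∀ x, G.Walk s x → Prop)
    (hP : ∀ p (q : G.Walk s p) (h : G.Adj p t), P t (q.concat h) ↔ P p q) :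
    {q ∈ shortestPaths G w s t | P t q}.ncard =
      ∑ p ∈ Finset.univ.filter (fun p => IsParent G w s p t),
        {q ∈ shortestPaths G w s p | P p q}.ncard := by
  have hfin : ∀ x, {q ∈ shortestPaths G w s x | P x q}.Finite := fun x =>
    (finite_shortestPaths s x).subset fun _ h => h.1
  have hnil : ∀ q : G.Walk s t, ¬ q.Nil := fun q hn => hst hn.eq.symm
  have hdl : ∀ q : G.Walk s t, q.dropLast.concat (q.adj_penultimate (hnil q)) = q := fun q =>
    SimpleGraph.Walk.concat_dropLast _
  rw [Set.ncard_eq_toFinset_card _ (hfin t)]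
  rw [Finset.card_eq_sum_card_fiberwise (f := fun q : G.Walk s t => q.penultimate)
    (t := Finset.univ.filter (fun p => IsParent G w s p t))]
  · apply Finset.sum_congr rfl
    intro p hp
    have hp' : IsParent G w s p t := (Finset.mem_filter.1 hp).2
    rw [Set.ncard_eq_toFinset_card _ (hfin p)]
    symm
    apply Finset.card_bij (fun q _ => q.concat hp'.1)
    · intro q hq
      simp only [Set.Finite.mem_toFinset, Set.mem_ofPred_eq] at hq
      simp only [Finset.mem_filter, Set.Finite.mem_toFinset, Set.mem_ofPred_eq,
        SimpleGraph.Walk.penultimate_concat, and_true]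
      exact ⟨concat_mem_shortestPaths hG hw hp' hq.1, (hP _ _ _).2 hq.2⟩
    · intro q _ q' _ h
      obtain ⟨_, h'⟩ := SimpleGraph.Walk.concat_inj h
      simpa using h'
    · intro q hq
      simp only [Finset.mem_filter, Set.Finite.mem_toFinset, Set.mem_ofPred_eq] at hq
      obtain ⟨⟨h1, h2⟩, rfl⟩ := hq
      rw [← hdl q] at h1 h2
      refine ⟨q.dropLast, ?_, hdl q⟩
      simp only [Set.Finite.mem_toFinset, Set.mem_ofPred_eq]
      exact ⟨(isParent_of_concat_shortest hG h1).2, (hP _ _ _).1 h2⟩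
  · intro q hq
    simp only [Set.Finite.coe_toFinset, Set.mem_ofPred_eq] at hq
    have h1 := hq.1
    rw [← hdl q] at h1
    simpa using (isParent_of_concat_shortest hG h1).1

open Classical in
theorem sigma_eq_sum (hG : G.Connected) (hw : ∀ e ∈ G.edgeSet, 0 < w e) {s t : V} (hst : t ≠ s) :
    sigma G w s t = ∑ p ∈ Finset.univ.filter (fun p => IsParent G w s p t), sigma G w s p := by
  have := ncard_shortestPaths_eq_sum hG hw hst (fun _ _ => True) (by simp)
  simpa [sigma] using this

open Classical in
theorem sigmaThrough_eq_sum (hG : G.Connected) (hw : ∀ e ∈ G.edgeSet, 0 < w e) {s t v : V}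
    (hst : t ≠ s) (hv : v ≠ t) : sigmaThrough G w s t v =
      ∑ p ∈ Finset.univ.filter (fun p => IsParent G w s p t), sigmaThrough G w s p v := by
  refine ncard_shortestPaths_eq_sum hG hw hst (fun _ q => v ∈ q.support) ?_
  intro p q h
  simp [SimpleGraph.Walk.support_concat, hv]

theorem sigma_pos (hG : G.Connected) (s t : V) : 0 < sigma G w s t := by
  rw [sigma, Set.ncard_pos (finite_shortestPaths s t)]
  exact exists_shortest hG s t

theorem sigmaThrough_le (s t v : V) : sigmaThrough G w s t v ≤ sigma G w s t :=
  Set.ncard_le_ncard (fun _ h => h.1) (finite_shortestPaths s t)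

open Classical in
-- The quotient counts the continuations from `u` to `t` of shortest paths, and each of them starts
-- with an edge to exactly one child of `u`. Formally this is an induction on the distance of `t`,
-- expanding both sides along the last edge.
theorem sigmaThrough_div_eq_sum (hG : G.Connected) (hw : ∀ e ∈ G.edgeSet, 0 < w e) {s u : V}
    (hus : u ≠ s) (t : V) (htu : t ≠ u) :
    (sigmaThrough G w s t u : ℝ) / sigma G w s u =
      ∑ x ∈ Finset.univ.filter (fun x => IsParent G w s u x),
        (sigmaThrough G w s t x : ℝ) / sigma G w s x := by
  induction hk : wdist G w s t using Nat.strong_induction_on generalizing t with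
  | _ k ih =>
  have hσ : ∀ x, (sigma G w s x : ℝ) ≠ 0 := fun x => by
    have := sigma_pos (w := w) hG s x
    positivity
  by_cases hts : t = s
  · subst hts
    rw [sigmaThrough_eq_zero hG hw hus (by simp [wdist_self]), Finset.sum_eq_zero]
    · simp
    · intro x hx
      have hx' := (Finset.mem_filter.1 hx).2.wdist_lt hw
      rw [sigmaThrough_eq_zero hG hw (by rintro rfl; simp [wdist_self] at hx')
        (by simp [wdist_self])]
      simp
  · have hlhs : (sigmaThrough G w s t u : ℝ) / sigma G w s u =
        ∑ p ∈ Finset.univ.filter (fun p => IsParent G w s p t),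
          ((if p = u then 1 else 0) + ∑ x ∈ Finset.univ.filter (fun x => IsParent G w s u x),
            (sigmaThrough G w s p x : ℝ) / sigma G w s x) := by
      rw [sigmaThrough_eq_sum hG hw hts htu.symm, Nat.cast_sum, Finset.sum_div]
      apply Finset.sum_congr rfl
      intro p hp
      have hp' := (Finset.mem_filter.1 hp).2
      by_cases hpu : p = u
      · subst hpu
        rw [sigmaThrough_self, div_self (hσ _), Finset.sum_eq_zero]
        · simp
        · intro x hx
          have hx' := (Finset.mem_filter.1 hx).2.wdist_lt hw
          rw [sigmaThrough_eq_zero hG hw (by rintro rfl; simp at hx') hx'.le]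
          simp
      · rw [ih _ (hk ▸ hp'.wdist_lt hw) p hpu rfl, if_neg hpu, zero_add]
    have hrhs : ∑ x ∈ Finset.univ.filter (fun x => IsParent G w s u x),
        (sigmaThrough G w s t x : ℝ) / sigma G w s x =
        ∑ x ∈ Finset.univ.filter (fun x => IsParent G w s u x),
          ((if x = t then 1 else 0) + ∑ p ∈ Finset.univ.filter (fun p => IsParent G w s p t),
            (sigmaThrough G w s p x : ℝ) / sigma G w s x) := by
      apply Finset.sum_congr rfl
      intro x hx
      by_cases hxt : x = t
      · subst hxt
        rw [sigmaThrough_self, div_self (hσ _), Finset.sum_eq_zero]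
        · simp
        · intro p hp
          have hp' := (Finset.mem_filter.1 hp).2.wdist_lt hw
          rw [sigmaThrough_eq_zero hG hw (by rintro rfl; simp at hp') hp'.le]
          simp
      · rw [sigmaThrough_eq_sum hG hw hts hxt, Nat.cast_sum, Finset.sum_div, if_neg hxt, zero_add]
    -- The parent `p = u` of `t` on the left and the child `x = t` of `u` on the right are the
    -- exceptional terms. Both contribute 1, precisely if `u` is a parent of `t`; all other terms
    -- agree after exchanging the sums.
    rw [hlhs, hrhs, Finset.sum_add_distrib, Finset.sum_add_distrib, Finset.sum_comm]
    congr 1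
    simp [Finset.sum_ite_eq']

/-- The dependency relative to the number of shortest paths. -/
noncomputable def relDep (G : SimpleGraph V) (w : Sym2 V → ℕ) (s u : V) : ℝ :=
  dependency G w s u / sigma G w s u

open Classical in
-- `sigmaThrough_div_eq_sum`, divided by the number of shortest paths to `t` and summed over all
-- targets `t`. After division by the path count of `u`, the recursion no longer contains that
-- count, so its rounding error can be treated separately.
theorem relDep_eq_sum (hG : G.Connected) (hw : ∀ e ∈ G.edgeSet, 0 < w e) {s u : V}
    (hus : u ≠ s) : relDep G w s u =
      ∑ x ∈ Finset.univ.filter (fun x => IsParent G w s u x),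
        (1 / (sigma G w s x : ℝ) + relDep G w s x) := by
  have hσ : ∀ x, (sigma G w s x : ℝ) ≠ 0 := fun x => by
    have := sigma_pos (w := w) hG s x
    positivity
  have h1 : ∀ v, v ≠ s → relDep G w s v = ∑ t, if t ≠ v then
      (sigmaThrough G w s t v : ℝ) / sigma G w s v / sigma G w s t else 0 := by
    intro v hv
    rw [relDep, dependency, Finset.sum_div, ← Finset.sum_filter]
    apply Finset.sum_congr
    · simp [hv]
    · intros
      rw [div_right_comm]
  have h2 : ∀ x, IsParent G w s u x → 1 / (sigma G w s x : ℝ) + relDep G w s x =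
      ∑ t, if t ≠ u then (sigmaThrough G w s t x : ℝ) / sigma G w s x / sigma G w s t else 0 := by
    intro x hx
    have hx' := hx.wdist_lt hw
    rw [h1 x (by rintro rfl; simp [wdist_self] at hx')]
    -- The summand 1/σ is the target `t = x`, which the dependency of `x` leaves out but that of its
    -- parent includes.
    have : (1 : ℝ) / (sigma G w s x : ℝ) = ∑ t, if t = x then 1 / (sigma G w s x : ℝ) else 0 := by
      simp
    rw [this, ← Finset.sum_add_distrib]
    apply Finset.sum_congr rfl
    intro t _
    by_cases htx : t = x
    · subst htx
      have : t ≠ u := by rintro rfl; simp at hx'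
      simp [this, sigmaThrough_self, hσ]
    · by_cases htu : t = u
      · subst htu
        rw [sigmaThrough_eq_zero hG hw (Ne.symm htx) hx'.le]
        simp [htx]
      · simp [htx, htu]
  rw [h1 u hus, Finset.sum_congr rfl (fun x hx => h2 x (Finset.mem_filter.1 hx).2),
    Finset.sum_comm]
  apply Finset.sum_congr rfl
  intro t _
  split_ifs with h
  · rw [sigmaThrough_div_eq_sum hG hw hus t h, Finset.sum_div]
  · simp

theorem dependency_self (s : V) : dependency G w s s = 0 := by
  simp [dependency]

theorem dependency_nonneg (s u : V) : 0 ≤ dependency G w s u :=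
  Finset.sum_nonneg fun _ _ => by positivity

theorem dependency_le_card (s u : V) : dependency G w s u ≤ Fintype.card V := by
  classical
  unfold dependency
  refine (Finset.sum_le_card_nsmul _ _ 1 ?_).trans ?_
  · intro t _
    apply div_le_one_of_le₀ _ (by positivity)
    exact_mod_cast sigmaThrough_le s t u
  · rw [nsmul_eq_mul, mul_one]
    exact_mod_cast Finset.card_le_univ _

/-- The number of nodes that are closer to `s` than `u` is. -/
noncomputable def rank (G : SimpleGraph V) (w : Sym2 V → ℕ) (s u : V) : ℕ :=
  (Finset.univ.filter fun v => wdist G w s v < wdist G w s u).card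

theorem rank_lt_card (s u : V) : rank G w s u < Fintype.card V :=
  Finset.card_lt_univ_of_notMem (x := u) (by simp)

theorem rank_lt_rank {s u v : V} (h : wdist G w s u < wdist G w s v) :
    rank G w s u < rank G w s v := by
  apply Finset.card_lt_card
  rw [Finset.ssubset_iff_of_subset
    (Finset.monotone_filter_right _ fun _ _ h' => lt_trans h' h)]
  exact ⟨u, by simpa using h, by simp⟩

/-- Every node has at most n parents, and the rank drops at each step towards the root. Only needed
to bound the exponents of the transmitted numbers. -/
theorem sigma_le (hG : G.Connected) (hw : ∀ e ∈ G.edgeSet, 0 < w e) (s u : V) :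
    sigma G w s u ≤ Fintype.card V ^ rank G w s u := by
  classical
  induction hk : wdist G w s u using Nat.strong_induction_on generalizing u with
  | _ k ih =>
  have hpos : 0 < Fintype.card V := Fintype.card_pos_iff.2 ⟨s⟩
  by_cases hus : u = s
  · subst hus
    rw [sigma_self]
    exact Nat.one_le_pow _ _ hpos
  · rw [sigma_eq_sum hG hw hus]
    obtain ⟨p0, hp0⟩ := exists_isParent (w := w) hG hus
    have hr : 0 < rank G w s u := (Nat.zero_le _).trans_lt (rank_lt_rank (hp0.wdist_lt hw))
    refine (Finset.sum_le_card_nsmul _ _ (Fintype.card V ^ (rank G w s u - 1)) ?_).trans ?_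
    · intro p hp
      have hlt := (Finset.mem_filter.1 hp).2.wdist_lt hw
      refine (ih _ (hk ▸ hlt) p rfl).trans (Nat.pow_le_pow_right hpos ?_)
      have := rank_lt_rank hlt
      omega
    · rw [smul_eq_mul]
      refine (Nat.mul_le_mul_right _ (Finset.card_le_univ _)).trans ?_
      rw [← pow_succ', Nat.sub_add_cancel hr]

end Metric

end BCSetup

/-! ### The graph of nodes and relays, and the slots of releases and crossings in it. -/

namespace BCSetup

/-- The processors of the two subroutines: the nodes, and the relays `relay u v j` at distance `j`
from `u` on the edge from `u` to a node `v` of larger identifier. -/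
inductive Site (V : Type*) where
  | node (u : V)
  | relay (u v : V) (j : ℕ)

section Sites

variable {V : Type*} [Fintype V] [LinearOrder V]

/-- The sites that exist in the network. -/
def Network.Valid (N : Network V) : Site V → Prop
  | .node _ => True
  | .relay u v j => u < v ∧ N.graph.Adj u v ∧ 0 < j ∧ j < N.weight s(u, v)

open Classical in
/-- The ports of a site. -/
noncomputable def Network.ports (N : Network V) : Site V → Finset V
  | .node u => Finset.univ.filter fun v => N.graph.Adj u v
  | .relay u v _ => {u, v}

/-- The site at the other end of the link at port `p`. -/
def Network.nb (N : Network V) : Site V → V → Site V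
  | .node u, p =>
      if N.weight s(u, p) ≤ 1 then .node p
      else if u < p then .relay u p 1 else .relay p u (N.weight s(p, u) - 1)
  | .relay u v j, p =>
      if p = u then if j = 1 then .node u else .relay u v (j - 1)
      else if j + 1 = N.weight s(u, v) then .node v else .relay u v (j + 1)

/-- The port at the other end of the link at port `p`. -/
def Site.rev : Site V → V → V
  | .node u, _ => u
  | .relay u v _, p => if p = u then v else u

/-- The distance of a site from the root `r`. -/
noncomputable def Network.sdist (N : Network V) (r : V) : Site V → ℕ
  | .node u => wdist N.graph N.weight r u
  | .relay u v j => min (wdist N.graph N.weight r u + j)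
      (wdist N.graph N.weight r v + (N.weight s(u, v) - j))

variable {N : Network V}

theorem Network.weight_pos' {u v : V} (h : N.graph.Adj u v) : 0 < N.weight s(u, v) :=
  N.weight_pos _ h

theorem Network.mem_ports_node {u p : V} : p ∈ N.ports (.node u) ↔ N.graph.Adj u p := by
  simp [Network.ports]

theorem Network.mem_ports_relay {u v p : V} {j : ℕ} :
    p ∈ N.ports (.relay u v j) ↔ p = u ∨ p = v := by
  simp [Network.ports]

/-- Links can be viewed from both ends: `h.rev p` is the port of the neighbour that leads back to
`h`, through the same link. All facts about one end thereby transfer to the other. -/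
theorem Network.nb_spec {h : Site V} (hh : N.Valid h) {p : V} (hp : p ∈ N.ports h) :
    N.Valid (N.nb h p) ∧ h.rev p ∈ N.ports (N.nb h p) ∧ N.nb (N.nb h p) (h.rev p) = h ∧
      (N.nb h p).rev (h.rev p) = p := by
  cases h with
  | node u =>
    have hadj := N.mem_ports_node.1 hp
    have hne : u ≠ p := hadj.ne
    have hsw : N.weight s(p, u) = N.weight s(u, p) := by rw [Sym2.eq_swap]
    have hpos := N.weight_pos' hadj
    by_cases h1 : N.weight s(u, p) ≤ 1
    · simp [Network.nb, h1, Network.Valid, Site.rev, Network.mem_ports_node, hadj.symm, hsw]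
    · by_cases h2 : u < p
      · simp [Network.nb, h1, h2, Network.Valid, Site.rev, Network.mem_ports_relay, hadj]
        omega
      · have h3 : p < u := lt_of_le_of_ne (not_lt.1 h2) hne.symm
        simp only [Network.nb, h1, h2, Network.Valid, Site.rev, Network.mem_ports_relay, hadj.symm,
          h3, hsw, hne, if_false, or_true, true_and]
        refine ⟨⟨by omega, by omega⟩, ?_⟩
        rw [if_pos (by omega)]
        simp
  | relay u v j =>
    obtain ⟨hlt, hadj, hj0, hj⟩ := hh
    have hne : u ≠ v := hlt.ne
    have hsw : N.weight s(v, u) = N.weight s(u, v) := by rw [Sym2.eq_swap]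
    have h1 : ¬ N.weight s(u, v) ≤ 1 := by omega
    rcases N.mem_ports_relay.1 hp with rfl | rfl
    · by_cases hj1 : j = 1
      · subst hj1
        simp [Network.nb, Site.rev, Network.Valid, Network.mem_ports_node, hadj, h1, hlt]
      · simp only [Network.nb, Site.rev, Network.Valid, Network.mem_ports_relay, hadj, hlt, hj1,
          hne.symm, if_true, if_false, true_and, or_true]
        refine ⟨⟨by omega, by omega⟩, ?_⟩
        rw [if_neg (by omega), Nat.sub_add_cancel hj0]
        simp
    · by_cases hj1 : j + 1 = N.weight s(u, p)
      · simp only [Network.nb, Site.rev, Network.Valid, Network.mem_ports_node, hadj.symm, hne.symm,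
          hj1, hsw, h1, not_lt.2 hlt.le, if_true, if_false, true_and]
        simp only [← hj1, Nat.add_sub_cancel, and_self]
      · simp only [Network.nb, Site.rev, Network.Valid, Network.mem_ports_relay, hadj, hlt, hj1,
          hne.symm, if_true, if_false, true_and, true_or]
        refine ⟨⟨by omega, by omega⟩, ?_⟩
        rw [if_neg (by omega)]
        simp

theorem Network.wdist_le_add (N : Network V) (r : V) {u v : V} (h : N.graph.Adj u v) :
    wdist N.graph N.weight r v ≤ wdist N.graph N.weight r u + N.weight s(u, v) :=
  BCSetup.wdist_le_add N.connected r h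

/-- Subdivision makes all links unit links. This is what keeps the indices of the two schedules
within 1 of each other. -/
theorem Network.sdist_nb_le_add {h : Site V} (hh : N.Valid h) {p : V} (hp : p ∈ N.ports h) (r : V) :
    N.sdist r (N.nb h p) ≤ N.sdist r h + 1 := by
  cases h with
  | node u =>
    have hadj := N.mem_ports_node.1 hp
    have h1 := N.wdist_le_add r hadj
    have hsw : N.weight s(p, u) = N.weight s(u, p) := by rw [Sym2.eq_swap]
    have hpos := N.weight_pos' hadj
    unfold Network.nb
    simp only
    split_ifs <;> simp only [Network.sdist] <;> omega
  | relay u v j =>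
    obtain ⟨hlt, hadj, hj0, hj⟩ := hh
    have h1 := N.wdist_le_add r hadj
    have h2 := N.wdist_le_add r hadj.symm
    have hsw : N.weight s(v, u) = N.weight s(u, v) := by rw [Sym2.eq_swap]
    unfold Network.nb
    simp only
    split_ifs <;> simp only [Network.sdist] <;> omega

theorem Network.sdist_le_nb_add {h : Site V} (hh : N.Valid h) {p : V} (hp : p ∈ N.ports h) (r : V) :
    N.sdist r h ≤ N.sdist r (N.nb h p) + 1 := by
  obtain ⟨h1, h2, h3, _⟩ := N.nb_spec hh hp
  have := N.sdist_nb_le_add h1 h2 r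
  rwa [h3] at this

theorem Network.sdist_eq_zero_iff {h : Site V} (hh : N.Valid h) {r : V} :
    N.sdist r h = 0 ↔ h = .node r := by
  cases h with
  | node u =>
    simp only [Network.sdist, wdist_eq_zero_iff N.connected N.weight_pos, Site.node.injEq]
    exact eq_comm
  | relay u v j =>
    obtain ⟨_, _, hj0, hj⟩ := hh
    simp only [Network.sdist, reduceCtorEq, iff_false]
    omega

theorem Network.exists_parent_port {h : Site V} (hh : N.Valid h) {r : V} (hr : h ≠ .node r) :
    ∃ p ∈ N.ports h, N.sdist r (N.nb h p) + 1 = N.sdist r h := by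
  cases h with
  | node u =>
    have hur : u ≠ r := fun e => hr (by rw [e])
    obtain ⟨p, hp⟩ := exists_isParent (w := N.weight) N.connected hur
    have hadj := hp.1
    have h1 := hp.2
    have hsw : N.weight s(p, u) = N.weight s(u, p) := by rw [Sym2.eq_swap]
    have hpos := N.weight_pos' hadj
    refine ⟨p, N.mem_ports_node.2 hadj.symm, ?_⟩
    unfold Network.nb
    simp only
    split_ifs <;> simp only [Network.sdist] <;> omega
  | relay u v j =>
    obtain ⟨hlt, hadj, hj0, hj⟩ := hh
    have h1 := N.wdist_le_add r hadj
    have h2 := N.wdist_le_add r hadj.symm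
    have hsw : N.weight s(v, u) = N.weight s(u, v) := by rw [Sym2.eq_swap]
    have hvu : v ≠ u := hlt.ne'
    rcases le_total (wdist N.graph N.weight r u + j)
      (wdist N.graph N.weight r v + (N.weight s(u, v) - j)) with hle | hle
    · refine ⟨u, N.mem_ports_relay.2 (Or.inl rfl), ?_⟩
      unfold Network.nb
      simp only [if_true]
      split_ifs <;> simp only [Network.sdist] <;> omega
    · refine ⟨v, N.mem_ports_relay.2 (Or.inr rfl), ?_⟩
      unfold Network.nb
      simp only [hvu, if_false]
      split_ifs <;> simp only [Network.sdist] <;> omega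

variable (N) in
/-- The slot in which the message of root `r` crosses the link at port `p` of `h`. -/
noncomputable def Network.cross (S : Finset V) (h : Site V) (p r : V) : ℕ :=
  schedule S (fun r => min (N.sdist r h) (N.sdist r (N.nb h p))) r

variable (N) in
/-- The slot in which the site `h` starts to send the message of root `r`. -/
noncomputable def Network.release (S : Finset V) (h : Site V) (r : V) : ℕ :=
  schedule S (fun r => N.sdist r h) r

variable {S : Finset V} {h : Site V} {p r : V}

/-- The index of a crossing is symmetric in the two ends, so that both directions of a link share
one schedule. -/
theorem Network.cross_nb (hh : N.Valid h) (hp : p ∈ N.ports h) :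
    N.cross S (N.nb h p) (h.rev p) r = N.cross S h p r := by
  unfold Network.cross
  rw [(N.nb_spec hh hp).2.2.1]
  simp only [min_comm]

theorem Network.cross_inj {r' : V} (hr : r ∈ S) (hr' : r' ∈ S)
    (he : N.cross S h p r = N.cross S h p r') : r = r' :=
  schedule_inj hr hr' he

theorem Network.release_inj {r' : V} (hr : r ∈ S) (hr' : r' ∈ S)
    (he : N.release S h r = N.release S h r') : r = r' :=
  schedule_inj hr hr' he

theorem Network.sdist_le_release (hr : r ∈ S) : N.sdist r h ≤ N.release S h r :=
  le_schedule (idx := fun r => N.sdist r h) hr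

theorem Network.release_lt (hr : r ∈ S) : N.release S h r < N.sdist r h + S.card :=
  schedule_lt (idx := fun r => N.sdist r h) hr

theorem Network.cross_lt (hr : r ∈ S) :
    N.cross S h p r < min (N.sdist r h) (N.sdist r (N.nb h p)) + S.card :=
  schedule_lt (idx := fun r => min (N.sdist r h) (N.sdist r (N.nb h p))) hr

theorem Network.min_sdist_le (h : Site V) (p r : V) :
    min (N.sdist r h) (N.sdist r (N.nb h p)) ≤ N.sdist r h := min_le_left _ _

theorem Network.sdist_le_min (hh : N.Valid h) (hp : p ∈ N.ports h) (r : V) :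
    N.sdist r h ≤ min (N.sdist r h) (N.sdist r (N.nb h p)) + 1 := by
  have := N.sdist_le_nb_add hh hp r
  omega

/-- On a link from a parent the index of the crossing is one less than that of the release. -/
theorem Network.cross_lt_release (hh : N.Valid h) (hp : p ∈ N.ports h) (hr : r ∈ S)
    (hd : N.sdist r (N.nb h p) + 1 = N.sdist r h) : N.cross S h p r < N.release S h r :=
  schedule_lt_schedule (fun r _ => N.min_sdist_le h p r) (fun r _ => N.sdist_le_min hh hp r) hr
    (by omega)

/-- At an end that is not the farther one, crossing and release of `r` have the same index, and the
other roots have link indices that are no larger than their release indices. -/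
theorem Network.release_le_cross (hh : N.Valid h) (hp : p ∈ N.ports h) (hr : r ∈ S)
    (hd : N.sdist r h ≤ N.sdist r (N.nb h p)) : N.release S h r ≤ N.cross S h p r :=
  schedule_le_schedule (fun r _ => N.min_sdist_le h p r) (fun r _ => N.sdist_le_min hh hp r) hr
    (by omega)

theorem Network.release_le_cross_iff (hh : N.Valid h) (hp : p ∈ N.ports h) (hr : r ∈ S) :
    N.release S h r ≤ N.cross S h p r ↔ N.sdist r h ≤ N.sdist r (N.nb h p) := by
  refine ⟨fun hle => ?_, N.release_le_cross hh hp hr⟩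
  by_contra hlt
  have := N.sdist_le_nb_add hh hp r
  have := N.cross_lt_release hh hp hr (by omega)
  omega

theorem Network.exists_release_eq {t : ℕ} (hh : N.Valid h) (hp : p ∈ N.ports h) (hr : r ∈ S)
    (hd : N.sdist r (N.nb h p) + 1 = N.sdist r h) (h1 : N.cross S h p r < t)
    (h2 : t < N.release S h r) : ∃ r' ∈ S, r' < r ∧ N.release S h r' = t :=
  exists_schedule_eq_of_waiting (fun r _ => N.min_sdist_le h p r)
    (fun r _ => N.sdist_le_min hh hp r) hr (by omega) h1 h2

theorem Network.exists_cross_eq {t : ℕ} (hh : N.Valid h) (hp : p ∈ N.ports h) (hr : r ∈ S)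
    (h1 : N.release S h r ≤ t) (h2 : t < N.cross S h p r) :
    ∃ r' ∈ S, r' < r ∧ N.cross S h p r' = t := by
  have hd := (N.release_le_cross_iff hh hp hr).1 (h1.trans h2.le)
  exact exists_schedule_eq_of_blocked (fun r _ => N.min_sdist_le h p r)
    (fun r _ => N.sdist_le_min hh hp r) hr (by omega) h1 h2

/-- No other root is at distance 0 from this node, so no smaller root competes for slot 0. -/
theorem Network.release_root (hr : r ∈ S) : N.release S (.node r) r = 0 := by
  have hv : N.Valid (.node r) := trivial
  refine schedule_eq_zero hr ((N.sdist_eq_zero_iff hv).2 rfl) fun r' _ hlt h0 => ?_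
  have := (N.sdist_eq_zero_iff hv).1 h0
  simp only [Site.node.injEq] at this
  exact hlt.ne' this

variable (N) in
/-- The site `h` has heard of root `r` before slot `t`. -/
def Network.Heard (S : Finset V) (h : Site V) (t : ℕ) (r : V) : Prop :=
  h = .node r ∨ ∃ p ∈ N.ports h, N.sdist r (N.nb h p) + 1 = N.sdist r h ∧ N.cross S h p r < t

theorem Network.heard_of_release_le {t : ℕ} (hh : N.Valid h) (hr : r ∈ S)
    (ht : N.release S h r ≤ t) : N.Heard S h t r := by
  by_cases he : h = .node r
  · exact Or.inl he
  · obtain ⟨p, hp, hd⟩ := N.exists_parent_port hh he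
    exact Or.inr ⟨p, hp, hd, (N.cross_lt_release hh hp hr hd).trans_le ht⟩

theorem Network.Heard.mono {t t' : ℕ} (hH : N.Heard S h t r) (ht : t ≤ t') : N.Heard S h t' r :=
  hH.imp id fun ⟨p, hp, hd, hc⟩ => ⟨p, hp, hd, hc.trans_le ht⟩

end Sites

end BCSetup

/-! ### `DLGcomp`: the closed form is preserved by every slot. -/

namespace BCSetup

theorem finset_min_eq_coe_iff {V : Type*} [LinearOrder V] {s : Finset V} {a : V} :
    s.min = (a : WithTop V) ↔ a ∈ s ∧ ∀ b ∈ s, a ≤ b := by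
  constructor
  · intro h
    exact ⟨Finset.mem_of_min h, fun b hb => Finset.min_le_of_eq hb h⟩
  · rintro ⟨h1, h2⟩
    apply le_antisymm (Finset.min_le h1)
    exact Finset.le_min fun b hb => WithTop.coe_le_coe.2 (h2 b hb)

theorem coe_lt_finset_min_iff {V : Type*} [LinearOrder V] {s : Finset V} {a : V} :
    (a : WithTop V) < s.min ↔ ∀ b ∈ s, a < b := by
  rcases s.eq_empty_or_nonempty with rfl | hs
  · simp
  · rw [← Finset.coe_min' hs, WithTop.coe_lt_coe, Finset.lt_min'_iff]

section Wave

variable {V : Type*} [Fintype V] [LinearOrder V] (N : Network V) (S : Finset V) (β k : ℕ)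

open Classical in
/-- The ports of `h` that lead to parents for the root `r`, provided that `h` is at distance at
most `k` from `r`. -/
noncomputable def Network.parentPorts (h : Site V) (r : V) : Finset V :=
  (N.ports h).filter fun p => N.sdist r (N.nb h p) + 1 = N.sdist r h ∧ N.sdist r h ≤ k

/-- The rounded number of shortest paths at a site that is `m` links away from the root. -/
noncomputable def Network.tspAux : ℕ → Site V → V → ℚ
  | 0, _, _ => 1
  | m + 1, h, r => ∑ p ∈ N.parentPorts k h r, (Flt.round β (Network.tspAux m (N.nb h p) r)).val

/-- The rounded number of shortest paths that `DLGcomp` computes at the site `h` for the root `r`. -/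
noncomputable def Network.tspVal (h : Site V) (r : V) : ℚ := N.tspAux β k (N.sdist r h) h r

open Classical in
/-- The variables of the processor at `h` before slot `t` of `DLGcomp`. -/
noncomputable def Network.waveState (t : ℕ) (h : Site V) : Proc V where
  known := S.filter fun r => N.Heard S h t r
  delayed := S.filter fun r => N.Heard S h t r ∧ t < N.release S h r
  pending p := if p ∈ N.ports h then S.filter fun r => N.Heard S h t r ∧ t ≤ N.cross S h p r else ∅
  dist r := if r ∈ S ∧ N.Heard S h t r then N.sdist r h else 0
  sched r p := if r ∈ S ∧ p ∈ N.parentPorts k h r ∧ N.cross S h p r < t then some (N.cross S h p r)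
    else none
  tsp r := if r ∈ S then if h = .node r then 1 else
    ∑ p ∈ (N.parentPorts k h r).filter fun p => N.cross S h p r < t,
      (Flt.round β (N.tspVal β k (N.nb h p) r)).val else 0
  dep _ := 0
  fwd _ := none

variable {N S β k} {h : Site V} {p r : V} {t : ℕ}

theorem Network.mem_parentPorts : p ∈ N.parentPorts k h r ↔
    p ∈ N.ports h ∧ N.sdist r (N.nb h p) + 1 = N.sdist r h ∧ N.sdist r h ≤ k := by
  simp [Network.parentPorts]

theorem Network.tspVal_root : N.tspVal β k (.node r) r = 1 := by
  have : N.sdist r (.node r) = 0 := (N.sdist_eq_zero_iff (h := .node r) trivial).2 rfl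
  rw [Network.tspVal, this, Network.tspAux]

theorem Network.tspVal_eq_sum (hh : N.Valid h) (hr : h ≠ .node r) :
    N.tspVal β k h r =
      ∑ p ∈ N.parentPorts k h r, (Flt.round β (N.tspVal β k (N.nb h p) r)).val := by
  have hne : N.sdist r h ≠ 0 := fun h0 => hr ((N.sdist_eq_zero_iff hh).1 h0)
  obtain ⟨m, hm⟩ := Nat.exists_eq_succ_of_ne_zero hne
  rw [Network.tspVal, hm, Network.tspAux]
  apply Finset.sum_congr rfl
  intro p hp
  have := (N.mem_parentPorts.1 hp).2.1
  rw [Network.tspVal, show N.sdist r (N.nb h p) = m by omega]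

theorem Network.waveState_tsp (hh : N.Valid h) (hr : r ∈ S) (ht : N.release S h r ≤ t) :
    (N.waveState S β k t h).tsp r = N.tspVal β k h r := by
  simp only [Network.waveState, if_pos hr]
  split_ifs with h1
  · rw [h1, N.tspVal_root]
  · rw [N.tspVal_eq_sum hh h1]
    congr 1
    apply Finset.filter_true_of_mem
    intro p hp
    obtain ⟨h2, h3, _⟩ := N.mem_parentPorts.1 hp
    exact (N.cross_lt_release hh h2 hr h3).trans_le ht

/-- A root leaves the delay queue at its release and leaves the pending set after its crossing, so
it is ready exactly between the two. -/
theorem Network.mem_waveState_ready (hh : N.Valid h) (hp : p ∈ N.ports h) :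
    r ∈ (N.waveState S β k t h).ready p ↔
      r ∈ S ∧ N.release S h r ≤ t ∧ t ≤ N.cross S h p r := by
  simp only [Proc.ready, Network.waveState, if_pos hp, Finset.mem_sdiff, Finset.mem_filter]
  constructor
  · rintro ⟨⟨h1, h2, h3⟩, h4⟩
    refine ⟨h1, ?_, h3⟩
    by_contra hlt
    exact h4 ⟨h1, h2, not_le.1 hlt⟩
  · rintro ⟨h1, h2, h3⟩
    exact ⟨⟨h1, N.heard_of_release_le hh h1 h2, h3⟩, fun h4 => absurd h4.2.2 (not_lt.2 h2)⟩

theorem Network.waveState_waveOut (hh : N.Valid h) (hp : p ∈ N.ports h)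
    (hr : ((N.waveState S β k t h).ready p).min = (r : WithTop V)) :
    (N.waveState S β k t h).waveOut β p =
      some (.wave r (N.sdist r h + 1) (Flt.round β (N.tspVal β k h r))) := by
  have hmem := Finset.mem_of_min hr
  have hne : ((N.waveState S β k t h).ready p).Nonempty := ⟨r, hmem⟩
  have hmin : ((N.waveState S β k t h).ready p).min' hne = r := by
    rw [← Finset.coe_min' hne] at hr
    exact WithTop.coe_injective hr
  obtain ⟨h1, h2, h3⟩ := (N.mem_waveState_ready hh hp).1 hmem
  rw [Proc.waveOut, dif_pos hne, hmin, N.waveState_tsp hh h1 h2]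
  simp [Network.waveState, h1, N.heard_of_release_le hh h1 h2]

theorem Network.waveOut_eq_some {m : Msg V} (hh : N.Valid h) (hp : p ∈ N.ports h)
    (hm : (N.waveState S β k t h).waveOut β p = some m) :
    ∃ r : V, ((N.waveState S β k t h).ready p).min = (r : WithTop V) ∧
      m = .wave r (N.sdist r h + 1) (Flt.round β (N.tspVal β k h r)) := by
  by_cases hne : ((N.waveState S β k t h).ready p).Nonempty
  · have hr := (Finset.coe_min' hne).symm
    refine ⟨_, hr, ?_⟩
    rw [N.waveState_waveOut hh hp hr] at hm
    exact (Option.some_injective _ hm).symm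
  · rw [Proc.waveOut, dif_neg hne] at hm
    cases hm

/-- A released root still waiting for the link waits for a smaller one that crosses now, and only
one root crosses per slot. Hence the crossing root has priority over all that are ready. -/
theorem Network.le_of_cross_eq {r' : V} (hh : N.Valid h) (hp : p ∈ N.ports h) (hr : r ∈ S)
    (hr' : r' ∈ S) (hc : N.cross S h p r = t) (h1 : N.release S h r' ≤ t)
    (h2 : t ≤ N.cross S h p r') : r ≤ r' := by
  rcases h2.eq_or_lt with h2 | h2
  · exact (N.cross_inj hr hr' (hc.trans h2)).le
  · obtain ⟨r'', hr'', hlt, hc'⟩ := N.exists_cross_eq hh hp hr' h1 h2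
    rw [N.cross_inj hr hr'' (hc.trans hc'.symm)]
    exact hlt.le

/-- The local rule (smallest ready root at each end, then the smaller of the two) selects the root
that the closed form lets cross in this slot. From it follow all updates of the variables. -/
theorem Network.accept_iff (hh : N.Valid h) (hp : p ∈ N.ports h) {inc : V → Option (Msg V)}
    (hinc : inc p = (N.waveState S β k t (N.nb h p)).waveOut β (h.rev p)) (m : V × ℕ × Flt) :
    (N.waveState S β k t h).accept inc p = some m ↔
      ∃ r ∈ S, N.cross S h p r = t ∧ N.sdist r (N.nb h p) + 1 = N.sdist r h ∧
        m = (r, N.sdist r h, Flt.round β (N.tspVal β k (N.nb h p) r)) := by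
  obtain ⟨hv, hq, hnn, -⟩ := N.nb_spec hh hp
  have hcr : ∀ r, N.cross S (N.nb h p) (h.rev p) r = N.cross S h p r := fun r => N.cross_nb hh hp
  constructor
  · intro hm
    unfold Proc.accept at hm
    split at hm
    · rename_i r d tsp heq
      split_ifs at hm with hlt
      rw [hinc] at heq
      obtain ⟨r', hr', hmsg⟩ := N.waveOut_eq_some hv hq heq
      cases hmsg
      obtain ⟨h1, h2⟩ := finset_min_eq_coe_iff.1 hr'
      rw [coe_lt_finset_min_iff] at hlt
      rw [N.mem_waveState_ready hv hq, hcr] at h1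
      obtain ⟨hrS, hrel, hle⟩ := h1
      -- Otherwise a smaller root crosses now. At the end that is not farther from that root, it is
      -- ready; at `h` this contradicts acceptance, at the neighbour it contradicts the choice of
      -- the sender.
      have hceq : N.cross S h p r = t := by
        by_contra hne
        obtain ⟨r', hr'S, hr'lt, hc⟩ := N.exists_cross_eq hv hq hrS hrel
          (by rw [hcr]; omega)
        have hc' := hc
        rw [hcr] at hc'
        rcases le_total (N.sdist r' h) (N.sdist r' (N.nb h p)) with hd | hd
        · have := N.release_le_cross hh hp hr'S hd
          exact lt_asymm hr'lt (hlt r' ((N.mem_waveState_ready hh hp).2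
            ⟨hr'S, by omega, hc'.ge⟩))
        · have := N.release_le_cross hv hq hr'S (by rw [hnn]; exact hd)
          exact absurd (h2 r' ((N.mem_waveState_ready hv hq).2 ⟨hr'S, by omega, hc.ge⟩))
            (not_le.2 hr'lt)
      -- If `h` were not farther, it would have `r` ready itself. The strict comparison in
      -- `Proc.accept` then rejects the message, as happens when two waves of the same root meet.
      have hd : N.sdist r (N.nb h p) < N.sdist r h := by
        by_contra hd
        have := N.release_le_cross hh hp hrS (not_lt.1 hd)
        exact lt_irrefl _ (hlt r ((N.mem_waveState_ready hh hp).2 ⟨hrS, by omega, hceq.ge⟩))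
      have hd' := N.sdist_le_nb_add hh hp r
      refine ⟨r, hrS, hceq, by omega, ?_⟩
      rw [← Option.some_injective _ hm, show N.sdist r (N.nb h p) + 1 = N.sdist r h by omega]
    · cases hm
  · rintro ⟨r, hrS, hc, hd, rfl⟩
    have hrel := N.release_le_cross (S := S) hv hq hrS (by rw [hnn]; omega)
    rw [hcr, hc] at hrel
    have hmin : ((N.waveState S β k t (N.nb h p)).ready (h.rev p)).min = (r : WithTop V) := by
      rw [finset_min_eq_coe_iff]
      refine ⟨(N.mem_waveState_ready hv hq).2 ⟨hrS, hrel, by rw [hcr, hc]⟩, fun b hb => ?_⟩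
      obtain ⟨hb1, hb2, hb3⟩ := (N.mem_waveState_ready hv hq).1 hb
      exact N.le_of_cross_eq hv hq hrS hb1 (by rw [hcr, hc]) hb2 hb3
    have hlt : (r : WithTop V) < ((N.waveState S β k t h).ready p).min := by
      rw [coe_lt_finset_min_iff]
      intro b hb
      obtain ⟨hb1, hb2, hb3⟩ := (N.mem_waveState_ready hh hp).1 hb
      refine lt_of_le_of_ne (N.le_of_cross_eq hh hp hrS hb1 hc hb2 hb3) ?_
      rintro rfl
      have := N.cross_lt_release hh hp hrS hd
      omega
    unfold Proc.accept
    rw [hinc, N.waveState_waveOut hv hq hmin]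
    simp only [if_pos hlt, hd]


variable (N S β k) in
/-- In slot `t` of `DLGcomp`, `h` receives what its neighbours send. -/
def Network.WaveInc (t : ℕ) (h : Site V) (inc : V → Option (Msg V)) : Prop :=
  ∀ p ∈ N.ports h, inc p = (N.waveState S β k t (N.nb h p)).waveOut β (h.rev p)

variable {inc : V → Option (Msg V)}

theorem Network.accept_map_iff (hh : N.Valid h) (hinc : N.WaveInc S β k t h inc)
    (hp : p ∈ N.ports h) :
    ((N.waveState S β k t h).accept inc p).map (fun m => m.1) = some r ↔
      r ∈ S ∧ N.cross S h p r = t ∧ N.sdist r (N.nb h p) + 1 = N.sdist r h := by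
  rw [Option.map_eq_some_iff]
  constructor
  · rintro ⟨m, hm, rfl⟩
    obtain ⟨r, h1, h2, h3, rfl⟩ := (N.accept_iff hh hp (hinc p hp) m).1 hm
    exact ⟨h1, h2, h3⟩
  · rintro ⟨h1, h2, h3⟩
    exact ⟨_, (N.accept_iff hh hp (hinc p hp) _).2 ⟨r, h1, h2, h3, rfl⟩, rfl⟩

theorem Network.accept_eq (hh : N.Valid h) (hinc : N.WaveInc S β k t h inc)
    (hp : p ∈ N.ports h) (hr : r ∈ S) (hc : N.cross S h p r = t)
    (hd : N.sdist r (N.nb h p) + 1 = N.sdist r h) :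
    (N.waveState S β k t h).accept inc p =
      some (r, N.sdist r h, Flt.round β (N.tspVal β k (N.nb h p) r)) :=
  (N.accept_iff hh hp (hinc p hp) _).2 ⟨r, hr, hc, hd, rfl⟩

theorem Network.mem_acceptPorts (hh : N.Valid h) (hinc : N.WaveInc S β k t h inc) :
    p ∈ (N.waveState S β k t h).acceptPorts (N.ports h) inc r ↔ p ∈ N.ports h ∧
      r ∈ S ∧ N.cross S h p r = t ∧ N.sdist r (N.nb h p) + 1 = N.sdist r h := by
  rw [Proc.acceptPorts, Finset.mem_filter]
  exact and_congr_right fun hp => N.accept_map_iff hh hinc hp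

theorem Network.mem_waveState_newRoots (hh : N.Valid h) (hinc : N.WaveInc S β k t h inc) :
    r ∈ (N.waveState S β k t h).newRoots (N.ports h) inc ↔
      r ∈ S ∧ N.Heard S h (t + 1) r ∧ ¬ N.Heard S h t r := by
  simp only [Proc.newRoots, Finset.mem_sdiff, Finset.mem_biUnion, Option.mem_toFinset,
    Option.mem_def]
  have hk : r ∈ (N.waveState S β k t h).known ↔ r ∈ S ∧ N.Heard S h t r := by
    simp [Network.waveState]
  rw [hk]
  constructor
  · rintro ⟨⟨p, hp, ha⟩, hn⟩
    obtain ⟨h1, h2, h3⟩ := (N.accept_map_iff hh hinc hp).1 ha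
    exact ⟨h1, Or.inr ⟨p, hp, h3, by omega⟩, fun h4 => hn ⟨h1, h4⟩⟩
  · rintro ⟨h1, h2, h3⟩
    refine ⟨?_, fun h4 => h3 h4.2⟩
    rcases h2 with h2 | ⟨p, hp, hd, hc⟩
    · exact absurd (Or.inl h2) h3
    · refine ⟨p, hp, (N.accept_map_iff hh hinc hp).2 ⟨h1, ?_, hd⟩⟩
      have : ¬ N.cross S h p r < t := fun hlt => h3 (Or.inr ⟨p, hp, hd, hlt⟩)
      omega

/-- All accepted messages of a root carry its true distance from `h`, so the infimum over ports is
taken over a constant, and later messages never contradict the first. -/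
theorem Network.waveState_newDist (hh : N.Valid h) (hinc : N.WaveInc S β k t h inc) :
    (N.waveState S β k t h).newDist (N.ports h) inc r =
      (N.waveState S β k (t + 1) h).dist r := by
  classical
  have hk : r ∈ (N.waveState S β k t h).known ↔ r ∈ S ∧ N.Heard S h t r := by
    simp [Network.waveState]
  have hnew := N.mem_waveState_newRoots (r := r) hh hinc
  unfold Proc.newDist
  split_ifs with h1 h2
  · rw [hk] at h1
    simp [Network.waveState, h1, h1.2.mono (Nat.le_succ t)]
  · have hall : ∀ p ∈ (N.waveState S β k t h).acceptPorts (N.ports h) inc r,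
        (N.waveState S β k t h).acceptDist inc p = N.sdist r h := fun p hp => by
      obtain ⟨a1, a2, a3, a4⟩ := (N.mem_acceptPorts hh hinc).1 hp
      simp [Proc.acceptDist, N.accept_eq hh hinc a1 a2 a3 a4]
    rw [Finset.inf'_congr h2 rfl hall, Finset.inf'_const]
    obtain ⟨p, hp⟩ := h2
    obtain ⟨a1, a2, a3, a4⟩ := (N.mem_acceptPorts hh hinc).1 hp
    have : N.Heard S h (t + 1) r := Or.inr ⟨p, a1, a4, by omega⟩
    simp [Network.waveState, a2, this]
  · have hno : ¬ (r ∈ S ∧ N.Heard S h (t + 1) r) := by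
      rintro ⟨b1, b2⟩
      have b3 := hnew.2 ⟨b1, b2, fun b3 => h1 (hk.2 ⟨b1, b3⟩)⟩
      simp only [Proc.newRoots, Finset.mem_sdiff, Finset.mem_biUnion, Option.mem_toFinset,
        Option.mem_def] at b3
      obtain ⟨⟨p, hp, ha⟩, -⟩ := b3
      exact h2 ⟨p, Finset.mem_filter.2 ⟨hp, ha⟩⟩
    rw [hk] at h1
    simp only [Network.waveState, if_neg hno, if_neg h1]

theorem Network.mem_validPorts (hh : N.Valid h) (hinc : N.WaveInc S β k t h inc) :
    p ∈ (N.waveState S β k t h).validPorts k (N.ports h) inc r ↔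
      r ∈ S ∧ p ∈ N.parentPorts k h r ∧ N.cross S h p r = t := by
  rw [Proc.validPorts, Finset.mem_filter, N.mem_acceptPorts hh hinc, N.mem_parentPorts]
  constructor
  · rintro ⟨⟨h1, h2, h3, h4⟩, h5, h6⟩
    simp only [Proc.acceptDist, N.accept_eq hh hinc h1 h2 h3 h4] at h6
    exact ⟨h2, ⟨h1, h4, by simpa using h6⟩, h3⟩
  · rintro ⟨h2, ⟨h1, h4, h5⟩, h3⟩
    refine ⟨⟨h1, h2, h3, h4⟩, ?_⟩
    have : N.Heard S h (t + 1) r := Or.inr ⟨p, h1, h4, by omega⟩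
    rw [N.waveState_newDist hh hinc]
    have hd : (N.waveState S β k (t + 1) h).dist r = N.sdist r h := by
      simp [Network.waveState, h2, this]
    rw [hd]
    simp [Proc.acceptDist, N.accept_eq hh hinc h1 h2 h3 h4, h5]

theorem Network.mem_delayed_union_newRoots (hh : N.Valid h) (hinc : N.WaveInc S β k t h inc) :
    r ∈ (N.waveState S β k t h).delayed ∪ (N.waveState S β k t h).newRoots (N.ports h) inc ↔
      r ∈ S ∧ N.Heard S h (t + 1) r ∧ t < N.release S h r := by
  rw [Finset.mem_union, N.mem_waveState_newRoots hh hinc]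
  simp only [Network.waveState, Finset.mem_filter]
  constructor
  · rintro (⟨h1, h2, h3⟩ | ⟨h1, h2, h3⟩)
    · exact ⟨h1, h2.mono (Nat.le_succ t), h3⟩
    · exact ⟨h1, h2, not_le.1 fun h4 => h3 (N.heard_of_release_le hh h1 h4)⟩
  · rintro ⟨h1, h2, h3⟩
    by_cases h4 : N.Heard S h t r
    · exact Or.inl ⟨h1, h4, h3⟩
    · exact Or.inr ⟨h1, h2, h4⟩

theorem Network.exists_release_of_heard (hh : N.Valid h) (hr : r ∈ S) (hH : N.Heard S h t r)
    (hlt : t < N.release S h r) : ∃ r' ∈ S, r' < r ∧ N.release S h r' = t := by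
  rcases hH with rfl | ⟨p, hp, hd, hc⟩
  · rw [N.release_root hr] at hlt
    omega
  · exact N.exists_release_eq hh hp hr hd hc hlt

/-- If some root is released in slot `t + 1`, it is the minimum of the queue: any other root in the
queue waits for a smaller one released in that slot. A root released later is therefore never the
minimum. -/
theorem Network.waveIn_delayed (hh : N.Valid h) (hinc : N.WaveInc S β k t h inc) :
    ((N.waveState S β k t h).waveIn k t (N.ports h) inc).delayed =
      (N.waveState S β k (t + 1) h).delayed := by
  ext r
  simp only [Proc.waveIn, Finset.mem_filter, ne_eq, finset_min_eq_coe_iff]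
  rw [N.mem_delayed_union_newRoots hh hinc]
  simp only [Network.waveState, Finset.mem_filter]
  constructor
  · rintro ⟨⟨h1, h2, h3⟩, h4⟩
    refine ⟨h1, h2, lt_of_le_of_ne h3 fun he => h4 ⟨⟨h1, h2, h3⟩, fun b hb => ?_⟩⟩
    obtain ⟨b1, b2, b3⟩ := (N.mem_delayed_union_newRoots hh hinc).1 hb
    by_contra hlt
    have hne : t + 1 ≠ N.release S h b := fun he' =>
      hlt (N.release_inj h1 b1 (he.symm.trans he')).le
    obtain ⟨r', h1', hlt', he'⟩ := N.exists_release_of_heard (t := t + 1) hh b1 b2 (by omega)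
    have := N.release_inj h1' h1 (he'.trans he)
    subst this
    exact hlt hlt'.le
  · rintro ⟨h1, h2, h3⟩
    refine ⟨⟨h1, h2, by omega⟩, fun h4 => ?_⟩
    obtain ⟨r', h1', hlt', he'⟩ := N.exists_release_of_heard hh h1 h2 h3
    exact not_le.2 hlt' (h4.2 r' ((N.mem_delayed_union_newRoots hh hinc).2
      ⟨h1', N.heard_of_release_le hh h1' he'.le, by omega⟩))

theorem Network.mem_pending_union_newRoots (hh : N.Valid h) (hinc : N.WaveInc S β k t h inc)
    (hp : p ∈ N.ports h) (hne : N.cross S h p r ≠ t) :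
    r ∈ (N.waveState S β k t h).pending p ∪ (N.waveState S β k t h).newRoots (N.ports h) inc ↔
      r ∈ S ∧ N.Heard S h (t + 1) r ∧ t + 1 ≤ N.cross S h p r := by
  rw [Finset.mem_union, N.mem_waveState_newRoots hh hinc]
  simp only [Network.waveState, if_pos hp, Finset.mem_filter]
  constructor
  · rintro (⟨h1, h2, h3⟩ | ⟨h1, h2, h3⟩)
    · exact ⟨h1, h2.mono (Nat.le_succ t), by omega⟩
    · refine ⟨h1, h2, ?_⟩
      rcases le_or_gt (N.sdist r h) (N.sdist r (N.nb h p)) with hd | hd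
      · have := N.release_le_cross hh hp h1 hd
        have : ¬ N.release S h r ≤ t := fun h4 => h3 (N.heard_of_release_le hh h1 h4)
        omega
      · have hd' := N.sdist_le_nb_add hh hp r
        have : ¬ N.cross S h p r < t := fun h4 => h3 (Or.inr ⟨p, hp, by omega, h4⟩)
        omega
  · rintro ⟨h1, h2, h3⟩
    by_cases h4 : N.Heard S h t r
    · exact Or.inl ⟨h1, h4, by omega⟩
    · exact Or.inr ⟨h1, h2, h4⟩

/-- Without an accepted message, a root that crosses in this slot cannot come from a closer site, so
it is already released at `h` and is the smallest ready root. In the other case the accepted root is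
the crossing one, and the root sent by `h` stays pending. -/
theorem Network.mem_sent_iff (hh : N.Valid h) (hinc : N.WaveInc S β k t h inc)
    (hp : p ∈ N.ports h) (hno : (N.waveState S β k t h).accept inc p = none) :
    r ∈ (N.waveState S β k t h).sent p ↔ r ∈ S ∧ N.cross S h p r = t := by
  have hno' : ∀ r ∈ S, N.cross S h p r = t → N.release S h r ≤ t := by
    intro r h1 h2
    rw [← h2]
    apply N.release_le_cross hh hp h1
    by_contra hd
    have hd' := N.sdist_le_nb_add hh hp r
    rw [N.accept_eq hh hinc hp h1 h2 (by omega)] at hno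
    cases hno
  rw [Proc.sent, Finset.mem_filter, finset_min_eq_coe_iff, N.mem_waveState_ready hh hp]
  constructor
  · rintro ⟨⟨h1, h2, h3⟩, -, h4⟩
    refine ⟨h1, ?_⟩
    by_contra hne
    obtain ⟨r', h1', hlt, hc⟩ := N.exists_cross_eq hh hp h1 h2 (by omega)
    exact not_le.2 hlt (h4 r' ((N.mem_waveState_ready hh hp).2 ⟨h1', hno' r' h1' hc, hc.ge⟩))
  · rintro ⟨h1, h2⟩
    have h3 := hno' r h1 h2
    refine ⟨⟨h1, h3, h2.ge⟩, ⟨h1, h3, h2.ge⟩, fun b hb => ?_⟩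
    obtain ⟨b1, b2, b3⟩ := (N.mem_waveState_ready hh hp).1 hb
    exact N.le_of_cross_eq hh hp h1 b1 h2 b2 b3

theorem Network.waveIn_pending (hh : N.Valid h) (hinc : N.WaveInc S β k t h inc) :
    ((N.waveState S β k t h).waveIn k t (N.ports h) inc).pending =
      (N.waveState S β k (t + 1) h).pending := by
  funext p
  by_cases hp : p ∈ N.ports h
  · have hrhs : ∀ r, r ∈ (N.waveState S β k (t + 1) h).pending p ↔
        r ∈ S ∧ N.Heard S h (t + 1) r ∧ t + 1 ≤ N.cross S h p r := fun r => by
      simp [Network.waveState, hp]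
    ext r
    rw [hrhs]
    simp only [Proc.waveIn, if_pos hp]
    have hpu := N.mem_pending_union_newRoots (r := r) hh hinc hp
    cases hacc : (N.waveState S β k t h).accept inc p with
    | none =>
      simp only [Finset.mem_sdiff]
      rw [N.mem_sent_iff hh hinc hp hacc]
      by_cases hc : N.cross S h p r = t
      · constructor
        · rintro ⟨h1, h2⟩
          have : r ∈ S := by
            rcases Finset.mem_union.1 h1 with h1 | h1
            · simp only [Network.waveState, if_pos hp, Finset.mem_filter] at h1
              exact h1.1
            · exact ((N.mem_waveState_newRoots hh hinc).1 h1).1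
          exact absurd ⟨this, hc⟩ h2
        · rintro ⟨-, -, h3⟩
          omega
      · rw [hpu hc]
        simp [hc]
    | some m =>
      obtain ⟨r', hr', hc', hd', rfl⟩ := (N.accept_iff hh hp (hinc p hp) m).1 hacc
      simp only [Finset.mem_erase]
      by_cases hc : N.cross S h p r = t
      · constructor
        · rintro ⟨h1, h2⟩
          have : r ∈ S := by
            rcases Finset.mem_union.1 h2 with h2 | h2
            · simp only [Network.waveState, if_pos hp, Finset.mem_filter] at h2
              exact h2.1
            · exact ((N.mem_waveState_newRoots hh hinc).1 h2).1
          exact absurd (N.cross_inj this hr' (hc.trans hc'.symm)) h1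
        · rintro ⟨-, -, h3⟩
          omega
      · rw [hpu hc]
        have : r ≠ r' := by rintro rfl; exact hc hc'
        simp [this]
  · simp [Proc.waveIn, Network.waveState, hp]

theorem Network.waveIn_tsp (hh : N.Valid h) (hinc : N.WaveInc S β k t h inc) :
    ((N.waveState S β k t h).waveIn k t (N.ports h) inc).tsp =
      (N.waveState S β k (t + 1) h).tsp := by
  funext r
  simp only [Proc.waveIn]
  by_cases hr : r ∈ S
  · have hsum : ∑ p ∈ (N.waveState S β k t h).validPorts k (N.ports h) inc r,
        (N.waveState S β k t h).acceptTsp inc p =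
        ∑ p ∈ (N.parentPorts k h r).filter fun p => N.cross S h p r = t,
          (Flt.round β (N.tspVal β k (N.nb h p) r)).val := by
      apply Finset.sum_congr
      · ext p
        rw [N.mem_validPorts hh hinc, Finset.mem_filter]
        simp [hr]
      · intro p hp
        obtain ⟨h1, h2⟩ := Finset.mem_filter.1 hp
        obtain ⟨h3, h4, -⟩ := N.mem_parentPorts.1 h1
        simp [Proc.acceptTsp, N.accept_eq hh hinc h3 hr h2 h4]
    rw [hsum]
    simp only [Network.waveState, if_pos hr]
    split_ifs with h1
    · rw [Finset.sum_eq_zero, add_zero]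
      intro p hp
      have h2 := (N.mem_parentPorts.1 (Finset.mem_filter.1 hp).1).2.1
      rw [(N.sdist_eq_zero_iff hh).2 h1] at h2
      omega
    · classical
      rw [← Finset.sum_union]
      · apply Finset.sum_congr _ fun _ _ => rfl
        ext p
        simp only [Finset.mem_union, Finset.mem_filter, ← and_or_left, Nat.lt_succ_iff_lt_or_eq]
      · rw [Finset.disjoint_filter]
        intros
        omega
  · rw [Finset.sum_eq_zero]
    · simp [Network.waveState, hr]
    · intro p hp
      exact absurd ((N.mem_validPorts hh hinc).1 hp).1 hr

/-- The invariance of the closed form, assembled field by field. -/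
theorem Network.waveIn_waveState (hh : N.Valid h) (hinc : N.WaveInc S β k t h inc) :
    (N.waveState S β k t h).waveIn k t (N.ports h) inc = N.waveState S β k (t + 1) h := by
  have hdel := N.waveIn_delayed hh hinc
  have hpend := N.waveIn_pending hh hinc
  have htsp := N.waveIn_tsp hh hinc
  have hknown : ((N.waveState S β k t h).waveIn k t (N.ports h) inc).known =
      (N.waveState S β k (t + 1) h).known := by
    ext r
    simp only [Proc.waveIn, Finset.mem_union]
    rw [N.mem_waveState_newRoots hh hinc]
    simp only [Network.waveState, Finset.mem_filter]
    have : N.Heard S h t r → N.Heard S h (t + 1) r := fun h => h.mono (Nat.le_succ t)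
    tauto
  have hdist : ((N.waveState S β k t h).waveIn k t (N.ports h) inc).dist =
      (N.waveState S β k (t + 1) h).dist := by
    funext r
    exact N.waveState_newDist hh hinc
  have hsched : ((N.waveState S β k t h).waveIn k t (N.ports h) inc).sched =
      (N.waveState S β k (t + 1) h).sched := by
    funext r p
    simp only [Proc.waveIn]
    simp only [N.mem_validPorts hh hinc]
    simp only [Network.waveState]
    by_cases h1 : r ∈ S <;> by_cases h2 : p ∈ N.parentPorts k h r <;> simp only [h1, h2,
      true_and, false_and, if_false]
    rcases lt_trichotomy (N.cross S h p r) t with h3 | h3 | h3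
    · rw [if_neg h3.ne, if_pos h3, if_pos (by omega)]
    · rw [if_pos h3, if_pos (by omega), h3]
    · rw [if_neg h3.ne', if_neg (by omega), if_neg (by omega)]
  generalize he : (N.waveState S β k t h).waveIn k t (N.ports h) inc = P at *
  have hdep : P.dep = (N.waveState S β k (t + 1) h).dep := by
    rw [← he]
    rfl
  have hfwd : P.fwd = (N.waveState S β k (t + 1) h).fwd := by
    rw [← he]
    rfl
  cases P
  simp only at hknown hdel hpend hdist hsched htsp hdep hfwd
  subst hknown hdel hpend hdist hsched htsp hdep hfwd
  rfl

theorem Network.waveState_zero_of_mem {s : V} (hs : s ∈ S) :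
    N.waveState S β k 0 (.node s) = Proc.source s (N.ports (.node s)) := by
  have hH : ∀ r, N.Heard S (.node s) 0 r ↔ r = s := fun r => by
    simp [Network.Heard, eq_comm]
  have h0 := N.release_root (S := S) hs
  simp only [Network.waveState, Proc.source, Proc.idle, Proc.mk.injEq, hH, and_true]
  refine ⟨?_, ?_, ?_, ?_, ?_, ?_⟩
  · ext r
    simp only [Finset.mem_filter, Finset.mem_singleton, and_iff_right_iff_imp]
    rintro rfl
    exact hs
  · rw [Finset.filter_eq_empty_iff]
    rintro r - ⟨rfl, h⟩
    omega
  · funext p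
    split_ifs
    · ext r
      simp only [zero_le, and_true, Finset.mem_filter, Finset.mem_singleton,
        and_iff_right_iff_imp]
      rintro rfl
      exact hs
    · rfl
  · funext r
    split_ifs with h
    · rw [h.2, N.sdist_eq_zero_iff (h := .node s) trivial]
    · rfl
  · simp
  · funext r
    by_cases h : r = s
    · subst h
      simp [hs]
    · simp [h, Ne.symm h]

theorem Network.waveState_zero_of_ne (hh : ∀ r ∈ S, h ≠ .node r) :
    N.waveState S β k 0 h = Proc.idle := by
  classical
  have hH : ∀ r ∈ S, ¬ N.Heard S h 0 r := fun r hr => by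
    simp [Network.Heard, hh r hr]
  simp only [Network.waveState, Proc.idle, Proc.mk.injEq, and_true]
  refine ⟨?_, ?_, ?_, ?_, ?_, ?_⟩
  · rw [Finset.filter_eq_empty_iff]
    exact fun r hr => hH r hr
  · rw [Finset.filter_eq_empty_iff]
    exact fun r hr h => hH r hr h.1
  · funext p
    split_ifs
    · rw [Finset.filter_eq_empty_iff]
      exact fun r hr h => hH r hr h.1
    · rfl
  · funext r
    rw [if_neg fun h => hH r h.1 h.2]
  · simp
  · funext r
    by_cases hr : r ∈ S
    · simp [hr, hh r hr]
    · simp [hr]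

end Wave

end BCSetup

/-! ### `DLGagr`: the recorded schedule run backwards. -/

namespace BCSetup

/-- The answer for the root `r` in a message. -/
def backPart {V : Type*} [LinearOrder V] (r : V) : Option (Msg V) → Option (Flt × Flt)
  | some (.back r' dep tsp) => if r' = r then some (dep, tsp) else none
  | _ => none

theorem relayIn_fwd {V : Type*} [LinearOrder V] (u v : V) (inc : V → Option (Msg V)) (P : Proc V) (r : V) :
    (P.relayIn u v inc).fwd r = (backPart r (inc u)).or ((backPart r (inc v)).or (P.fwd r)) := by
  simp only [Proc.relayIn]
  rcases hu : inc u with _ | (_ | _ | _ | _ | _ | _) <;>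
  rcases hv : inc v with _ | (_ | _ | _ | _ | _ | _) <;>
  simp only [backPart, Option.none_or] <;> (try split_ifs) <;> simp

section Back

variable {V : Type*} [Fintype V] [LinearOrder V] (N : Network V) (S : Finset V) (β k : ℕ)

open Classical in
/-- The ports of `h` that lead to children for the root `r` at distance at most `k` from `r`. -/
noncomputable def Network.childPorts (h : Site V) (r : V) : Finset V :=
  (N.ports h).filter fun p => N.sdist r (N.nb h p) = N.sdist r h + 1 ∧ N.sdist r (N.nb h p) ≤ k

/-- What an answer `(δ_c, tsp_c)` of a child contributes to the dependency of a node with `x`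
shortest paths. -/
def answerContrib (x : ℚ) : Option (Flt × Flt) → ℚ
  | some m => x / m.2.val * (1 + m.1.val)
  | none => 0

/-- The answer of the site `h` to its parents for the root `r`; only `m` levels are explored. -/
noncomputable def Network.answerAux : ℕ → Site V → V → Option (Flt × Flt)
  | 0, _, _ => none
  | m + 1, .node u, r => some
      (Flt.round β (if r = u then 0 else ∑ p ∈ N.childPorts k (.node u) r,
        answerContrib (N.tspVal β k (.node u) r) (Network.answerAux m (N.nb (.node u) p) r)),
      Flt.round β (N.tspVal β k (.node u) r))
  | m + 1, .relay u v j, r =>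
      if u ∈ N.childPorts k (.relay u v j) r then
        Network.answerAux m (N.nb (.relay u v j) u) r
      else if v ∈ N.childPorts k (.relay u v j) r then
        Network.answerAux m (N.nb (.relay u v j) v) r
      else none

/-- The answer of the site `h` to its parents for the root `r` in `DLGagr`. -/
noncomputable def Network.answer (h : Site V) (r : V) : Option (Flt × Flt) :=
  N.answerAux β k (k + 1 - N.sdist r h) h r

/-- The dependency that `DLGagr` computes at the node `u` for the root `r`. -/
noncomputable def Network.depVal (u r : V) : ℚ :=
  if r = u then 0 else ∑ p ∈ N.childPorts k (.node u) r,
    answerContrib (N.tspVal β k (.node u) r) (N.answer β k (N.nb (.node u) p) r)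

/-- Whether a site is a relay. -/
def Site.isRelay : Site V → Bool
  | .node _ => false
  | .relay _ _ _ => true

open Classical in
/-- The variables of the processor at `h` after `b` slots of `DLGagr`. -/
noncomputable def Network.backState (b : ℕ) (h : Site V) : Proc V :=
  { N.waveState S β k (S.card + k + 1) h with
    dep := fun r => match h with
      | .node u => if r ∈ S ∧ r ≠ u then
          ∑ p ∈ (N.childPorts k h r).filter fun p => S.card + k + 1 ≤ N.cross S h p r + b,
            answerContrib (N.tspVal β k h r) (N.answer β k (N.nb h p) r) else 0
      | .relay _ _ _ => 0
    fwd := fun r => match h with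
      | .node _ => none
      | .relay _ _ _ => if r ∈ S ∧ ∃ p ∈ N.childPorts k h r, S.card + k + 1 ≤ N.cross S h p r + b
          then N.answer β k h r else none }

variable {N S β k} {h : Site V} {p r : V}

theorem Network.mem_childPorts : p ∈ N.childPorts k h r ↔
    p ∈ N.ports h ∧ N.sdist r (N.nb h p) = N.sdist r h + 1 ∧ N.sdist r (N.nb h p) ≤ k := by
  simp [Network.childPorts]

theorem Network.rev_mem_parentPorts_iff (hh : N.Valid h) (hp : p ∈ N.ports h) :
    h.rev p ∈ N.parentPorts k (N.nb h p) r ↔ p ∈ N.childPorts k h r := by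
  obtain ⟨-, hq, hnn, -⟩ := N.nb_spec hh hp
  rw [N.mem_parentPorts, N.mem_childPorts, hnn]
  simp only [hp, hq, true_and]
  constructor <;> rintro ⟨h1, h2⟩ <;> exact ⟨h1.symm, h2⟩

/-- The recursion depth `k + 1 - sdist` is positive up to distance `k` and drops by exactly 1 at
each child, so it never cuts anything off. -/
theorem Network.answer_node {u : V} (hd : N.sdist r (.node u) ≤ k) :
    N.answer β k (.node u) r =
      some (Flt.round β (N.depVal β k u r), Flt.round β (N.tspVal β k (.node u) r)) := by
  obtain ⟨m, hm⟩ : ∃ m, k + 1 - N.sdist r (.node u) = m + 1 := ⟨k - N.sdist r (.node u), by omega⟩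
  rw [Network.answer, hm, Network.answerAux, Network.depVal]
  congr 4
  apply Finset.sum_congr rfl
  intro p hp
  have := (N.mem_childPorts.1 hp).2.1
  rw [Network.answer, show k + 1 - N.sdist r (N.nb (.node u) p) = m by omega]

/-- One of the two ports of a relay leads closer to the root, which leaves at most one child. A
relay thus never has to merge answers. -/
theorem Network.childPorts_relay_unique {u v q : V} {j : ℕ} (hh : N.Valid (.relay u v j))
    (hp : p ∈ N.childPorts k (.relay u v j) r) (hq : q ∈ N.childPorts k (.relay u v j) r) :
    p = q := by
  obtain ⟨x, hx, hd⟩ := N.exists_parent_port hh (r := r) (by simp)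
  obtain ⟨p1, p2, -⟩ := N.mem_childPorts.1 hp
  obtain ⟨q1, q2, -⟩ := N.mem_childPorts.1 hq
  have hpx : p ≠ x := by rintro rfl; omega
  have hqx : q ≠ x := by rintro rfl; omega
  rw [N.mem_ports_relay] at hx p1 q1
  rcases hx with rfl | rfl <;> rcases p1 with rfl | rfl <;> rcases q1 with rfl | rfl <;>
    first | rfl | contradiction

theorem Network.answer_relay_of_mem {u v : V} {j : ℕ} (hh : N.Valid (.relay u v j))
    (hp : p ∈ N.childPorts k (.relay u v j) r) :
    N.answer β k (.relay u v j) r = N.answer β k (N.nb (.relay u v j) p) r := by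
  obtain ⟨p1, p2, p3⟩ := N.mem_childPorts.1 hp
  obtain ⟨m, hm⟩ : ∃ m, k + 1 - N.sdist r (.relay u v j) = m + 1 :=
    ⟨k - N.sdist r (.relay u v j), by omega⟩
  have hm' : k + 1 - N.sdist r (N.nb (.relay u v j) p) = m := by omega
  rw [Network.answer, Network.answer, hm, hm', Network.answerAux]
  split_ifs with h1 h2
  · rw [N.childPorts_relay_unique hh hp h1]
  · rw [N.childPorts_relay_unique hh hp h2]
  · rcases N.mem_ports_relay.1 p1 with rfl | rfl
    · exact absurd hp h1
    · exact absurd hp h2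

theorem Network.answer_relay_of_forall {u v : V} {j : ℕ}
    (hp : ∀ p, p ∉ N.childPorts k (.relay u v j) r) :
    N.answer β k (.relay u v j) r = none := by
  rw [Network.answer]
  cases k + 1 - N.sdist r (.relay u v j) with
  | zero => rfl
  | succ m => rw [Network.answerAux, if_neg (hp u), if_neg (hp v)]

/-- Crossings towards children within distance `k` happen before slot |S| + k, hence before the
reversed clock starts, and no answer counts as received yet. -/
theorem Network.backState_zero : N.backState S β k 0 h = N.waveState S β k (S.card + k + 1) h := by
  have hlt : ∀ r ∈ S, ∀ p ∈ N.childPorts k h r, ¬ S.card + k + 1 ≤ N.cross S h p r + 0 := by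
    intro r hr p hp
    obtain ⟨-, h1, h2⟩ := N.mem_childPorts.1 hp
    have := N.cross_lt (h := h) (p := p) hr
    omega
  have hdep : (N.backState S β k 0 h).dep = (N.waveState S β k (S.card + k + 1) h).dep := by
    funext r
    cases h with
    | relay u v j => rfl
    | node u =>
      simp only [Network.backState, Network.waveState]
      split_ifs with h1
      · rw [Finset.filter_false_of_mem (hlt r h1.1), Finset.sum_empty]
      · rfl
  have hfwd : (N.backState S β k 0 h).fwd = (N.waveState S β k (S.card + k + 1) h).fwd := by
    funext r
    cases h with
    | node u => rfl
    | relay u v j =>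
      simp only [Network.backState, Network.waveState]
      rw [if_neg]
      rintro ⟨h1, p, h2, h3⟩
      exact hlt r h1 p h2 h3
  have : N.backState S β k 0 h = { N.waveState S β k (S.card + k + 1) h with
      dep := (N.backState S β k 0 h).dep
      fwd := (N.backState S β k 0 h).fwd } := rfl
  rw [this, hdep, hfwd]

theorem Network.known_filter_sched {τ : ℕ} (hτ : τ ≤ S.card + k) (b : ℕ) :
    r ∈ (N.backState S β k b h).known.filter
      (fun r => (N.backState S β k b h).sched r p = some τ) ↔
      r ∈ S ∧ p ∈ N.parentPorts k h r ∧ N.cross S h p r = τ := by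
  classical
  rw [Finset.mem_filter]
  simp only [Network.backState, Network.waveState]
  rw [Finset.mem_filter]
  constructor
  · rintro ⟨⟨h1, -⟩, h2⟩
    split_ifs at h2 with h3
    exact ⟨h1, h3.2.1, Option.some_injective _ h2⟩
  · rintro ⟨h1, h2, h3⟩
    obtain ⟨h4, h5, -⟩ := N.mem_parentPorts.1 h2
    refine ⟨⟨h1, Or.inr ⟨p, h4, h5, by omega⟩⟩, ?_⟩
    rw [if_pos ⟨h1, h2, by omega⟩, h3]

/-- An answer goes to the parent whose message crossed in the mirrored slot; at most one root
qualifies, because crossings on a link are distinct. At that moment the value sent is already final.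
-/
theorem Network.backState_backOut_iff {b : ℕ} (hh : N.Valid h) (hb : b ≤ S.card + k) (m : Msg V) :
    (N.backState S β k b h).backOut β h.isRelay (S.card + k - b) p = some m ↔
      ∃ r ∈ S, p ∈ N.parentPorts k h r ∧ N.cross S h p r = S.card + k - b ∧
        ∃ a, N.answer β k h r = some a ∧ m = .back r a.1 a.2 := by
  have hmem := fun r => N.known_filter_sched (h := h) (p := p) (r := r) (β := β)
    (τ := S.card + k - b) (S := S) (k := k) (by omega) b
  by_cases hne : ((N.backState S β k b h).known.filter
      (fun r => (N.backState S β k b h).sched r p = some (S.card + k - b))).Nonempty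
  · obtain ⟨r, hr⟩ := hne
    have hmin : ((N.backState S β k b h).known.filter (fun r =>
        (N.backState S β k b h).sched r p = some (S.card + k - b))).min' ⟨r, hr⟩ = r := by
      have h1 := Finset.min'_mem _ ⟨r, hr⟩
      obtain ⟨a1, -, a2⟩ := (hmem _).1 h1
      obtain ⟨b1, -, b2⟩ := (hmem _).1 hr
      exact N.cross_inj a1 b1 (a2.trans b2.symm)
    obtain ⟨hrS, hpar, hc⟩ := (hmem r).1 hr
    obtain ⟨hp, hd, hk⟩ := N.mem_parentPorts.1 hpar
    -- Crossing from the parent, then release, then crossing to a child: reversed, every child has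
    -- answered before.
    have hchild : ∀ q ∈ N.childPorts k h r, S.card + k + 1 ≤ N.cross S h q r + b := by
      intro q hq
      obtain ⟨q1, q2, q3⟩ := N.mem_childPorts.1 hq
      have h1 := N.release_le_cross hh q1 hrS (by omega)
      have h2 := N.cross_lt_release hh hp hrS hd
      omega
    have hout : (N.backState S β k b h).backOut β h.isRelay (S.card + k - b) p =
        (N.answer β k h r).map fun a => .back r a.1 a.2 := by
      rw [Proc.backOut, dif_pos ⟨r, hr⟩, hmin]
      have hrel := N.release_lt (h := h) hrS
      cases h with
      | relay u v j =>
        simp only [Site.isRelay, if_true]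
        congr 1
        simp only [Network.backState]
        split_ifs with h1
        · rfl
        · rw [N.answer_relay_of_forall]
          exact fun q hq => h1 ⟨hrS, q, hq, hchild q hq⟩
      | node u =>
        have hru : r ≠ u := by
          rintro rfl
          rw [(N.sdist_eq_zero_iff hh).2 rfl] at hd
          omega
        have htsp : (N.backState S β k b (.node u)).tsp r = N.tspVal β k (.node u) r :=
          N.waveState_tsp hh hrS (by omega)
        have hdep : (N.backState S β k b (.node u)).dep r = N.depVal β k u r := by
          simp only [Network.backState]
          rw [if_pos ⟨hrS, hru⟩, Network.depVal, if_neg hru, Finset.filter_true_of_mem hchild]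
        simp [Site.isRelay, N.answer_node hk, htsp, hdep]
    rw [hout, Option.map_eq_some_iff]
    constructor
    · rintro ⟨a, h1, h2⟩
      exact ⟨r, hrS, hpar, hc, a, h1, h2.symm⟩
    · rintro ⟨r', h1, h2, h3, a, h4, rfl⟩
      obtain rfl := N.cross_inj h1 hrS (h3.trans hc.symm)
      exact ⟨a, h4, rfl⟩
  · rw [Proc.backOut, dif_neg hne]
    simp only [reduceCtorEq, false_iff]
    rintro ⟨r, h1, h2, h3, -⟩
    exact hne ⟨r, (hmem r).2 ⟨h1, h2, h3⟩⟩

variable (N S β k) in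
/-- After `b` slots of `DLGagr`, `h` receives what its neighbours send. -/
def Network.BackInc (b : ℕ) (h : Site V) (inc : V → Option (Msg V)) : Prop :=
  ∀ p ∈ N.ports h, inc p = (N.backState S β k b (N.nb h p)).backOut β (N.nb h p).isRelay
    (S.card + k - b) (h.rev p)

variable {inc : V → Option (Msg V)} {b : ℕ}

theorem Network.backInc_iff (hh : N.Valid h) (hb : b ≤ S.card + k)
    (hinc : N.BackInc S β k b h inc) (hp : p ∈ N.ports h) (m : Msg V) :
    inc p = some m ↔ ∃ r ∈ S, p ∈ N.childPorts k h r ∧ N.cross S h p r = S.card + k - b ∧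
        ∃ a, N.answer β k (N.nb h p) r = some a ∧ m = .back r a.1 a.2 := by
  rw [hinc p hp, N.backState_backOut_iff (N.nb_spec hh hp).1 hb]
  simp only [N.rev_mem_parentPorts_iff hh hp, N.cross_nb hh hp]

theorem Network.backInc_contrib {u : V} (hb : b ≤ S.card + k)
    (hinc : N.BackInc S β k b (.node u) inc) (hp : p ∈ N.ports (.node u)) (P : Proc V)
    (hr : r ∈ S) (hru : r ≠ u) : P.contrib u inc r p =
      if p ∈ N.childPorts k (.node u) r ∧ N.cross S (.node u) p r = S.card + k - b then
        answerContrib (P.tsp r) (N.answer β k (N.nb (.node u) p) r) else 0 := by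
  have key := N.backInc_iff (h := .node u) trivial hb hinc hp
  cases hi : inc p with
  | none =>
    have : P.contrib u inc r p = 0 := by simp [Proc.contrib, hi]
    rw [this]
    split_ifs with h1
    · cases ha : N.answer β k (N.nb (.node u) p) r with
      | none => rfl
      | some a =>
        have := (key _).2 ⟨r, hr, h1.1, h1.2, a, ha, rfl⟩
        rw [hi] at this
        cases this
    · rfl
  | some m =>
    obtain ⟨r', h1, h2, h3, a, h4, rfl⟩ := (key m).1 hi
    simp only [Proc.contrib, hi]
    by_cases hrr : r' = r
    · subst hrr
      rw [if_pos ⟨rfl, hru⟩, if_pos ⟨h2, h3⟩, h4]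
      rfl
    · rw [if_neg (fun h => hrr h.1)]
      split_ifs with h5
      · exact absurd (N.cross_inj h1 hr (h3.trans h5.2.symm)) hrr
      · rfl

/-- In this slot exactly the answers arrive whose links were crossed in slot |S| + k - b, which
extends the range of the partial sum by that slot. -/
theorem Network.backIn_backState {u : V} (hb : b ≤ S.card + k)
    (hinc : N.BackInc S β k b (.node u) inc) :
    (N.backState S β k b (.node u)).backIn u (N.ports (.node u)) inc =
      N.backState S β k (b + 1) (.node u) := by
  classical
  have hdep : ((N.backState S β k b (.node u)).backIn u (N.ports (.node u)) inc).dep =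
      (N.backState S β k (b + 1) (.node u)).dep := by
    funext r
    simp only [Proc.backIn]
    by_cases hr : r ∈ S ∧ r ≠ u
    · rw [Finset.sum_congr rfl fun p hp => N.backInc_contrib hb hinc hp _ hr.1 hr.2,
        ← Finset.sum_filter]
      -- The path count is known to be complete only within distance `k`; farther away there are no
      -- child ports and nothing is added.
      by_cases hrel : N.sdist r (.node u) ≤ k
      · have htsp : (N.backState S β k b (.node u)).tsp r = N.tspVal β k (.node u) r := by
          have hrel := N.release_lt (h := .node u) hr.1
          exact N.waveState_tsp (h := .node u) trivial hr.1 (by omega)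
        rw [htsp]
        simp only [Network.backState, if_pos hr]
        rw [← Finset.sum_union]
        · apply Finset.sum_congr _ fun _ _ => rfl
          ext p
          simp only [Finset.mem_union, Finset.mem_filter]
          constructor
          · rintro (⟨h1, h2⟩ | ⟨h1, h2, h3⟩)
            · exact ⟨h1, by omega⟩
            · exact ⟨h2, by omega⟩
          · rintro ⟨h1, h2⟩
            rcases Nat.lt_or_ge (S.card + k) (N.cross S (.node u) p r + b) with h3 | h3
            · exact Or.inl ⟨h1, h3⟩
            · exact Or.inr ⟨(N.mem_childPorts.1 h1).1, h1, by omega⟩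
        · rw [Finset.disjoint_left]
          intro p h1 h2
          have h1' := (Finset.mem_filter.1 h1).2
          have h2' := (Finset.mem_filter.1 h2).2.2
          omega
      · have hempty : ∀ p, p ∉ N.childPorts k (.node u) r := fun p hp => by
          obtain ⟨-, h1, h2⟩ := N.mem_childPorts.1 hp
          omega
        simp only [Network.backState, if_pos hr]
        rw [Finset.eq_empty_of_forall_notMem hempty]
        simp
    · have hz : ∀ b, (N.backState S β k b (.node u)).dep r = 0 := fun b => by
        simp only [Network.backState, if_neg hr]
      rw [hz, hz, zero_add]
      apply Finset.sum_eq_zero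
      intro p hp
      cases hi : inc p with
      | none => simp [Proc.contrib, hi]
      | some m =>
        obtain ⟨r', h1, h2, h3, a, h4, rfl⟩ :=
          (N.backInc_iff (h := .node u) trivial hb hinc hp m).1 hi
        simp only [Proc.contrib, hi]
        rw [if_neg]
        rintro ⟨rfl, h5⟩
        exact hr ⟨h1, h5⟩
  have : (N.backState S β k b (.node u)).backIn u (N.ports (.node u)) inc =
      { N.waveState S β k (S.card + k + 1) (.node u) with
        dep := ((N.backState S β k b (.node u)).backIn u (N.ports (.node u)) inc).dep
        fwd := fun _ => none } := rfl
  rw [this, hdep]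
  rfl

theorem Network.backInc_backPart (hh : N.Valid h) (hb : b ≤ S.card + k)
    (hinc : N.BackInc S β k b h inc) (hp : p ∈ N.ports h) :
    backPart r (inc p) = if r ∈ S ∧ p ∈ N.childPorts k h r ∧
      N.cross S h p r = S.card + k - b then N.answer β k (N.nb h p) r else none := by
  have key := N.backInc_iff hh hb hinc hp
  cases hi : inc p with
  | none =>
    split_ifs with h1
    · cases ha : N.answer β k (N.nb h p) r with
      | none => rfl
      | some a =>
        have := (key _).2 ⟨r, h1.1, h1.2.1, h1.2.2, a, ha, rfl⟩
        rw [hi] at this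
        cases this
    · rfl
  | some m =>
    obtain ⟨r', h1, h2, h3, a, h4, rfl⟩ := (key m).1 hi
    simp only [backPart]
    by_cases hrr : r' = r
    · subst hrr
      rw [if_pos rfl, if_pos ⟨h1, h2, h3⟩, h4]
    · rw [if_neg hrr, if_neg]
      rintro ⟨h5, -, h6⟩
      exact hrr (N.cross_inj h1 h5 (h3.trans h6.symm))

theorem Network.relayIn_backState {u v : V} {j : ℕ} (hh : N.Valid (.relay u v j))
    (hb : b ≤ S.card + k) (hinc : N.BackInc S β k b (.relay u v j) inc) :
    (N.backState S β k b (.relay u v j)).relayIn u v inc =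
      N.backState S β k (b + 1) (.relay u v j) := by
  have hfwd : ((N.backState S β k b (.relay u v j)).relayIn u v inc).fwd =
      (N.backState S β k (b + 1) (.relay u v j)).fwd := by
    funext r
    rw [relayIn_fwd, N.backInc_backPart hh hb hinc (N.mem_ports_relay.2 (Or.inl rfl)),
      N.backInc_backPart hh hb hinc (N.mem_ports_relay.2 (Or.inr rfl))]
    simp only [Network.backState]
    by_cases hc : r ∈ S ∧ ∃ p, p ∈ N.childPorts k (.relay u v j) r
    · obtain ⟨hr, p, hp⟩ := hc
      have huniq : ∀ q, q ∈ N.childPorts k (.relay u v j) r → q = p := fun q hq =>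
        N.childPorts_relay_unique hh hq hp
      have hans := N.answer_relay_of_mem (β := β) hh hp
      -- With a single child port, the stored answer is governed by the crossing slot of that port
      -- alone.
      have hex : ∀ P : V → Prop, (∃ q ∈ N.childPorts k (.relay u v j) r, P q) ↔ P p := fun P =>
        ⟨fun ⟨q, h1, h2⟩ => huniq q h1 ▸ h2, fun h => ⟨p, hp, h⟩⟩
      simp only [hex, hr, true_and]
      have hne : v ≠ u := hh.1.ne'
      have hpuv := N.mem_ports_relay.1 (N.mem_childPorts.1 hp).1
      rcases hpuv with rfl | rfl
      · have hv : v ∉ N.childPorts k (.relay p v j) r := fun h => hne (huniq v h)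
        simp only [hp, hv, true_and, false_and, if_false, Option.none_or, ← hans]
        split_ifs <;> first | omega | simp
      · have hv : u ∉ N.childPorts k (.relay u p j) r := fun h => hne (huniq u h).symm
        simp only [hp, hv, true_and, false_and, if_false, Option.none_or, ← hans]
        split_ifs <;> first | omega | simp
    · have hno : ∀ q, r ∈ S → q ∉ N.childPorts k (.relay u v j) r := fun q hr hq => hc ⟨hr, q, hq⟩
      rw [if_neg (fun h => hno _ h.1 h.2.1), if_neg (fun h => hno _ h.1 h.2.1),
        if_neg (fun ⟨h1, q, h2, _⟩ => hno q h1 h2), if_neg (fun ⟨h1, q, h2, _⟩ => hno q h1 h2)]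
      rfl
  have : (N.backState S β k b (.relay u v j)).relayIn u v inc =
      { N.waveState S β k (S.card + k + 1) (.relay u v j) with
        dep := fun _ => 0
        fwd := ((N.backState S β k b (.relay u v j)).relayIn u v inc).fwd } := rfl
  rw [this, hfwd]
  rfl

theorem Network.backState_dep {u : V} (hr : r ∈ S) :
    (N.backState S β k (S.card + k + 1) (.node u)).dep r = N.depVal β k u r := by
  simp only [Network.backState, Network.depVal]
  by_cases h1 : r = u
  · simp [h1]
  · rw [if_pos ⟨hr, h1⟩, if_neg h1, Finset.filter_true_of_mem]
    intros
    omega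

end Back

end BCSetup

/-! ### Floating-point rounding. -/

namespace BCSetup

section Rounding

variable {β : ℕ} {x : ℚ}

theorem Flt.round_of_nonpos (hx : x ≤ 0) : Flt.round β x = ⟨0, 0⟩ := if_pos hx

theorem Flt.round_of_pos (hx : 0 < x) : Flt.round β x =
    ⟨⌊x / (2 : ℚ) ^ (Int.log 2 x + 1 - (β : ℤ))⌋₊, Int.log 2 x + 1 - (β : ℤ)⟩ :=
  if_neg (not_le.2 hx)

theorem Flt.val_nonneg (y : Flt) : 0 ≤ y.val := by
  unfold Flt.val
  positivity

theorem Flt.round_val_le (hx : 0 ≤ x) : (Flt.round β x).val ≤ x := by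
  rcases hx.eq_or_lt with rfl | hx
  · simp [Flt.round_of_nonpos, Flt.val]
  · rw [Flt.round_of_pos hx, Flt.val]
    have h2 : (0 : ℚ) < (2 : ℚ) ^ (Int.log 2 x + 1 - (β : ℤ)) := by positivity
    calc _ ≤ x / (2 : ℚ) ^ (Int.log 2 x + 1 - (β : ℤ)) * (2 : ℚ) ^ (Int.log 2 x + 1 - (β : ℤ)) := by
          gcongr
          exact Nat.floor_le (by positivity)
      _ = x := div_mul_cancel₀ _ h2.ne'

theorem Flt.round_mant_lt (hx : 0 < x) : (Flt.round β x).mant < 2 ^ β := by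
  rw [Flt.round_of_pos hx]
  simp only
  rw [Nat.floor_lt (by positivity), div_lt_iff₀ (by positivity)]
  have := Int.lt_zpow_succ_log_self (b := 2) (by norm_num) x
  calc x < (2 : ℚ) ^ (Int.log 2 x + 1) := by exact_mod_cast this
    _ = (2 : ℚ) ^ ((β : ℤ) + (Int.log 2 x + 1 - (β : ℤ))) := by congr 1; ring
    _ = _ := by rw [zpow_add₀ (by norm_num)]; simp

theorem Flt.le_round_mant (hβ : 1 ≤ β) (hx : 0 < x) : 2 ^ (β - 1) ≤ (Flt.round β x).mant := by
  rw [Flt.round_of_pos hx]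
  simp only
  rw [Nat.le_floor_iff (by positivity), le_div_iff₀ (by positivity)]
  have := Int.zpow_log_le_self (b := 2) (by norm_num) hx
  calc _ = (2 : ℚ) ^ (((β - 1 : ℕ) : ℤ) + (Int.log 2 x + 1 - (β : ℤ))) := by
        rw [zpow_add₀ (by norm_num)]; simp
    _ = (2 : ℚ) ^ (Int.log 2 x) := by congr 1; push_cast [Nat.cast_sub hβ]; ring
    _ ≤ x := by exact_mod_cast this

theorem Flt.zpow_log_le_round (hβ : 1 ≤ β) (hx : 0 < x) :
    (2 : ℚ) ^ Int.log 2 x ≤ (Flt.round β x).val := by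
  have h1 := Flt.le_round_mant hβ hx
  have he : (Flt.round β x).exp = Int.log 2 x + 1 - (β : ℤ) := by rw [Flt.round_of_pos hx]
  rw [Flt.val, he]
  calc (2 : ℚ) ^ (Int.log 2 x)
      = (2 : ℚ) ^ (((β - 1 : ℕ) : ℤ) + (Int.log 2 x + 1 - (β : ℤ))) := by
        congr 1; push_cast [Nat.cast_sub hβ]; ring
    _ = ((2 ^ (β - 1) : ℕ) : ℚ) * (2 : ℚ) ^ (Int.log 2 x + 1 - (β : ℤ)) := by
        rw [zpow_add₀ (by norm_num)]; simp
    _ ≤ _ := by gcongr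

theorem Flt.round_val_pos (hβ : 1 ≤ β) (hx : 0 < x) : 0 < (Flt.round β x).val :=
  lt_of_lt_of_le (by positivity) (Flt.zpow_log_le_round hβ hx)

/-- For positive `x`, rounding down stays between the same two consecutive powers of 2, so the
second rounding uses the same exponent and finds an integral mantissa. Relays therefore cause no
further error. -/
theorem Flt.round_round (hβ : 1 ≤ β) : Flt.round β (Flt.round β x).val = Flt.round β x := by
  rcases le_or_gt x 0 with hx | hx
  · rw [Flt.round_of_nonpos hx]
    exact Flt.round_of_nonpos (by simp [Flt.val])
  · have hy := Flt.round_val_pos hβ hx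
    have hlog : Int.log 2 (Flt.round β x).val = Int.log 2 x := by
      apply le_antisymm
      · exact Int.log_mono_right hy (Flt.round_val_le hx.le)
      · rw [← Int.zpow_le_iff_le_log (by norm_num) hy]
        exact_mod_cast Flt.zpow_log_le_round hβ hx
    have h0 : (2 : ℚ) ^ (Int.log 2 x + 1 - (β : ℤ)) ≠ 0 := by positivity
    rw [Flt.round_of_pos hy, hlog]
    have hv : (Flt.round β x).val / (2 : ℚ) ^ (Int.log 2 x + 1 - (β : ℤ)) =
        ((Flt.round β x).mant : ℚ) := by
      rw [div_eq_iff h0, Flt.val, Flt.round_of_pos hx]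
    rw [hv, Nat.floor_natCast, Flt.round_of_pos hx]

/-- Less than one unit of the last place is lost, and this unit is at most 2^(1-β) times `x`,
because `x` is at least its leading power of 2. -/
theorem Flt.le_round_val (hx : 0 ≤ x) :
    (1 - (2 : ℚ) ^ (1 - (β : ℤ))) * x ≤ (Flt.round β x).val := by
  rcases hx.eq_or_lt with rfl | hx
  · simp [Flt.round_of_nonpos, Flt.val]
  · have h2 : (0 : ℚ) < (2 : ℚ) ^ (Int.log 2 x + 1 - (β : ℤ)) := by positivity
    have h3 := Nat.lt_floor_add_one (x / (2 : ℚ) ^ (Int.log 2 x + 1 - (β : ℤ)))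
    rw [div_lt_iff₀ h2] at h3
    have h4 := Int.zpow_log_le_self (b := 2) (by norm_num) hx
    have h5 : (2 : ℚ) ^ (Int.log 2 x + 1 - (β : ℤ)) =
        (2 : ℚ) ^ (1 - (β : ℤ)) * (2 : ℚ) ^ (Int.log 2 x) := by
      rw [← zpow_add₀ (by norm_num)]; congr 1; ring
    have h6 : (2 : ℚ) ^ (Int.log 2 x + 1 - (β : ℤ)) ≤ (2 : ℚ) ^ (1 - (β : ℤ)) * x := by
      rw [h5]
      gcongr
      exact_mod_cast h4
    rw [Flt.round_of_pos hx, Flt.val]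
    simp only
    linarith

theorem Flt.one_le_round_val (hβ : 1 ≤ β) (hx : 1 ≤ x) : 1 ≤ (Flt.round β x).val := by
  refine le_trans ?_ (Flt.zpow_log_le_round hβ (by linarith))
  apply one_le_zpow₀ (by norm_num)
  have := Int.log_mono_right (b := 2) one_pos hx
  simpa using this

theorem Flt.round_one (hβ : 1 ≤ β) : (Flt.round β 1).val = 1 :=
  le_antisymm (Flt.round_val_le (by norm_num)) (Flt.one_le_round_val hβ le_rfl)

/-- The exponent has absolute value at most `M + β`, and only the length of that number enters the
message. -/
theorem Flt.round_bits_le {M : ℕ} (h1 : x < (2 : ℚ) ^ M) (h2 : 0 < x → 1 ≤ x * (2 : ℚ) ^ M) :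
    (Flt.round β x).bits ≤ β + (M + β).size + 1 := by
  rcases le_or_gt x 0 with hx | hx
  · rw [Flt.round_of_nonpos hx]
    simp [Flt.bits]
  · have hm := Nat.size_le.2 (Flt.round_mant_lt (β := β) hx)
    have hup : Int.log 2 x < M := by
      rw [← Int.lt_zpow_iff_log_lt (by norm_num) hx]
      exact_mod_cast h1
    have hlo : -(M : ℤ) ≤ Int.log 2 x := by
      rw [← Int.zpow_le_iff_le_log (by norm_num) hx, zpow_neg, zpow_natCast]
      rw [inv_le_iff_one_le_mul₀ (by positivity)]
      exact_mod_cast h2 hx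
    have he : (Flt.round β x).exp = Int.log 2 x + 1 - (β : ℤ) := by rw [Flt.round_of_pos hx]
    have hn : (Flt.round β x).exp.natAbs ≤ M + β := by
      rw [he]
      omega
    have := Nat.size_le_size hn
    unfold Flt.bits
    omega

end Rounding

end BCSetup

/-! ### Eliminating the relays: recursions over the nodes only. -/

namespace BCSetup

section Chains

variable {V : Type*} [Fintype V] [LinearOrder V] (N : Network V)

/-- The site at distance `j` from `x` on the edge from `x` to `y`. -/
def Network.along (x y : V) (j : ℕ) : Site V :=
  if j = 0 then .node x
  else if N.weight s(x, y) ≤ j then .node y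
  else if x < y then .relay x y j
  else .relay y x (N.weight s(y, x) - j)

variable {N} {x y r : V} {j : ℕ} {β k : ℕ}

theorem Network.along_zero : N.along x y 0 = .node x := if_pos rfl

theorem Network.along_weight (h : N.graph.Adj x y) : N.along x y (N.weight s(x, y)) = .node y := by
  have := N.weight_pos' h
  rw [Network.along, if_neg (by omega), if_pos le_rfl]

/-- Relays are stored from the endpoint of smaller identifier; `along` hides this, so that an edge
can be walked in either direction. -/
theorem Network.along_comm (h : N.graph.Adj x y) (hj : j ≤ N.weight s(x, y)) :
    N.along y x (N.weight s(x, y) - j) = N.along x y j := by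
  have hpos := N.weight_pos' h
  have hsw : N.weight s(y, x) = N.weight s(x, y) := by rw [Sym2.eq_swap]
  unfold Network.along
  rcases lt_or_gt_of_ne h.ne with hlt | hlt
  · simp only [hsw, hlt, not_lt.2 hlt.le]
    split_ifs <;> first | rfl | omega | contradiction | (congr 1; omega)
  · simp only [hsw, hlt, not_lt.2 hlt.le]
    split_ifs <;> first | rfl | omega | contradiction

theorem Network.along_valid (h : N.graph.Adj x y) (j : ℕ) : N.Valid (N.along x y j) := by
  have hsw : N.weight s(y, x) = N.weight s(x, y) := by rw [Sym2.eq_swap]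
  unfold Network.along
  split_ifs with h1 h2 h3
  · trivial
  · trivial
  · exact ⟨h3, h, by omega, by omega⟩
  · exact ⟨lt_of_le_of_ne (not_lt.1 h3) h.ne', h.symm, by omega, by omega⟩

theorem Network.mem_ports_along (h : N.graph.Adj x y) (hj : j < N.weight s(x, y)) :
    y ∈ N.ports (N.along x y j) := by
  unfold Network.along
  split_ifs with h1 h2 h3
  · exact N.mem_ports_node.2 h
  · omega
  · exact N.mem_ports_relay.2 (Or.inr rfl)
  · exact N.mem_ports_relay.2 (Or.inl rfl)

theorem Network.nb_along (h : N.graph.Adj x y) (hj : j < N.weight s(x, y)) :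
    N.nb (N.along x y j) y = N.along x y (j + 1) := by
  have hsw : N.weight s(y, x) = N.weight s(x, y) := by rw [Sym2.eq_swap]
  have hne := h.ne
  unfold Network.along
  rcases lt_or_gt_of_ne h.ne with hlt | hlt
  · by_cases h0 : j = 0
    · subst h0
      simp [Network.nb, hlt]
    · simp only [h0, not_le.2 hj, hlt, if_false, if_true, Network.nb, hne.symm]
      split_ifs <;> first | rfl | omega | contradiction
  · by_cases h0 : j = 0
    · subst h0
      simp [Network.nb, not_lt.2 hlt.le, hsw]
    · simp only [h0, not_le.2 hj, not_lt.2 hlt.le, if_false, Network.nb, hsw, if_true]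
      split_ifs <;> first | rfl | omega | contradiction

theorem Network.nb_along_left (h : N.graph.Adj x y) (hj : j < N.weight s(x, y)) :
    N.nb (N.along x y (j + 1)) x = N.along x y j := by
  have hsw : N.weight s(y, x) = N.weight s(x, y) := by rw [Sym2.eq_swap]
  rw [← N.along_comm h (j := j + 1) (by omega), ← N.along_comm h (j := j) hj.le,
    N.nb_along h.symm (by omega)]
  congr 1
  omega

theorem Network.ports_along (hj0 : 0 < j) (hj : j < N.weight s(x, y)) {p : V} :
    p ∈ N.ports (N.along x y j) ↔ p = x ∨ p = y := by
  unfold Network.along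
  rw [if_neg (by omega), if_neg (by omega)]
  split_ifs
  · exact N.mem_ports_relay
  · rw [N.mem_ports_relay, or_comm]

theorem Network.sdist_along (h : N.graph.Adj x y) (hj : j ≤ N.weight s(x, y)) :
    N.sdist r (N.along x y j) = min (wdist N.graph N.weight r x + j)
      (wdist N.graph N.weight r y + (N.weight s(x, y) - j)) := by
  have hsw : N.weight s(y, x) = N.weight s(x, y) := by rw [Sym2.eq_swap]
  have h1 := N.wdist_le_add r h
  have h2 := N.wdist_le_add r h.symm
  unfold Network.along
  split_ifs <;> simp only [Network.sdist] <;> omega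

theorem Network.along_ne_node (hj0 : 0 < j) (hj : j < N.weight s(x, y)) :
    N.along x y j ≠ .node r := by
  unfold Network.along
  rw [if_neg (by omega), if_neg (by omega)]
  split_ifs <;> simp

/-- On the part of an edge that is reached from `x`, the number of shortest paths is passed on
unchanged. -/
theorem Network.round_tspVal_along (hβ : 1 ≤ β) (h : N.graph.Adj x y)
    (hd : wdist N.graph N.weight r x + 2 * j <
      wdist N.graph N.weight r y + N.weight s(x, y))
    (hk : wdist N.graph N.weight r x + j ≤ k) :
    Flt.round β (N.tspVal β k (N.along x y j) r) = Flt.round β (N.tspVal β k (.node x) r) := by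
  have h1 := N.wdist_le_add r h
  induction j with
  | zero => rw [N.along_zero]
  | succ j ih =>
    have hjw : j + 1 < N.weight s(x, y) := by omega
    -- Before the meeting point of the two waves on the edge, the only port towards the root is `x`;
    -- the sum defining the path count has a single, already rounded term.
    have hpp : N.parentPorts k (N.along x y (j + 1)) r = {x} := by
      ext p
      rw [N.mem_parentPorts, N.ports_along (by omega) hjw, Finset.mem_singleton]
      constructor
      · rintro ⟨rfl | rfl, h2, -⟩
        · rfl
        · rw [N.nb_along h hjw, N.sdist_along h hjw.le, N.sdist_along h (by omega)] at h2
          omega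
      · rintro rfl
        refine ⟨Or.inl rfl, ?_⟩
        rw [N.nb_along_left h (by omega), N.sdist_along h hjw.le, N.sdist_along h (by omega)]
        omega
    rw [N.tspVal_eq_sum (N.along_valid h _) (N.along_ne_node (by omega) hjw), hpp,
      Finset.sum_singleton, Flt.round_round hβ, N.nb_along_left h (by omega)]
    exact ih (by omega) (by omega)

/-- Every site lies on an edge towards each of its ports. -/
theorem Network.exists_along {h : Site V} (hh : N.Valid h) {p : V} (hp : p ∈ N.ports h) :
    ∃ q j, N.graph.Adj q p ∧ j < N.weight s(q, p) ∧ h = N.along q p j ∧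
      (∀ u, h = .node u → u = q ∧ j = 0) := by
  cases h with
  | node u =>
    have ha := N.mem_ports_node.1 hp
    refine ⟨u, 0, ha, N.weight_pos' ha, N.along_zero.symm, ?_⟩
    rintro _ ⟨⟩
    exact ⟨rfl, rfl⟩
  | relay u v j =>
    obtain ⟨hlt, hadj, h0, hj⟩ := hh
    have hsw : N.weight s(v, u) = N.weight s(u, v) := by rw [Sym2.eq_swap]
    rcases N.mem_ports_relay.1 hp with rfl | rfl
    · refine ⟨v, N.weight s(p, v) - j, hadj.symm, by omega, ?_, by simp⟩
      rw [Network.along, if_neg (by omega), if_neg (by omega), if_neg (not_lt.2 hlt.le)]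
      congr 1
      omega
    · refine ⟨u, j, hadj, by omega, ?_, by simp⟩
      rw [Network.along, if_neg (by omega), if_neg (by omega), if_pos hlt]

/-- The site behind a parent port lies on the part of the edge that is reached from the endpoint
`p`. -/
theorem Network.round_tspVal_nb (hβ : 1 ≤ β) {h : Site V} (hh : N.Valid h) {p : V}
    (hp : p ∈ N.parentPorts k h r) :
    Flt.round β (N.tspVal β k (N.nb h p) r) = Flt.round β (N.tspVal β k (.node p) r) := by
  obtain ⟨hp1, hp2, hp3⟩ := N.mem_parentPorts.1 hp
  obtain ⟨q, j, ha, hj, rfl, -⟩ := N.exists_along hh hp1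
  have hsw : N.weight s(p, q) = N.weight s(q, p) := by rw [Sym2.eq_swap]
  rw [N.nb_along ha hj] at hp2 ⊢
  rw [N.sdist_along ha hj.le] at hp2 hp3
  rw [N.sdist_along ha (by omega)] at hp2
  rw [← N.along_comm ha (by omega)]
  apply N.round_tspVal_along hβ ha.symm <;> omega

theorem Network.tspVal_eq_sum_ports (hβ : 1 ≤ β) {h : Site V} (hh : N.Valid h)
    (hr : h ≠ .node r) : N.tspVal β k h r =
      ∑ p ∈ N.parentPorts k h r, (Flt.round β (N.tspVal β k (.node p) r)).val := by
  rw [N.tspVal_eq_sum hh hr]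
  exact Finset.sum_congr rfl fun p hp => by rw [N.round_tspVal_nb hβ hh hp]

theorem Network.mem_parentPorts_node {u p : V} (hk : wdist N.graph N.weight r u ≤ k) :
    p ∈ N.parentPorts k (.node u) r ↔ IsParent N.graph N.weight r p u := by
  rw [N.mem_parentPorts, N.mem_ports_node, IsParent]
  have hsd : N.sdist r (.node u) = wdist N.graph N.weight r u := rfl
  constructor
  · rintro ⟨ha, h1, -⟩
    refine ⟨ha.symm, ?_⟩
    have hsw : N.weight s(p, u) = N.weight s(u, p) := by rw [Sym2.eq_swap]
    have hpos := N.weight_pos' ha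
    have h2 := N.wdist_le_add r ha.symm
    rw [← N.along_zero (x := u) (y := p), N.nb_along ha hpos, N.sdist_along ha (by omega),
      N.along_zero, hsd] at h1
    omega
  · rintro ⟨ha', h1⟩
    have ha := ha'.symm
    refine ⟨ha, ?_, hk⟩
    have hsw : N.weight s(p, u) = N.weight s(u, p) := by rw [Sym2.eq_swap]
    have hpos := N.weight_pos' ha
    rw [← N.along_zero (x := u) (y := p), N.nb_along ha hpos, N.sdist_along ha (by omega),
      N.along_zero, hsd]
    omega

open Classical in
-- The rounded version of `sigma_eq_sum`. Relays have disappeared, so the number of roundings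
-- depends on hops and not on weights.
theorem Network.tspVal_node (hβ : 1 ≤ β) {u : V} (hr : u ≠ r)
    (hk : wdist N.graph N.weight r u ≤ k) : N.tspVal β k (.node u) r =
      ∑ p ∈ Finset.univ.filter (fun p => IsParent N.graph N.weight r p u),
        (Flt.round β (N.tspVal β k (.node p) r)).val := by
  rw [N.tspVal_eq_sum_ports (h := .node u) hβ trivial (by simpa using hr)]
  apply Finset.sum_congr _ fun _ _ => rfl
  ext p
  simp [N.mem_parentPorts_node hk]

/-- On an edge to a child, the answer of the child is passed on. -/
theorem Network.answer_along_child (hp : IsParent N.graph N.weight r x y)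
    (hk : wdist N.graph N.weight r y ≤ k) (hj0 : 0 < j) (hj : j ≤ N.weight s(x, y)) :
    N.answer β k (N.along x y j) r = N.answer β k (.node y) r := by
  obtain ⟨h, hd⟩ := hp
  induction hi : N.weight s(x, y) - j generalizing j with
  | zero => rw [show j = N.weight s(x, y) by omega, N.along_weight h]
  | succ i ih =>
    have hjw : j < N.weight s(x, y) := by omega
    rw [← ih (j := j + 1) (by omega) (by omega) (by omega), ← N.nb_along h hjw]
    have hc : y ∈ N.childPorts k (N.along x y j) r := by
      rw [N.mem_childPorts, N.nb_along h hjw, N.sdist_along h hj, N.sdist_along h (by omega)]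
      exact ⟨N.mem_ports_along h hjw, by omega, by omega⟩
    have hv := N.along_valid h j
    have hne : ∀ u, N.along x y j ≠ .node u := fun u => N.along_ne_node hj0 hjw
    cases hal : N.along x y j with
    | node u => exact absurd hal (hne u)
    | relay u v i =>
      rw [hal] at hc hv
      exact N.answer_relay_of_mem hv hc

/-- On an edge that leads neither to a child nor to a parent, there is no answer. -/
theorem Network.answer_along_none (h : N.graph.Adj x y)
    (hp : ¬ IsParent N.graph N.weight r x y) (hj0 : 0 < j) (hj : j ≤ N.weight s(x, y))
    (hd : N.sdist r (N.along x y j) = wdist N.graph N.weight r x + j) :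
    N.answer β k (N.along x y j) r = none := by
  have hne : wdist N.graph N.weight r y ≠ wdist N.graph N.weight r x + N.weight s(x, y) :=
    fun he => hp ⟨h, he⟩
  have h1 := N.wdist_le_add r h
  induction hi : N.weight s(x, y) - j generalizing j with
  | zero =>
    rw [show j = N.weight s(x, y) by omega, N.along_weight h] at hd
    exact absurd hd hne
  | succ i ih =>
    have hjw : j < N.weight s(x, y) := by omega
    have hv := N.along_valid h j
    have hnn : ∀ u, N.along x y j ≠ .node u := fun u => N.along_ne_node hj0 hjw
    have hx : x ∉ N.childPorts k (N.along x y j) r := by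
      intro hc
      have h2 := (N.mem_childPorts.1 hc).2.1
      obtain ⟨j', rfl⟩ : ∃ j', j = j' + 1 := ⟨j - 1, by omega⟩
      rw [N.nb_along_left h (by omega), hd, N.sdist_along h (by omega)] at h2
      omega
    by_cases hc : y ∈ N.childPorts k (N.along x y j) r
    · have h2 := (N.mem_childPorts.1 hc).2.1
      rw [N.nb_along h hjw, hd] at h2
      have h3 := ih (j := j + 1) (by omega) (by omega) (by omega) (by omega)
      rw [← h3, ← N.nb_along h hjw]
      cases hal : N.along x y j with
      | node u => exact absurd hal (hnn u)
      | relay u v i =>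
        rw [hal] at hc hv
        exact N.answer_relay_of_mem hv hc
    · have hall : ∀ p, p ∉ N.childPorts k (N.along x y j) r := by
        intro p hp'
        rcases (N.ports_along hj0 hjw).1 (N.mem_childPorts.1 hp').1 with rfl | rfl
        · exact hx hp'
        · exact hc hp'
      cases hal : N.along x y j with
      | node u => exact absurd hal (hnn u)
      | relay u v i =>
        rw [hal] at hall
        exact N.answer_relay_of_forall hall

/-- Answers originate at nodes and relays only forward them; the size of a message from a relay thus
reduces to values at nodes. -/
theorem Network.exists_of_answer_eq_some {h : Site V} (hh : N.Valid h) {a : Flt × Flt}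
    (ha : N.answer β k h r = some a) (hk : N.sdist r h ≤ k) :
    ∃ u, wdist N.graph N.weight r u ≤ k ∧
      a = (Flt.round β (N.depVal β k u r), Flt.round β (N.tspVal β k (.node u) r)) := by
  induction hi : k - N.sdist r h using Nat.strong_induction_on generalizing h with
  | _ i ih =>
  cases h with
  | node u =>
    rw [N.answer_node hk] at ha
    exact ⟨u, hk, (Option.some_injective _ ha).symm⟩
  | relay u v j =>
    by_cases hc : ∃ p, p ∈ N.childPorts k (.relay u v j) r
    · obtain ⟨p, hp⟩ := hc
      rw [N.answer_relay_of_mem hh hp] at ha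
      obtain ⟨h1, h2, h3⟩ := N.mem_childPorts.1 hp
      exact ih _ (by omega) (N.nb_spec hh h1).1 ha h3 rfl
    · rw [N.answer_relay_of_forall (fun p hp => hc ⟨p, hp⟩)] at ha
      cases ha

open Classical in
theorem Network.depVal_eq_sum {u : V} (hr : u ≠ r)
    (hk : ∀ v, wdist N.graph N.weight r v ≤ k) : N.depVal β k u r =
      ∑ v ∈ Finset.univ.filter (fun v => IsParent N.graph N.weight r u v),
        N.tspVal β k (.node u) r / (Flt.round β (N.tspVal β k (.node v) r)).val *
          (1 + (Flt.round β (N.depVal β k v r)).val) := by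
  rw [Network.depVal, if_neg hr.symm]
  symm
  have hnb : ∀ v, N.graph.Adj u v → N.nb (.node u) v = N.along u v 1 := fun v ha => by
    rw [← N.along_zero (x := u) (y := v), N.nb_along ha (N.weight_pos' ha)]
  refine Finset.sum_subset_zero_on_sdiff (fun v hv => ?_) (fun v hv => ?_) (fun v hv => ?_)
  · obtain ⟨ha, hd⟩ := (Finset.mem_filter.1 hv).2
    have hpos := N.weight_pos' ha
    have := hk v
    rw [N.mem_childPorts, N.mem_ports_node, hnb v ha, N.sdist_along ha (by omega)]
    refine ⟨ha, ?_, by omega⟩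
    have hsd : N.sdist r (.node u) = wdist N.graph N.weight r u := rfl
    omega
  -- A child port may lead onto an edge whose other endpoint is not a child, because two waves meet
  -- on it. No answer comes back from there.
  · obtain ⟨hv1, hv2⟩ := Finset.mem_sdiff.1 hv
    obtain ⟨h1, h2, -⟩ := N.mem_childPorts.1 hv1
    have ha := N.mem_ports_node.1 h1
    have hn : ¬ IsParent N.graph N.weight r u v := fun h => hv2 (by simpa using h)
    rw [hnb v ha] at h2 ⊢
    rw [N.answer_along_none ha hn one_pos (N.weight_pos' ha) h2]
    rfl
  · have hp := (Finset.mem_filter.1 hv).2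
    rw [hnb v hp.1, N.answer_along_child hp (hk v) one_pos (N.weight_pos' hp.1),
      N.answer_node (hk v)]
    rfl

end Chains

end BCSetup

/-! ### Error analysis. -/

namespace BCSetup

section Accuracy

variable {V : Type*} [Fintype V] [LinearOrder V] {N : Network V} {β k : ℕ} {r : V}

theorem Network.one_le_tspVal (hβ : 1 ≤ β) {h : Site V} (hh : N.Valid h) (hk : N.sdist r h ≤ k) :
    1 ≤ N.tspVal β k h r := by
  induction hi : N.sdist r h using Nat.strong_induction_on generalizing h with
  | _ i ih =>
  by_cases hr : h = .node r
  · rw [hr, N.tspVal_root]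
  · obtain ⟨p, hp, hd⟩ := N.exists_parent_port hh hr
    rw [N.tspVal_eq_sum hh hr]
    refine le_trans ?_ (Finset.single_le_sum (fun p _ => Flt.val_nonneg _)
      (N.mem_parentPorts.2 ⟨hp, hd, hk⟩))
    exact Flt.one_le_round_val hβ (ih _ (by omega) (N.nb_spec hh hp).1 (by omega) rfl)

theorem Network.tspVal_le_sigma (hβ : 1 ≤ β) (hk : ∀ v, wdist N.graph N.weight r v ≤ k) (u : V) :
    N.tspVal β k (.node u) r ≤ sigma N.graph N.weight r u := by
  classical
  induction hi : wdist N.graph N.weight r u using Nat.strong_induction_on generalizing u with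
  | _ i ih =>
  by_cases hr : u = r
  · rw [hr, N.tspVal_root, sigma_self]
    norm_num
  · rw [N.tspVal_node hβ hr (hk u), sigma_eq_sum N.connected N.weight_pos hr, Nat.cast_sum]
    apply Finset.sum_le_sum
    intro p hp
    have hlt := (Finset.mem_filter.1 hp).2.wdist_lt N.weight_pos
    refine (Flt.round_val_le ?_).trans (ih _ (by omega) p rfl)
    exact zero_le_one.trans (N.one_le_tspVal (h := .node p) hβ trivial (hk p))

/-- One factor is lost per rounding and the rank drops by at least 1 at each parent. The root loses
nothing, since 1 is represented exactly. -/
theorem Network.le_round_tspVal (hβ : 1 ≤ β) (hk : ∀ v, wdist N.graph N.weight r v ≤ k) (u : V) :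
    (1 - (2 : ℚ) ^ (1 - (β : ℤ))) ^ rank N.graph N.weight r u * sigma N.graph N.weight r u ≤
      (Flt.round β (N.tspVal β k (.node u) r)).val := by
  classical
  have hε1 : (2 : ℚ) ^ (1 - (β : ℤ)) ≤ 1 := zpow_le_one_of_nonpos₀ (by norm_num) (by omega)
  have hε0 : 0 ≤ (2 : ℚ) ^ (1 - (β : ℤ)) := by positivity
  set q : ℚ := 1 - (2 : ℚ) ^ (1 - (β : ℤ)) with hq
  have hq0 : 0 ≤ q := by linarith
  have hq1 : q ≤ 1 := by linarith
  induction hi : wdist N.graph N.weight r u using Nat.strong_induction_on generalizing u with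
  | _ i ih =>
  by_cases hr : u = r
  · rw [hr, N.tspVal_root, sigma_self, Flt.round_one hβ]
    simpa using pow_le_one₀ hq0 hq1
  · obtain ⟨p0, hp0⟩ := exists_isParent (w := N.weight) N.connected hr
    have hr0 : 0 < rank N.graph N.weight r u :=
      (Nat.zero_le _).trans_lt (rank_lt_rank (hp0.wdist_lt N.weight_pos))
    have h0 : 0 ≤ N.tspVal β k (.node u) r :=
      zero_le_one.trans (N.one_le_tspVal (h := .node u) hβ trivial (hk u))
    refine le_trans ?_ (Flt.le_round_val h0)
    obtain ⟨j, hj⟩ := Nat.exists_eq_succ_of_ne_zero hr0.ne'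
    rw [hj, Nat.succ_eq_add_one, pow_succ', mul_assoc]
    apply mul_le_mul_of_nonneg_left _ hq0
    rw [N.tspVal_node hβ hr (hk u), sigma_eq_sum N.connected N.weight_pos hr, Nat.cast_sum,
      Finset.mul_sum]
    apply Finset.sum_le_sum
    intro p hp
    have hlt := (Finset.mem_filter.1 hp).2.wdist_lt N.weight_pos
    refine le_trans ?_ (ih _ (by omega) p rfl)
    apply mul_le_mul_of_nonneg_right _ (Nat.cast_nonneg _)
    apply pow_le_pow_of_le_one hq0 hq1
    have := rank_lt_rank hlt
    omega

theorem Network.depVal_nonneg (hβ : 1 ≤ β) (hk : ∀ v, wdist N.graph N.weight r v ≤ k) (u : V) :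
    0 ≤ N.depVal β k u r := by
  by_cases hr : u = r
  · simp [Network.depVal, hr]
  · rw [N.depVal_eq_sum hr hk]
    apply Finset.sum_nonneg
    intro v _
    have h1 := N.one_le_tspVal (h := .node u) hβ trivial (hk u)
    have h2 := Flt.val_nonneg (Flt.round β (N.tspVal β k (.node v) r))
    have h3 := Flt.val_nonneg (Flt.round β (N.depVal β k v r))
    have : 0 ≤ N.tspVal β k (.node u) r := by linarith
    positivity

theorem sigma_pos_real (s u : V) : (0 : ℝ) < sigma N.graph N.weight s u := by
  exact_mod_cast sigma_pos (w := N.weight) N.connected s u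

theorem relDep_nonneg (s u : V) : 0 ≤ relDep N.graph N.weight s u :=
  div_nonneg (dependency_nonneg s u) (Nat.cast_nonneg _)

theorem rank_child_lt {s u v : V} (h : IsParent N.graph N.weight s u v) :
    Fintype.card V - 1 - rank N.graph N.weight s v + 1 ≤
      Fintype.card V - 1 - rank N.graph N.weight s u := by
  have h1 := rank_lt_rank (h.wdist_lt N.weight_pos)
  have h2 := rank_lt_card (G := N.graph) (w := N.weight) s v
  omega

/-- What a proof by induction needs to know about the values at one node. -/
theorem Network.real_bounds (hβ : 1 ≤ β) (hk : ∀ v, wdist N.graph N.weight r v ≤ k) (u : V) :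
    let q : ℝ := 1 - (2 : ℝ) ^ (1 - (β : ℤ))
    let τ : ℝ := (N.tspVal β k (.node u) r : ℝ)
    let ρ : ℝ := ((Flt.round β (N.tspVal β k (.node u) r)).val : ℝ)
    let d : ℝ := (N.depVal β k u r : ℝ)
    let e : ℝ := ((Flt.round β (N.depVal β k u r)).val : ℝ)
    1 ≤ τ ∧ τ ≤ sigma N.graph N.weight r u ∧ 1 ≤ ρ ∧ ρ ≤ τ ∧ q * τ ≤ ρ ∧
      q ^ (Fintype.card V - 1) * sigma N.graph N.weight r u ≤ ρ ∧
      q ^ rank N.graph N.weight r u * sigma N.graph N.weight r u ≤ ρ ∧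
      0 ≤ d ∧ 0 ≤ e ∧ e ≤ d ∧ q * d ≤ e := by
  have h1 := N.one_le_tspVal (h := .node u) hβ trivial (hk u)
  have h0 : 0 ≤ N.tspVal β k (.node u) r := zero_le_one.trans h1
  have h2 := N.tspVal_le_sigma hβ hk u
  have h3 := Flt.one_le_round_val hβ h1
  have h4 := Flt.round_val_le (β := β) h0
  have h5 := Flt.le_round_val (β := β) h0
  have h6 := N.le_round_tspVal hβ hk u
  have hd := N.depVal_nonneg hβ hk u
  have h7 := Flt.val_nonneg (Flt.round β (N.depVal β k u r))
  have h8 := Flt.round_val_le (β := β) hd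
  have h9 := Flt.le_round_val (β := β) hd
  have hε1 : (2 : ℝ) ^ (1 - (β : ℤ)) ≤ 1 := zpow_le_one_of_nonpos₀ (by norm_num) (by omega)
  have hε0 : 0 ≤ (2 : ℝ) ^ (1 - (β : ℤ)) := by positivity
  have hcast : (2 : ℝ) ^ (1 - (β : ℤ)) = (((2 : ℚ) ^ (1 - (β : ℤ)) : ℚ) : ℝ) := by
    rw [Rat.cast_zpow, Rat.cast_ofNat]
  rw [hcast] at hε0 hε1 ⊢
  generalize (2 : ℚ) ^ (1 - (β : ℤ)) = ε at *
  have h6' : (1 - (ε : ℝ)) ^ rank N.graph N.weight r u *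
      sigma N.graph N.weight r u ≤
      ((Flt.round β (N.tspVal β k (.node u) r)).val : ℝ) := by exact_mod_cast h6
  refine ⟨by exact_mod_cast h1, by exact_mod_cast h2, by exact_mod_cast h3, by exact_mod_cast h4,
    by exact_mod_cast h5, ?_, h6', by exact_mod_cast hd, by exact_mod_cast h7,
    by exact_mod_cast h8, by exact_mod_cast h9⟩
  refine le_trans ?_ h6'
  apply mul_le_mul_of_nonneg_right _ (Nat.cast_nonneg _)
  have := rank_lt_card (G := N.graph) (w := N.weight) r u
  exact pow_le_pow_of_le_one (by linarith) (by linarith) (by omega)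

open Classical in
theorem Network.depVal_eq_sum_real {u : V} (hr : u ≠ r)
    (hk : ∀ v, wdist N.graph N.weight r v ≤ k) : (N.depVal β k u r : ℝ) =
      (N.tspVal β k (.node u) r : ℝ) *
      ∑ v ∈ Finset.univ.filter (fun v => IsParent N.graph N.weight r u v),
        (1 + ((Flt.round β (N.depVal β k v r)).val : ℝ)) /
          ((Flt.round β (N.tspVal β k (.node v) r)).val : ℝ) := by
  rw [N.depVal_eq_sum hr hk, Finset.mul_sum]
  push_cast
  apply Finset.sum_congr rfl
  intro v _
  ring

theorem Network.depVal_root_eq_zero : N.depVal β k r r = 0 := if_pos rfl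

/-- Rounding down can increase a dependency only through the path counts in the denominators. The
first n - 1 factors pay for 1/ρ against 1/σ, where ρ is the rounded count. One more per level, with
at most n - 1 - rank levels below `u`, pays for the quotient of the child's unrounded count by the
rounded one. -/
theorem Network.depVal_upper (hβ : 1 ≤ β) (hk : ∀ v, wdist N.graph N.weight r v ≤ k)
    (u : V) (hr : u ≠ r) :
    (N.depVal β k u r : ℝ) * (1 - (2 : ℝ) ^ (1 - (β : ℤ))) ^
        (Fintype.card V - 1 + (Fintype.card V - 1 - rank N.graph N.weight r u)) ≤
      (N.tspVal β k (.node u) r : ℝ) * relDep N.graph N.weight r u := by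
  classical
  have hε1 : (2 : ℝ) ^ (1 - (β : ℤ)) ≤ 1 := zpow_le_one_of_nonpos₀ (by norm_num) (by omega)
  have hε0 : 0 ≤ (2 : ℝ) ^ (1 - (β : ℤ)) := by positivity
  have hb := fun v => N.real_bounds (r := r) hβ hk v
  set q : ℝ := 1 - (2 : ℝ) ^ (1 - (β : ℤ)) with hq
  have hq0 : 0 ≤ q := by linarith
  have hq1 : q ≤ 1 := by linarith
  induction hi : Fintype.card V - 1 - rank N.graph N.weight r u using Nat.strong_induction_on
    generalizing u with
  | _ i ih =>
  rw [N.depVal_eq_sum_real hr hk, relDep_eq_sum N.connected N.weight_pos hr, mul_assoc,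
    Finset.sum_mul]
  apply mul_le_mul_of_nonneg_left _ (zero_le_one.trans (hb u).1)
  apply Finset.sum_le_sum
  intro v hv
  have hpar := (Finset.mem_filter.1 hv).2
  have hlt := rank_child_lt hpar
  have hvr : v ≠ r := by
    rintro rfl
    have := hpar.wdist_lt N.weight_pos
    rw [wdist_self] at this
    omega
  have ihv := ih _ (by omega) v hvr rfl
  obtain ⟨b1, b2, b3, b4, b5, b6, b7, b8, b9, b10, b11⟩ := hb v
  have hσ := sigma_pos_real (N := N) r v
  have hα := relDep_nonneg (N := N) r v
  have hpow1 : q ^ (Fintype.card V - 1 + i) ≤ q ^ (Fintype.card V - 1) :=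
    pow_le_pow_of_le_one hq0 hq1 (by omega)
  have hpow2 : q ^ (Fintype.card V - 1 + i) ≤
      q ^ (Fintype.card V - 1 + (Fintype.card V - 1 - rank N.graph N.weight r v)) * q := by
    rw [← pow_succ]
    exact pow_le_pow_of_le_one hq0 hq1 (by omega)
  have hρ : (0 : ℝ) < ((Flt.round β (N.tspVal β k (.node v) r)).val : ℝ) :=
    zero_lt_one.trans_le b3
  rw [div_mul_eq_mul_div, div_le_iff₀ hρ, add_mul, add_mul, one_mul]
  apply add_le_add
  · rw [div_mul_eq_mul_div, one_mul, le_div_iff₀ hσ]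
    exact (mul_le_mul_of_nonneg_right hpow1 hσ.le).trans b6
  · calc _ ≤ (N.depVal β k v r : ℝ) * (q ^ (Fintype.card V - 1 +
            (Fintype.card V - 1 - rank N.graph N.weight r v)) * q) :=
          mul_le_mul b10 hpow2 (by positivity) b8
      _ = q * ((N.depVal β k v r : ℝ) * q ^ (Fintype.card V - 1 +
            (Fintype.card V - 1 - rank N.graph N.weight r v))) := by ring
      _ ≤ q * ((N.tspVal β k (.node v) r : ℝ) * relDep N.graph N.weight r v) :=
          mul_le_mul_of_nonneg_left ihv hq0
      _ = (q * (N.tspVal β k (.node v) r : ℝ)) * relDep N.graph N.weight r v := by ring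
      _ ≤ _ := by
          rw [mul_comm (relDep _ _ _ _)]
          exact mul_le_mul_of_nonneg_right b5 hα

/-- Here the rounded denominators help, as they do not exceed the exact counts. Only the rounding of
the children's dependencies costs one factor per level. -/
theorem Network.depVal_lower (hβ : 1 ≤ β) (hk : ∀ v, wdist N.graph N.weight r v ≤ k)
    (u : V) (hr : u ≠ r) :
    (N.tspVal β k (.node u) r : ℝ) * relDep N.graph N.weight r u *
      (1 - (2 : ℝ) ^ (1 - (β : ℤ))) ^ (Fintype.card V - 1 - rank N.graph N.weight r u) ≤
    (N.depVal β k u r : ℝ) := by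
  classical
  have hε1 : (2 : ℝ) ^ (1 - (β : ℤ)) ≤ 1 := zpow_le_one_of_nonpos₀ (by norm_num) (by omega)
  have hε0 : 0 ≤ (2 : ℝ) ^ (1 - (β : ℤ)) := by positivity
  have hb := fun v => N.real_bounds (r := r) hβ hk v
  set q : ℝ := 1 - (2 : ℝ) ^ (1 - (β : ℤ)) with hq
  have hq0 : 0 ≤ q := by linarith
  have hq1 : q ≤ 1 := by linarith
  induction hi : Fintype.card V - 1 - rank N.graph N.weight r u using Nat.strong_induction_on
    generalizing u with
  | _ i ih =>
  rw [N.depVal_eq_sum_real hr hk, relDep_eq_sum N.connected N.weight_pos hr, mul_assoc,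
    Finset.sum_mul]
  apply mul_le_mul_of_nonneg_left _ (zero_le_one.trans (hb u).1)
  apply Finset.sum_le_sum
  intro v hv
  have hpar := (Finset.mem_filter.1 hv).2
  have hlt := rank_child_lt hpar
  have hvr : v ≠ r := by
    rintro rfl
    have := hpar.wdist_lt N.weight_pos
    rw [wdist_self] at this
    omega
  have ihv := ih _ (by omega) v hvr rfl
  obtain ⟨b1, b2, b3, b4, b5, b6, b7, b8, b9, b10, b11⟩ := hb v
  have hσ := sigma_pos_real (N := N) r v
  have hα := relDep_nonneg (N := N) r v
  have hpow1 : q ^ i ≤ 1 := pow_le_one₀ hq0 hq1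
  have hpow2 : q ^ i ≤ q ^ (Fintype.card V - 1 - rank N.graph N.weight r v) * q := by
    rw [← pow_succ]
    exact pow_le_pow_of_le_one hq0 hq1 (by omega)
  have hρ : (0 : ℝ) < ((Flt.round β (N.tspVal β k (.node v) r)).val : ℝ) :=
    zero_lt_one.trans_le b3
  rw [le_div_iff₀ hρ, add_mul, add_mul]
  apply add_le_add
  · calc _ ≤ 1 / (sigma N.graph N.weight r v : ℝ) * 1 * (sigma N.graph N.weight r v : ℝ) := by
          apply mul_le_mul _ (b4.trans b2) hρ.le (by positivity)
          exact mul_le_mul_of_nonneg_left hpow1 (by positivity)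
      _ = 1 := by field_simp
  · calc relDep N.graph N.weight r v * q ^ i *
          ((Flt.round β (N.tspVal β k (.node v) r)).val : ℝ)
        ≤ relDep N.graph N.weight r v *
            (q ^ (Fintype.card V - 1 - rank N.graph N.weight r v) * q) *
            (N.tspVal β k (.node v) r : ℝ) := by
          apply mul_le_mul _ b4 hρ.le (by positivity)
          exact mul_le_mul_of_nonneg_left hpow2 hα
      _ = q * ((N.tspVal β k (.node v) r : ℝ) * relDep N.graph N.weight r v *
            q ^ (Fintype.card V - 1 - rank N.graph N.weight r v)) := by ring
      _ ≤ q * (N.depVal β k v r : ℝ) := mul_le_mul_of_nonneg_left ihv hq0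
      _ ≤ _ := b11

/-- The computed dependencies, up to the accumulated rounding errors. -/
theorem Network.depVal_bounds (hβ : 1 ≤ β) (hk : ∀ v, wdist N.graph N.weight r v ≤ k) (u : V) :
    (1 - (2 : ℝ) ^ (1 - (β : ℤ))) ^ (Fintype.card V - 1) * dependency N.graph N.weight r u ≤
      (N.depVal β k u r : ℝ) ∧
    (N.depVal β k u r : ℝ) * (1 - (2 : ℝ) ^ (1 - (β : ℤ))) ^ (2 * (Fintype.card V - 1)) ≤
      dependency N.graph N.weight r u := by
  by_cases hr : u = r
  · subst hr
    simp [dependency_self, N.depVal_root_eq_zero]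
  have hε1 : (2 : ℝ) ^ (1 - (β : ℤ)) ≤ 1 := zpow_le_one_of_nonpos₀ (by norm_num) (by omega)
  have hε0 : 0 ≤ (2 : ℝ) ^ (1 - (β : ℤ)) := by positivity
  obtain ⟨b1, b2, b3, b4, b5, b6, b7, b8, b9, b10, b11⟩ := N.real_bounds (r := r) hβ hk u
  have hup := N.depVal_upper hβ hk u hr
  have hlo := N.depVal_lower hβ hk u hr
  set q : ℝ := 1 - (2 : ℝ) ^ (1 - (β : ℤ)) with hq
  have hq0 : 0 ≤ q := by linarith
  have hq1 : q ≤ 1 := by linarith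
  have hσ := sigma_pos_real (N := N) r u
  have hα := relDep_nonneg (N := N) r u
  have hδ : dependency N.graph N.weight r u =
      sigma N.graph N.weight r u * relDep N.graph N.weight r u := by
    rw [relDep]
    field_simp
  have hrank := rank_lt_card (G := N.graph) (w := N.weight) r u
  constructor
  · refine le_trans ?_ hlo
    -- The levels above `u` are charged for its path count and those below for the dependencies;
    -- together there are n - 1.
    rw [hδ, show q ^ (Fintype.card V - 1) = q ^ rank N.graph N.weight r u *
      q ^ (Fintype.card V - 1 - rank N.graph N.weight r u) by rw [← pow_add]; congr 1; omega]
    calc _ = (q ^ rank N.graph N.weight r u * sigma N.graph N.weight r u) *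
          (relDep N.graph N.weight r u *
            q ^ (Fintype.card V - 1 - rank N.graph N.weight r u)) := by ring
      _ ≤ (N.tspVal β k (.node u) r : ℝ) * (relDep N.graph N.weight r u *
            q ^ (Fintype.card V - 1 - rank N.graph N.weight r u)) :=
          mul_le_mul_of_nonneg_right (b7.trans b4) (by positivity)
      _ = _ := by ring
  · rw [hδ]
    refine le_trans ?_ (hup.trans (mul_le_mul_of_nonneg_right b2 hα))
    apply mul_le_mul_of_nonneg_left _ b8
    exact pow_le_pow_of_le_one hq0 hq1 (by omega)

/-- The mantissa length gives 2^β ≥ n^(3+c). The total loss 2(n-1) · 2^(1-β) is then at most half of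
n^(-c) by 8(n-1) ≤ n^3, which is an equality for n = 2. -/
theorem eps_bound {n : ℕ} (hn : 2 ≤ n) {c : ℝ} (hβ : β = ⌈(3 + c) * Real.logb 2 n⌉₊) :
    2 * ((n : ℝ) - 1) * (2 : ℝ) ^ (1 - (β : ℤ)) ≤ 1 / (n : ℝ) ^ c / 2 := by
  have hn0 : (0 : ℝ) < n := by positivity
  have hn2 : (2 : ℝ) ≤ n := by exact_mod_cast hn
  have h1 : (n : ℝ) ^ (3 + c) ≤ (2 : ℝ) ^ β := by
    have h2 : (n : ℝ) ^ (3 + c) = (2 : ℝ) ^ ((3 + c) * Real.logb 2 n) := by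
      rw [mul_comm, Real.rpow_mul (by norm_num), Real.rpow_logb (by norm_num) (by norm_num) hn0]
    rw [h2, ← Real.rpow_natCast]
    apply Real.rpow_le_rpow_of_exponent_le (by norm_num)
    rw [hβ]
    exact Nat.le_ceil _
  have hpc : 0 < (n : ℝ) ^ c := Real.rpow_pos_of_pos hn0 c
  rw [Real.rpow_add hn0, show (n : ℝ) ^ (3 : ℝ) = (n : ℝ) ^ 3 by
    rw [← Real.rpow_natCast]; norm_num] at h1
  have h2 : (2 : ℝ) ^ (1 - (β : ℤ)) = 2 / (2 : ℝ) ^ β := by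
    rw [zpow_sub₀ (by norm_num)]
    simp
  rw [h2, mul_div_assoc', div_div, div_le_div_iff₀ (by positivity) (by positivity)]
  have h3 : 8 * ((n : ℝ) - 1) ≤ (n : ℝ) ^ 3 := by nlinarith [sq_nonneg ((n : ℝ) - 2)]
  calc 2 * ((n : ℝ) - 1) * 2 * ((n : ℝ) ^ c * 2) = 8 * ((n : ℝ) - 1) * (n : ℝ) ^ c := by ring
    _ ≤ (n : ℝ) ^ 3 * (n : ℝ) ^ c := mul_le_mul_of_nonneg_right h3 hpc.le
    _ ≤ 1 * (2 : ℝ) ^ β := by rw [one_mul]; exact h1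

theorem one_le_prec {n : ℕ} (hn : 2 ≤ n) {c : ℝ} (hc : 0 ≤ c) :
    1 ≤ ⌈(3 + c) * Real.logb 2 n⌉₊ := by
  rw [Nat.one_le_ceil_iff]
  have hn1 : (1 : ℝ) < n := by exact_mod_cast (show 1 < n by omega)
  have := Real.logb_pos (b := 2) (by norm_num) hn1
  positivity

/-- The dependencies that `DLGagr` computes are accurate. -/
theorem Network.depVal_accurate [Nontrivial V] {c : ℝ} (hc : 0 ≤ c)
    (hβ : β = ⌈(3 + c) * Real.logb 2 (Fintype.card V)⌉₊)
    (hk : ∀ v, wdist N.graph N.weight r v ≤ k) (u : V) :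
    (1 - 1 / (Fintype.card V : ℝ) ^ c) * dependency N.graph N.weight r u ≤
      (N.depVal β k u r : ℝ) ∧
    (N.depVal β k u r : ℝ) ≤
      (1 + 1 / (Fintype.card V : ℝ) ^ c) * dependency N.graph N.weight r u := by
  have hn : 2 ≤ Fintype.card V := Fintype.one_lt_card
  have hβ1 : 1 ≤ β := hβ ▸ one_le_prec hn hc
  obtain ⟨h1, h2⟩ := N.depVal_bounds (r := r) hβ1 hk u
  have heps := eps_bound hn hβ
  have hδ := dependency_nonneg (G := N.graph) (w := N.weight) r u
  have hd : (0 : ℝ) ≤ (N.depVal β k u r : ℝ) := by exact_mod_cast N.depVal_nonneg hβ1 hk u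
  have hn2 : (2 : ℝ) ≤ Fintype.card V := by exact_mod_cast hn
  have hy0 : 0 < 1 / (Fintype.card V : ℝ) ^ c := by positivity
  have hy1 : 1 / (Fintype.card V : ℝ) ^ c ≤ 1 := by
    rw [div_le_one (by positivity)]
    exact Real.one_le_rpow (by linarith) hc
  set y : ℝ := 1 / (Fintype.card V : ℝ) ^ c
  have hε1 : (2 : ℝ) ^ (1 - (β : ℤ)) ≤ 1 := zpow_le_one_of_nonpos₀ (by norm_num) (by omega)
  have hε0 : 0 < (2 : ℝ) ^ (1 - (β : ℤ)) := by positivity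
  set ε : ℝ := (2 : ℝ) ^ (1 - (β : ℤ))
  have hcast : ((Fintype.card V - 1 : ℕ) : ℝ) = (Fintype.card V : ℝ) - 1 := by
    push_cast [Nat.cast_sub (show 1 ≤ Fintype.card V by omega)]
    ring
  have hbern : ∀ m : ℕ, 1 - (m : ℝ) * ε ≤ (1 - ε) ^ m := fun m => by
    have := one_add_mul_le_pow (a := -ε) (by linarith) m
    rw [← sub_eq_add_neg] at this
    linarith
  have hb1 := hbern (Fintype.card V - 1)
  have hb2 := hbern (2 * (Fintype.card V - 1))
  rw [hcast] at hb1
  push_cast at hb2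
  rw [hcast] at hb2
  constructor
  · refine le_trans (mul_le_mul_of_nonneg_right ?_ hδ) h1
    have : 0 ≤ ((Fintype.card V : ℝ) - 1) * ε := mul_nonneg (by linarith) hε0.le
    linarith
  · have h3 : (N.depVal β k u r : ℝ) * (1 - y / 2) ≤ dependency N.graph N.weight r u :=
      le_trans (mul_le_mul_of_nonneg_left (by linarith) hd) h2
    -- The product is 1 + y(1 - y)/2, and y ≤ 1. This is why half the tolerance is demanded of the
    -- loss.
    have h4 : 1 ≤ (1 - y / 2) * (1 + y) := by nlinarith
    calc (N.depVal β k u r : ℝ) ≤ (N.depVal β k u r : ℝ) * ((1 - y / 2) * (1 + y)) :=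
          le_mul_of_one_le_right hd h4
      _ = (1 + y) * ((N.depVal β k u r : ℝ) * (1 - y / 2)) := by ring
      _ ≤ _ := mul_le_mul_of_nonneg_left h3 (by linarith)

end Accuracy

end BCSetup

/-! ### The phases on the tree: broadcast and summation. -/

namespace BCSetup

section Program

variable {V : Type*} [Fintype V] [LinearOrder V] (N : Network V)

open Classical in
/-- The messages that node `u` receives when the global state is `Q`. -/
noncomputable def Network.inbox (x : V → View V) (Q : V → State V) (u v : V) : Option (Msg V) :=
  if N.graph.Adj v u then send (x v) (Q v) u else none

/-- The global state after one slot. -/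
noncomputable def Network.next (x : V → View V) (Q : V → State V) (u : V) : State V :=
  step (x u) (Q u) (N.inbox x Q u)

variable {N}

theorem Network.during_succ (x : V → View V) (q : V → State V) (t : ℕ) :
    N.during x q (t + 1) = N.next x (N.during x q t) := by
  rw [Network.during, Function.iterate_succ_apply']
  rfl

/-- What holds at all nodes in the slot `c` of round `i`. -/
structure Common (i c : ℕ) (old : V → Bool) (Q : V → State V) : Prop where
  clock : ∀ u, (Q u).clock = c
  done : ∀ u, (Q u).done = false
  round : ∀ u, (Q u).round = i
  isSampled : ∀ u, (Q u).isSampled = old u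

variable {β : ℕ} {thr : ℚ} {nhat : ℕ} {coin : ℕ → V → Bool}

theorem Network.view_diam_pos [Nontrivial V] (N : Network V) :
    0 < wecc N.graph N.weight N.node1 := by
  obtain ⟨v, hv⟩ := exists_ne N.node1
  have h1 : wdist N.graph N.weight N.node1 v ≤ wecc N.graph N.weight N.node1 :=
    Finset.le_sup (f := fun v => wdist N.graph N.weight N.node1 v) (Finset.mem_univ v)
  have h2 := mt (wdist_eq_zero_iff N.connected N.weight_pos).1 hv.symm
  omega

/-- With positive integer weights the tree has depth at most D/2, so D slots suffice for a broadcast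
or a summation. -/
theorem Network.dist_le_wecc (N : Network V) (u : V) :
    N.graph.dist N.node1 u ≤ wecc N.graph N.weight N.node1 :=
  (dist_le_wdist N.connected N.weight_pos _ _).trans
    (Finset.le_sup (f := fun v => wdist N.graph N.weight N.node1 v) (Finset.mem_univ u))

/-- The detour via node 1. Hence the distance bound of `DLGcomp` discards no message that a node
needs. -/
theorem Network.wdist_le_diam (N : Network V) (r u : V) :
    wdist N.graph N.weight r u ≤ 2 * wecc N.graph N.weight N.node1 := by
  have h0 : ∀ v, wdist N.graph N.weight N.node1 v ≤ wecc N.graph N.weight N.node1 := fun v =>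
    Finset.le_sup (f := fun v => wdist N.graph N.weight N.node1 v) (Finset.mem_univ v)
  have h1 := wdist_triangle (w := N.weight) N.connected r N.node1 u
  have h2 := wdist_comm (w := N.weight) N.connected r N.node1
  have := h0 r
  have := h0 u
  omega

theorem Network.mem_treeChildren {u v : V} :
    v ∈ (N.view β thr nhat coin u).treeChildren ↔ v ≠ N.node1 ∧ N.treeParent v = u := by
  simp [Network.view]

theorem Network.isNode1_iff {u : V} :
    (N.view β thr nhat coin u).isNode1 = true ↔ u = N.node1 := by
  simp [Network.view]

theorem Network.inbox_treeParent {u : V} (hu : u ≠ N.node1) (x : V → View V) (Q : V → State V) :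
    N.inbox x Q u (N.treeParent u) = send (x (N.treeParent u)) (Q (N.treeParent u)) u :=
  if_pos (N.treeParent_adj u hu).symm

theorem Network.inbox_treeChild {u v : V} (hv : v ≠ N.node1) (hp : N.treeParent v = u)
    (x : V → View V) (Q : V → State V) : N.inbox x Q u v = send (x v) (Q v) u :=
  if_pos (hp ▸ N.treeParent_adj v hv)

/-- A node with partial sum zero stays silent, and silence is counted as zero. -/
theorem Network.stepCount_acc {u : V} {Q : V → State V}
    (hsend : ∀ v, v ≠ N.node1 → send (N.view β thr nhat coin v) (Q v) (N.treeParent v) =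
      if 0 < (Q v).acc then some (.count (Q v).acc) else none) :
    ((Q u).stepCount (N.view β thr nhat coin u) (N.inbox (N.view β thr nhat coin) Q u)).acc =
      (if u = N.node1 then (Q u).acc else 0) +
        ∑ v ∈ (N.view β thr nhat coin u).treeChildren, (Q v).acc := by
  simp only [State.stepCount, N.isNode1_iff]
  congr 1
  apply Finset.sum_congr rfl
  intro v hv
  obtain ⟨h1, h2⟩ := N.mem_treeChildren.1 hv
  have h3 := hsend v h1
  rw [h2] at h3
  rw [N.inbox_treeChild h1 h2, h3]
  split_ifs with h4
  · rfl
  · simp only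
    omega

/-- Every node other than node 1 is a child of exactly one node, so moving all partial sums up one
level preserves the total. -/
theorem Network.sum_stepCount (f : V → ℕ) :
    ∑ u, ((if u = N.node1 then f u else 0) +
      ∑ v ∈ (N.view β thr nhat coin u).treeChildren, f v) = ∑ u, f u := by
  classical
  rw [Finset.sum_add_distrib]
  have h1 : ∑ u, ∑ v ∈ (N.view β thr nhat coin u).treeChildren, f v =
      ∑ v ∈ Finset.univ.filter (fun v => v ≠ N.node1), f v := by
    rw [← Finset.sum_fiberwise (Finset.univ.filter (fun v => v ≠ N.node1)) N.treeParent]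
    apply Finset.sum_congr rfl
    intro u _
    apply Finset.sum_congr _ fun _ _ => rfl
    ext v
    simp [Network.view]
  have h2 : ∑ u, (if u = N.node1 then f u else 0) =
      ∑ v ∈ Finset.univ.filter (fun v => ¬ v ≠ N.node1), f v := by
    rw [← Finset.sum_filter]
    simp
  rw [h1, h2, add_comm]
  exact Finset.sum_filter_add_sum_filter_not _ _ _

/-- The variables while `p_s` is broadcast. -/
structure ProbPhase (N : Network V) (S : Finset V) (T D t : ℕ) (Q : V → State V) : Prop where
  total : ∀ u, (Q u).total = none
  prob : ∀ u, (Q u).prob = none ∨ (Q u).prob = some T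
  reached : ∀ u, N.graph.dist N.node1 u ≤ t → (Q u).prob = some T
  getsSampled : ∀ u, t = D → (Q u).getsSampled = decide (u ∈ S)
  acc : ∀ u, t = D → (Q u).acc = if u ∈ S then 1 else 0

theorem ProbPhase.send_eq {D t i : ℕ} {Q : V → State V} {old : V → Bool}
    (hD : D = 2 * wecc N.graph N.weight N.node1) (ht : t < D) (hc : Common i t old Q) (u v : V) :
    send (N.view β thr nhat coin u) (Q u) v =
      if v ∈ (N.view β thr nhat coin u).treeChildren then (Q u).prob.map Msg.prob else none := by
  have h1 : (Q u).clock < (N.view β thr nhat coin u).diam := by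
    rw [hc.clock]
    simpa [Network.view, ← hD] using ht
  rw [send, if_neg (by simp [hc.done]), if_pos h1]

theorem ProbPhase.next {S : Finset V} {T D t i : ℕ} {Q : V → State V} {old : V → Bool}
    (hD : D = 2 * wecc N.graph N.weight N.node1)
    (hS : ∀ u, u ∈ S ↔ coin i u = true ∧ old u = false)
    (ht : t < D) (hc : Common i t old Q) (h : ProbPhase N S T D t Q) :
    Common i (t + 1) old (N.next (N.view β thr nhat coin) Q) ∧
      ProbPhase N S T D (t + 1) (N.next (N.view β thr nhat coin) Q) := by
  have h1 : ∀ u, (Q u).clock < (N.view β thr nhat coin u).diam := fun u => by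
    rw [hc.clock]
    simpa [Network.view, ← hD] using ht
  have hstep : ∀ u, N.next (N.view β thr nhat coin) Q u =
      { (Q u).stepProb (N.view β thr nhat coin u) (N.inbox (N.view β thr nhat coin) Q u) with
        clock := t + 1 } := fun u => by
    simp only [Network.next, step, hc.done u, h1 u, if_true, Bool.false_eq_true, if_false]
    rw [hc.clock u]
  have hdiam : ∀ u, (N.view β thr nhat coin u).diam = D := fun u => hD.symm
  have hpar : ∀ u, u ≠ N.node1 →
      N.inbox (N.view β thr nhat coin) Q u (N.view β thr nhat coin u).treeParent =
        (Q (N.treeParent u)).prob.map Msg.prob := fun u hu => by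
    have : (N.view β thr nhat coin u).treeParent = N.treeParent u := rfl
    rw [this, N.inbox_treeParent hu, ProbPhase.send_eq hD ht hc, if_pos]
    exact N.mem_treeChildren.2 ⟨hu, rfl⟩
  have hprob : ∀ u, ((N.next (N.view β thr nhat coin) Q u).prob = none ∨
      (N.next (N.view β thr nhat coin) Q u).prob = some T) ∧
      (N.graph.dist N.node1 u ≤ t + 1 → (N.next (N.view β thr nhat coin) Q u).prob = some T) := by
    intro u
    have hp : (N.next (N.view β thr nhat coin) Q u).prob =
        if (N.view β thr nhat coin u).isNode1 then (Q u).prob else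
        match N.inbox (N.view β thr nhat coin) Q u (N.view β thr nhat coin u).treeParent with
        | some (.prob t) => some t
        | _ => (Q u).prob := by
      rw [hstep u]
      simp only [State.stepProb]
      split_ifs <;> rfl
    rw [hp]
    by_cases hu : u = N.node1
    · rw [if_pos (N.isNode1_iff.2 hu)]
      exact ⟨h.prob u, fun _ => h.reached u (by simp [hu])⟩
    · rw [if_neg (fun h => hu (N.isNode1_iff.1 h)), hpar u hu]
      have hd := N.treeParent_dist u hu
      rcases h.prob (N.treeParent u) with h2 | h2
      · rw [h2]
        refine ⟨h.prob u, fun h3 => ?_⟩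
        rw [h.reached (N.treeParent u) (by omega)] at h2
        cases h2
      · rw [h2]
        exact ⟨Or.inr rfl, fun _ => rfl⟩
  have hother : ∀ u, (N.next (N.view β thr nhat coin) Q u).clock = t + 1 ∧
      (N.next (N.view β thr nhat coin) Q u).done = false ∧
      (N.next (N.view β thr nhat coin) Q u).round = i ∧
      (N.next (N.view β thr nhat coin) Q u).isSampled = old u ∧
      (N.next (N.view β thr nhat coin) Q u).total = none := by
    intro u
    rw [hstep u]
    simp only [State.stepProb]
    split_ifs <;> exact ⟨trivial, hc.done u, hc.round u, hc.isSampled u, h.total u⟩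
  have hlast : t + 1 = D → ∀ u,
      (N.next (N.view β thr nhat coin) Q u).getsSampled = decide (u ∈ S) ∧
      (N.next (N.view β thr nhat coin) Q u).acc = if u ∈ S then 1 else 0 := by
    intro htD u
    -- The sampling rule also asks whether the broadcast has arrived; by the last slot of the phase
    -- it has arrived everywhere.
    have hpr := (hprob u).2 (by have := N.dist_le_wecc u; omega)
    have hb : ((N.view β thr nhat coin u).coin (Q u).round && !(Q u).isSampled) =
        decide (u ∈ S) := by
      have : (N.view β thr nhat coin u).coin (Q u).round = coin i u := by rw [hc.round]; rfl
      rw [this, hc.isSampled, Bool.eq_iff_iff]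
      simp [hS]
    rw [hstep u] at hpr ⊢
    simp only [State.stepProb] at hpr ⊢
    rw [if_pos (by rw [hc.clock, hdiam, htD])] at hpr ⊢
    simp only at hpr ⊢
    rw [hpr, hb]
    simp
  exact ⟨⟨fun u => (hother u).1, fun u => (hother u).2.1, fun u => (hother u).2.2.1,
    fun u => (hother u).2.2.2.1⟩, ⟨fun u => (hother u).2.2.2.2, fun u => (hprob u).1,
    fun u => (hprob u).2, fun u ht => (hlast ht u).1, fun u ht => (hlast ht u).2⟩⟩

/-- The variables while the number of samples is summed up. -/
structure CountPhase (N : Network V) (S : Finset V) (D t : ℕ) (Q : V → State V) : Prop where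
  total : ∀ u, (Q u).total = none
  getsSampled : ∀ u, (Q u).getsSampled = decide (u ∈ S)
  sum : ∑ u, (Q u).acc = S.card
  moved : ∀ u, 0 < (Q u).acc → u = N.node1 ∨ N.graph.dist N.node1 u + t ≤ D

theorem ProbPhase.countPhase {S : Finset V} {T D : ℕ} {Q : V → State V}
    (hD : D = 2 * wecc N.graph N.weight N.node1) (h : ProbPhase N S T D D Q) :
    CountPhase N S D 0 Q where
  total := h.total
  getsSampled u := h.getsSampled u rfl
  sum := by
    rw [Finset.sum_congr rfl fun u _ => h.acc u rfl]
    simp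
  moved u _ := Or.inr (by have := N.dist_le_wecc u; omega)

theorem CountPhase.send_eq {D t i : ℕ} {Q : V → State V} {old : V → Bool}
    (hD : D = 2 * wecc N.graph N.weight N.node1) (ht : t < 2 * D) (hc : Common i (D + t) old Q)
    (u v : V) : send (N.view β thr nhat coin u) (Q u) v =
      if u ≠ N.node1 ∧ v = N.treeParent u ∧ 0 < (Q u).acc then some (.count (Q u).acc)
      else none := by
  have hdiam : (N.view β thr nhat coin u).diam = D := hD.symm
  have hpar : (N.view β thr nhat coin u).treeParent = N.treeParent u := rfl
  rw [send, if_neg (by simp [hc.done]), if_neg (by rw [hc.clock, hdiam]; omega),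
    if_pos (by rw [hc.clock, hdiam]; omega)]
  simp only [N.isNode1_iff, hpar, ne_eq]

/-- What arrives away from node 1 comes from one level deeper, so the occupied levels shrink by one
in each slot. -/
theorem moved_stepCount {D t : ℕ} {Q : V → State V} {u : V}
    (hm : ∀ u, 0 < (Q u).acc → u = N.node1 ∨ N.graph.dist N.node1 u + t ≤ D)
    (hpos : 0 < (if u = N.node1 then (Q u).acc else 0) +
        ∑ v ∈ (N.view β thr nhat coin u).treeChildren, (Q v).acc) :
    u = N.node1 ∨ N.graph.dist N.node1 u + (t + 1) ≤ D := by
  by_cases hu : u = N.node1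
  · exact Or.inl hu
  · right
    rw [if_neg hu, zero_add] at hpos
    obtain ⟨v, hv, hv0⟩ := Finset.exists_ne_zero_of_sum_ne_zero hpos.ne'
    obtain ⟨h1, rfl⟩ := N.mem_treeChildren.1 hv
    have hd := N.treeParent_dist v h1
    rcases hm v (Nat.pos_of_ne_zero hv0) with h2 | h2
    · exact absurd h2 h1
    · omega

theorem CountPhase.next {S : Finset V} {D t i : ℕ} {Q : V → State V} {old : V → Bool}
    (hD : D = 2 * wecc N.graph N.weight N.node1)
    (ht : t < 2 * D) (hc : Common i (D + t) old Q) (h : CountPhase N S D t Q) :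
    Common i (D + (t + 1)) old (N.next (N.view β thr nhat coin) Q) ∧
      CountPhase N S D (t + 1) (N.next (N.view β thr nhat coin) Q) := by
  have hdiam : ∀ u, (N.view β thr nhat coin u).diam = D := fun u => hD.symm
  have hstep : ∀ u, N.next (N.view β thr nhat coin) Q u =
      { (Q u).stepCount (N.view β thr nhat coin u) (N.inbox (N.view β thr nhat coin) Q u) with
        clock := D + (t + 1) } := fun u => by
    have h1 : ¬ D + t < D := by omega
    have h2 : D + t < 3 * D := by omega
    simp only [Network.next, step, hc.done u, hc.clock u, hdiam u, h1, h2, if_true,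
      Bool.false_eq_true, if_false]
    rfl
  have hacc : ∀ u, (N.next (N.view β thr nhat coin) Q u).acc =
      (if u = N.node1 then (Q u).acc else 0) +
        ∑ v ∈ (N.view β thr nhat coin u).treeChildren, (Q v).acc := fun u => by
    rw [hstep u]
    apply N.stepCount_acc
    intro v hv
    rw [CountPhase.send_eq hD ht hc]
    simp [hv]
  refine ⟨⟨fun u => ?_, fun u => ?_, fun u => ?_, fun u => ?_⟩, ⟨fun u => ?_, fun u => ?_, ?_,
    fun u hu => ?_⟩⟩
  · rw [hstep]
  · rw [hstep]; exact hc.done u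
  · rw [hstep]; exact hc.round u
  · rw [hstep]; exact hc.isSampled u
  · rw [hstep]; exact h.total u
  · rw [hstep]; exact h.getsSampled u
  · rw [Finset.sum_congr rfl fun u _ => hacc u, N.sum_stepCount fun u => (Q u).acc, h.sum]
  · rw [hacc u] at hu
    exact moved_stepCount h.moved hu

/-- The variables while the number of samples is broadcast. -/
structure TotalPhase (N : Network V) (S : Finset V) (D t : ℕ) (Q : V → State V) : Prop where
  total : ∀ u, (Q u).total = none ∨ (Q u).total = some S.card
  reached : ∀ u, N.graph.dist N.node1 u < t → (Q u).total = some S.card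
  getsSampled : ∀ u, (Q u).getsSampled = decide (u ∈ S)
  acc : (Q N.node1).acc = S.card
  self : t = D → ∀ u, (Q u).self = if u ∈ S then Proc.source u (N.ports (.node u)) else Proc.idle
  relay : t = D → ∀ u v j, (Q u).relay v j = Proc.idle

theorem CountPhase.totalPhase {S : Finset V} {D : ℕ} {Q : V → State V}
    (hD : D = 2 * wecc N.graph N.weight N.node1) (hpos : 0 < wecc N.graph N.weight N.node1)
    (h : CountPhase N S D (2 * D) Q) : TotalPhase N S D 0 Q where
  total u := Or.inl (h.total u)
  reached u hu := absurd hu (Nat.not_lt_zero _)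
  getsSampled := h.getsSampled
  acc := by
    -- After 2D slots no level but that of node 1 can hold anything, since D is positive; the whole
    -- sum sits there.
    rw [← h.sum, Finset.sum_eq_single N.node1]
    · intro u _ hu
      by_contra h0
      rcases h.moved u (Nat.pos_of_ne_zero h0) with h1 | h1
      · exact hu h1
      · omega
    · simp
  self h0 := by omega
  relay h0 := by omega

theorem TotalPhase.send_eq {D t i : ℕ} {Q : V → State V} {old : V → Bool}
    (hD : D = 2 * wecc N.graph N.weight N.node1) (ht : t < D) (hc : Common i (3 * D + t) old Q)
    (u v : V) : send (N.view β thr nhat coin u) (Q u) v =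
      if v ∈ (N.view β thr nhat coin u).treeChildren then (Q u).total.map Msg.total else none := by
  have hdiam : (N.view β thr nhat coin u).diam = D := hD.symm
  rw [send, if_neg (by simp [hc.done]), if_neg (by rw [hc.clock, hdiam]; omega),
    if_neg (by rw [hc.clock, hdiam]; omega), if_pos (by rw [hc.clock, hdiam]; omega)]

theorem TotalPhase.next {S : Finset V} {D t i : ℕ} {Q : V → State V} {old : V → Bool}
    (hD : D = 2 * wecc N.graph N.weight N.node1)
    (ht : t < D) (hc : Common i (3 * D + t) old Q) (h : TotalPhase N S D t Q) :
    Common i (3 * D + (t + 1)) old (N.next (N.view β thr nhat coin) Q) ∧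
      TotalPhase N S D (t + 1) (N.next (N.view β thr nhat coin) Q) := by
  have hdiam : ∀ u, (N.view β thr nhat coin u).diam = D := fun u => hD.symm
  have hstep : ∀ u, N.next (N.view β thr nhat coin) Q u =
      { (Q u).stepTotal (N.view β thr nhat coin u) (N.inbox (N.view β thr nhat coin) Q u) with
        clock := 3 * D + (t + 1) } := fun u => by
    have h1 : ¬ 3 * D + t < D := by omega
    have h2 : ¬ 3 * D + t < 3 * D := by omega
    have h3 : 3 * D + t < 4 * D := by omega
    simp only [Network.next, step, hc.done u, hc.clock u, hdiam u, h1, h2, h3, if_true,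
      Bool.false_eq_true, if_false]
    rfl
  have hpar : ∀ u, u ≠ N.node1 →
      N.inbox (N.view β thr nhat coin) Q u (N.view β thr nhat coin u).treeParent =
        (Q (N.treeParent u)).total.map Msg.total := fun u hu => by
    have : (N.view β thr nhat coin u).treeParent = N.treeParent u := rfl
    rw [this, N.inbox_treeParent hu, TotalPhase.send_eq hD ht hc, if_pos]
    exact N.mem_treeChildren.2 ⟨hu, rfl⟩
  have htot : ∀ u, ((N.next (N.view β thr nhat coin) Q u).total = none ∨
      (N.next (N.view β thr nhat coin) Q u).total = some S.card) ∧
      (N.graph.dist N.node1 u < t + 1 →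
        (N.next (N.view β thr nhat coin) Q u).total = some S.card) := by
    intro u
    have hp : (N.next (N.view β thr nhat coin) Q u).total =
        if (N.view β thr nhat coin u).isNode1 then some (Q u).acc else
        match N.inbox (N.view β thr nhat coin) Q u (N.view β thr nhat coin u).treeParent with
        | some (.total m) => some m
        | _ => (Q u).total := by
      rw [hstep u]
      simp only [State.stepTotal]
      split_ifs <;> rfl
    rw [hp]
    by_cases hu : u = N.node1
    · rw [if_pos (N.isNode1_iff.2 hu), hu, h.acc]
      exact ⟨Or.inr rfl, fun _ => rfl⟩
    · rw [if_neg (fun h => hu (N.isNode1_iff.1 h)), hpar u hu]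
      have hd := N.treeParent_dist u hu
      rcases h.total (N.treeParent u) with h2 | h2
      · rw [h2]
        refine ⟨h.total u, fun h3 => ?_⟩
        rw [h.reached (N.treeParent u) (by omega)] at h2
        cases h2
      · rw [h2]
        exact ⟨Or.inr rfl, fun _ => rfl⟩
  have hother : ∀ u, (N.next (N.view β thr nhat coin) Q u).clock = 3 * D + (t + 1) ∧
      (N.next (N.view β thr nhat coin) Q u).done = false ∧
      (N.next (N.view β thr nhat coin) Q u).round = i ∧
      (N.next (N.view β thr nhat coin) Q u).isSampled = old u ∧
      (N.next (N.view β thr nhat coin) Q u).getsSampled = decide (u ∈ S) ∧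
      (N.next (N.view β thr nhat coin) Q u).acc = (Q u).acc := by
    intro u
    rw [hstep u]
    simp only [State.stepTotal]
    split_ifs <;> exact ⟨trivial, hc.done u, hc.round u, hc.isSampled u, h.getsSampled u, rfl⟩
  have hlast : t + 1 = D → ∀ u, (N.next (N.view β thr nhat coin) Q u).self =
        (if u ∈ S then Proc.source u (N.ports (.node u)) else Proc.idle) ∧
      (N.next (N.view β thr nhat coin) Q u).relay = fun _ _ => Proc.idle := by
    intro htD u
    rw [hstep u]
    simp only [State.stepTotal]
    rw [if_pos (by rw [hc.clock, hdiam]; omega)]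
    simp only [h.getsSampled u, decide_eq_true_eq, and_true]
    rfl
  exact ⟨⟨fun u => (hother u).1, fun u => (hother u).2.1, fun u => (hother u).2.2.1,
    fun u => (hother u).2.2.2.1⟩, ⟨fun u => (htot u).1, fun u => (htot u).2,
    fun u => (hother u).2.2.2.2.1, (hother _).2.2.2.2.2.trans h.acc,
    fun ht u => (hlast ht u).1, fun ht u v j => by rw [(hlast ht u).2]⟩⟩

end Program

end BCSetup

/-! ### The nodes simulate the processors, and the last two phases. -/

namespace BCSetup

section Subroutines

variable {V : Type*} [Fintype V] [LinearOrder V] {N : Network V}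
variable {β : ℕ} {thr : ℚ} {nhat : ℕ} {coin : ℕ → V → Bool}

/-- The processors of the network send the messages `F`. -/
structure Hosts (N : Network V) (x : V → View V) (Q : V → State V)
    (F : Site V → V → Option (Msg V)) : Prop where
  node : ∀ u p, (Q u).emit (x u) false (Q u).self p = F (.node u) p
  relay : ∀ u v j, N.Valid (.relay u v j) → ∀ p,
    (Q u).emit (x u) true ((Q u).relay v j) p = F (.relay u v j) p
  send : ∀ u v, send (x u) (Q u) v = (Q u).emitEdge (x u) v

theorem Network.view_relays {u v : V} (h : N.graph.Adj u v) :
    (N.view β thr nhat coin u).relays v = if u < v then N.weight s(u, v) - 1 else 0 := by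
  have h1 : (N.view β thr nhat coin u).id = u := rfl
  have h2 : (N.view β thr nhat coin u).wt v = N.weight s(u, v) := if_pos h
  rw [View.relays, h1, h2]

variable {Q : V → State V} {F : Site V → V → Option (Msg V)}

theorem Hosts.emitEdge (hF : Hosts N (N.view β thr nhat coin) Q F) {u v : V}
    (h : N.graph.Adj u v) : (Q u).emitEdge (N.view β thr nhat coin u) v =
      if u < v ∧ 1 < N.weight s(u, v) then F (.relay u v (N.weight s(u, v) - 1)) v
      else F (.node u) v := by
  have hpos := N.weight_pos' h
  rw [State.emitEdge, N.view_relays h]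
  by_cases h1 : u < v
  · by_cases h2 : 1 < N.weight s(u, v)
    · simp only [h1, h2, if_true, and_self]
      rw [if_neg (by omega), hF.relay u v _ ⟨h1, h, by omega, by omega⟩]
    · simp only [h1, h2, if_true, and_false, if_false]
      rw [if_pos (by omega), hF.node]
  · simp only [h1, if_false, false_and, if_true]
    rw [hF.node]

theorem Hosts.inbox (hF : Hosts N (N.view β thr nhat coin) Q F) {u v : V}
    (h : N.graph.Adj v u) : N.inbox (N.view β thr nhat coin) Q u v =
      if v < u ∧ 1 < N.weight s(v, u) then F (.relay v u (N.weight s(v, u) - 1)) u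
      else F (.node v) u := by
  rw [Network.inbox, if_pos h, hF.send, hF.emitEdge h]

/-- The neighbouring site is the other node, a relay hosted by `u` itself, or the last relay hosted
by the other endpoint. The program looks up the message in the right place in each case. -/
theorem Hosts.selfInc (hF : Hosts N (N.view β thr nhat coin) Q F) {u p : V}
    (hp : p ∈ N.ports (.node u)) :
    (Q u).selfInc (N.view β thr nhat coin u) (N.inbox (N.view β thr nhat coin) Q u) p =
      F (N.nb (.node u) p) u := by
  have h := N.mem_ports_node.1 hp
  have hpos := N.weight_pos' h
  have hsw : N.weight s(p, u) = N.weight s(u, p) := by rw [Sym2.eq_swap]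
  have hid : (N.view β thr nhat coin u).id = u := rfl
  rw [State.selfInc, N.view_relays h, hF.inbox h.symm, Network.nb, hid, hsw]
  rcases lt_or_gt_of_ne h.ne with h1 | h1
  · simp only [h1, not_lt.2 h1.le, if_true, false_and, if_false]
    by_cases h2 : N.weight s(u, p) ≤ 1
    · rw [if_pos (by omega), if_pos h2]
    · rw [if_neg (by omega), if_neg h2, hF.relay u p 1 ⟨h1, h, by omega, by omega⟩]
  · simp only [h1, not_lt.2 h1.le, if_true, true_and, if_false]
    by_cases h2 : N.weight s(u, p) ≤ 1
    · rw [if_neg (by omega), if_pos h2]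
    · rw [if_pos (by omega), if_neg h2]

/-- All links of the chain are internal to the host, except that the last relay uses the network
edge itself. -/
theorem Hosts.relayInc (hF : Hosts N (N.view β thr nhat coin) Q F) {u v p : V} {j : ℕ}
    (hh : N.Valid (.relay u v j)) (hp : p ∈ N.ports (.relay u v j)) :
    (Q u).relayInc (N.view β thr nhat coin u) (N.inbox (N.view β thr nhat coin) Q u) v j p =
      F (N.nb (.relay u v j) p) ((Site.relay u v j).rev p) := by
  obtain ⟨hlt, h, h0, hj⟩ := hh
  have hid : (N.view β thr nhat coin u).id = u := rfl
  rw [State.relayInc, N.view_relays h, hF.inbox h.symm, Network.nb, hid, Site.rev]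
  simp only [hlt, not_lt.2 hlt.le, if_true, false_and, if_false]
  rcases N.mem_ports_relay.1 hp with rfl | rfl
  · simp only [if_true]
    split_ifs with h1
    · exact hF.node _ _
    · exact hF.relay _ _ _ ⟨hlt, h, by omega, by omega⟩ _
  · simp only [hlt.ne', if_false]
    by_cases h1 : j + 1 = N.weight s(u, p)
    · rw [if_pos (by omega), if_pos h1]
    · rw [if_neg (by omega), if_neg h1]
      exact hF.relay _ _ _ ⟨hlt, h, by omega, by omega⟩ _

/-- A message on an edge is a message of the site next to the other endpoint. -/
theorem Hosts.exists_site (hF : Hosts N (N.view β thr nhat coin) Q F) {u v : V}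
    (h : N.graph.Adj u v) {m : Msg V}
    (hm : m ∈ BCSetup.send (N.view β thr nhat coin u) (Q u) v) :
    ∃ y p, N.Valid y ∧ p ∈ N.ports y ∧ F y p = some m := by
  rw [hF.send, hF.emitEdge h] at hm
  split_ifs at hm with h1
  · exact ⟨.relay u v (N.weight s(u, v) - 1), v, ⟨h1.1, h, by omega, by omega⟩,
      N.mem_ports_relay.2 (Or.inr rfl), hm⟩
  · exact ⟨.node u, v, trivial, N.mem_ports_node.2 h, hm⟩

/-- The nodes simulate the processors `P`. -/
structure Simulates (N : Network V) (P : Site V → Proc V) (S : Finset V) (Q : V → State V) :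
    Prop where
  total : ∀ u, (Q u).total = some S.card
  getsSampled : ∀ u, (Q u).getsSampled = decide (u ∈ S)
  self : ∀ u, (Q u).self = P (.node u)
  relay : ∀ u v j, N.Valid (.relay u v j) → (Q u).relay v j = P (.relay u v j)

variable {S : Finset V} {D i : ℕ} {old : V → Bool}

theorem TotalPhase.simulates (h : TotalPhase N S D D Q)
    (hD : D = 2 * wecc N.graph N.weight N.node1) (hpos : 0 < wecc N.graph N.weight N.node1) :
    Simulates N (N.waveState S β D 0) S Q where
  total u := h.reached u (by have := N.dist_le_wecc u; omega)
  getsSampled := h.getsSampled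
  self u := by
    rw [h.self rfl u]
    split_ifs with hu
    · rw [N.waveState_zero_of_mem hu]
    · rw [N.waveState_zero_of_ne]
      rintro r hr ⟨⟩
      exact hu hr
  relay u v j _ := by
    rw [h.relay rfl u v j, N.waveState_zero_of_ne]
    simp

section Wave

variable {t : ℕ}

theorem Simulates.hosts_wave (h : Simulates N (N.waveState S β D t) S Q)
    (hD : D = 2 * wecc N.graph N.weight N.node1) (ht : t ≤ S.card + D)
    (hc : Common i (4 * D + t) old Q) :
    Hosts N (N.view β thr nhat coin) Q (fun y => (N.waveState S β D t y).waveOut β) := by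
  have hdiam : ∀ u, (N.view β thr nhat coin u).diam = D := fun u => hD.symm
  have hprec : ∀ u, (N.view β thr nhat coin u).prec = β := fun u => rfl
  have hlast : ∀ u, (Q u).last (N.view β thr nhat coin u) = S.card + D := fun u => by
    simp [State.last, h.total u, hdiam u]
  have hemit : ∀ u b P p, (Q u).emit (N.view β thr nhat coin u) b P p = P.waveOut β p := by
    intro u b P p
    rw [State.emit, hc.clock, hdiam, hlast, hprec, if_neg (by omega), if_pos (by omega)]
  refine ⟨fun u p => ?_, fun u v j hv p => ?_, fun u v => ?_⟩
  · rw [hemit, h.self u]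
  · rw [hemit, h.relay u v j hv]
  · rw [send, if_neg (by simp [hc.done]), hc.clock, hdiam, hlast, if_neg (by omega),
      if_neg (by omega), if_neg (by omega), if_pos (by omega)]

theorem Simulates.next_wave (h : Simulates N (N.waveState S β D t) S Q)
    (hD : D = 2 * wecc N.graph N.weight N.node1) (ht : t ≤ S.card + D)
    (hc : Common i (4 * D + t) old Q) :
    Common i (4 * D + (t + 1)) old (N.next (N.view β thr nhat coin) Q) ∧
      Simulates N (N.waveState S β D (t + 1)) S (N.next (N.view β thr nhat coin) Q) := by
  have hF := h.hosts_wave (thr := thr) (nhat := nhat) (coin := coin) hD ht hc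
  have hdiam : ∀ u, (N.view β thr nhat coin u).diam = D := fun u => hD.symm
  have hlast : ∀ u, (Q u).last (N.view β thr nhat coin u) = S.card + D := fun u => by
    simp [State.last, h.total u, hdiam u]
  have hstep : ∀ u, N.next (N.view β thr nhat coin) Q u =
      { (Q u).stepWave (N.view β thr nhat coin u) (N.inbox (N.view β thr nhat coin) Q u) with
        clock := 4 * D + (t + 1) } := fun u => by
    have h1 : ¬ 4 * D + t < D := by omega
    have h2 : ¬ 4 * D + t < 3 * D := by omega
    have h3 : ¬ 4 * D + t < 4 * D := by omega
    have h4 : 4 * D + t ≤ 4 * D + (S.card + D) := by omega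
    simp only [Network.next, step, hc.done u, hc.clock u, hdiam u, hlast u, h1, h2, h3, h4, if_true,
      Bool.false_eq_true, if_false]
    rfl
  refine ⟨⟨fun u => ?_, fun u => ?_, fun u => ?_, fun u => ?_⟩, ⟨fun u => ?_, fun u => ?_,
    fun u => ?_, fun u v j hv => ?_⟩⟩
  · rw [hstep]
  · rw [hstep]; exact hc.done u
  · rw [hstep]; exact hc.round u
  · rw [hstep]; exact hc.isSampled u
  · rw [hstep]; exact h.total u
  · rw [hstep]; exact h.getsSampled u
  · rw [hstep]
    simp only [State.stepWave]
    have hnbrs : (N.view β thr nhat coin u).nbrs = N.ports (.node u) := rfl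
    rw [hc.clock, hdiam, hnbrs, show 4 * D + t - 4 * D = t by omega, h.self u]
    exact N.waveIn_waveState (h := .node u) trivial fun p hp => hF.selfInc hp
  · rw [hstep]
    simp only [State.stepWave]
    obtain ⟨hlt, hadj, h0, hj⟩ := hv
    have hports : ({(N.view β thr nhat coin u).id, v} : Finset V) = N.ports (.relay u v j) := rfl
    have hmem : v ∈ (N.view β thr nhat coin u).nbrs := N.mem_ports_node.2 hadj
    rw [if_pos ⟨hmem, h0, by rw [N.view_relays hadj, if_pos hlt]; omega⟩, hc.clock, hdiam, hports,
      show 4 * D + t - 4 * D = t by omega, h.relay u v j ⟨hlt, hadj, h0, hj⟩]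
    exact N.waveIn_waveState ⟨hlt, hadj, h0, hj⟩ fun p hp => hF.relayInc ⟨hlt, hadj, h0, hj⟩ hp

end Wave

section Back

variable {b : ℕ}

theorem Simulates.hosts_back (h : Simulates N (N.backState S β D b) S Q)
    (hD : D = 2 * wecc N.graph N.weight N.node1) (hb : b ≤ S.card + D)
    (hc : Common i (5 * D + S.card + 1 + b) old Q) :
    Hosts N (N.view β thr nhat coin) Q
      (fun y => (N.backState S β D b y).backOut β y.isRelay (S.card + D - b)) := by
  have hdiam : ∀ u, (N.view β thr nhat coin u).diam = D := fun u => hD.symm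
  have hprec : ∀ u, (N.view β thr nhat coin u).prec = β := fun u => rfl
  have hlast : ∀ u, (Q u).last (N.view β thr nhat coin u) = S.card + D := fun u => by
    simp [State.last, h.total u, hdiam u]
  have hemit : ∀ u r P p, (Q u).emit (N.view β thr nhat coin u) r P p =
      P.backOut β r (S.card + D - b) p := by
    intro u r P p
    rw [State.emit, hc.clock, hdiam, hlast, hprec, if_neg (by omega), if_neg (by omega),
      -- The clock of the program translates to the mirrored slot |S| + D - b of `DLGcomp`.
      if_pos (by omega), show 4 * D + 2 * (S.card + D) + 1 - (5 * D + S.card + 1 + b) =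
        S.card + D - b by omega]
  refine ⟨fun u p => ?_, fun u v j hv p => ?_, fun u v => ?_⟩
  · rw [hemit, h.self u]
    rfl
  · rw [hemit, h.relay u v j hv]
    rfl
  · rw [send, if_neg (by simp [hc.done]), hc.clock, hdiam, hlast, if_neg (by omega),
      if_neg (by omega), if_neg (by omega), if_pos (by omega)]

theorem Simulates.next_back (h : Simulates N (N.backState S β D b) S Q)
    (hD : D = 2 * wecc N.graph N.weight N.node1) (hb : b ≤ S.card + D)
    (hc : Common i (5 * D + S.card + 1 + b) old Q) :
    Common i (5 * D + S.card + 1 + (b + 1))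
        (fun u => old u || (decide (b = S.card + D) && decide (u ∈ S)))
        (N.next (N.view β thr nhat coin) Q) ∧
      Simulates N (N.backState S β D (b + 1)) S (N.next (N.view β thr nhat coin) Q) ∧
      (b = S.card + D → ∀ u, (N.next (N.view β thr nhat coin) Q u).acc ≤ 1) := by
  have hF := h.hosts_back (thr := thr) (nhat := nhat) (coin := coin) hD hb hc
  have hdiam : ∀ u, (N.view β thr nhat coin u).diam = D := fun u => hD.symm
  have hlast : ∀ u, (Q u).last (N.view β thr nhat coin u) = S.card + D := fun u => by
    simp [State.last, h.total u, hdiam u]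
  have hstep : ∀ u, N.next (N.view β thr nhat coin) Q u =
      { (Q u).stepBack (N.view β thr nhat coin u) (N.inbox (N.view β thr nhat coin) Q u) with
        clock := 5 * D + S.card + 1 + (b + 1) } := fun u => by
    have h1 : ¬ 5 * D + S.card + 1 + b < D := by omega
    have h2 : ¬ 5 * D + S.card + 1 + b < 3 * D := by omega
    have h3 : ¬ 5 * D + S.card + 1 + b < 4 * D := by omega
    have h4 : ¬ 5 * D + S.card + 1 + b ≤ 4 * D + (S.card + D) := by omega
    have h5 : 5 * D + S.card + 1 + b ≤ 4 * D + 2 * (S.card + D) + 1 := by omega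
    simp only [Network.next, step, hc.done u, hc.clock u, hdiam u, hlast u, h1, h2, h3, h4, h5,
      if_true, Bool.false_eq_true, if_false]
    rfl
  have hcond : ∀ u, (Q u).clock = 4 * (N.view β thr nhat coin u).diam +
      2 * (Q u).last (N.view β thr nhat coin u) + 1 ↔ b = S.card + D := fun u => by
    rw [hc.clock, hdiam, hlast]
    omega
  have hself : ∀ u, (N.next (N.view β thr nhat coin) Q u).self =
      N.backState S β D (b + 1) (.node u) := by
    intro u
    have : (N.next (N.view β thr nhat coin) Q u).self =
        (Q u).self.backIn (N.view β thr nhat coin u).id (N.view β thr nhat coin u).nbrs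
          ((Q u).selfInc (N.view β thr nhat coin u)
            (N.inbox (N.view β thr nhat coin) Q u)) := by
      rw [hstep]
      simp only [State.stepBack]
      split_ifs <;> rfl
    rw [this, h.self u]
    exact N.backIn_backState (u := u) hb fun p hp => hF.selfInc hp
  have hrelay : ∀ u v j, N.Valid (.relay u v j) →
      (N.next (N.view β thr nhat coin) Q u).relay v j =
      N.backState S β D (b + 1) (.relay u v j) := by
    intro u v j hv
    have : (N.next (N.view β thr nhat coin) Q u).relay v j =
        if v ∈ (N.view β thr nhat coin u).nbrs ∧ 1 ≤ j ∧ j ≤ (N.view β thr nhat coin u).relays v then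
          ((Q u).relay v j).relayIn (N.view β thr nhat coin u).id v
            ((Q u).relayInc (N.view β thr nhat coin u)
              (N.inbox (N.view β thr nhat coin) Q u) v j)
        else Proc.idle := by
      rw [hstep]
      simp only [State.stepBack]
      split_ifs <;> first | rfl | (exfalso; tauto) | (simp only [State.testThreshold]; split_ifs; rfl)
    have hmem : v ∈ (N.view β thr nhat coin u).nbrs := N.mem_ports_node.2 hv.2.1
    have hj : j ≤ (N.view β thr nhat coin u).relays v := by
      rw [N.view_relays hv.2.1, if_pos hv.1]
      have := hv.2.2.2
      omega
    rw [this, if_pos ⟨hmem, hv.2.2.1, hj⟩, h.relay u v j hv]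
    exact N.relayIn_backState hv hb fun p hp => hF.relayInc hv hp
  have hother : ∀ u, (N.next (N.view β thr nhat coin) Q u).done = false ∧
      (N.next (N.view β thr nhat coin) Q u).round = i ∧
      (N.next (N.view β thr nhat coin) Q u).total = some S.card ∧
      (N.next (N.view β thr nhat coin) Q u).getsSampled = decide (u ∈ S) := by
    intro u
    rw [hstep]
    simp only [State.stepBack]
    split_ifs <;> exact ⟨hc.done u, hc.round u, h.total u, h.getsSampled u⟩
  refine ⟨⟨fun u => ?_, fun u => (hother u).1, fun u => (hother u).2.1, fun u => ?_⟩,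
    ⟨fun u => (hother u).2.2.1, fun u => (hother u).2.2.2, hself, hrelay⟩, fun hbK u => ?_⟩
  · rw [hstep]
  · rw [hstep]
    simp only [State.stepBack, hcond u]
    split_ifs with h1
    · simp [State.testThreshold, hc.isSampled u, h.getsSampled u, h1]
    · simp [hc.isSampled u, h1]
  · rw [hstep]
    simp only [State.stepBack, hcond u]
    rw [if_pos hbK]
    simp only [State.testThreshold]
    split_ifs <;> omega

end Back

/-- The variables after `DLGagr`. -/
structure Finished (N : Network V) (P : Site V → Proc V) (S : Finset V) (Q : V → State V) :
    Prop where
  total : ∀ u, (Q u).total = some S.card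
  self : ∀ u, (Q u).self = P (.node u)

theorem Simulates.finished {P : Site V → Proc V} (h : Simulates N P S Q) : Finished N P S Q :=
  ⟨h.total, h.self⟩

variable {P : Site V → Proc V} {t : ℕ}

theorem Finished.last (h : Finished N P S Q) (hD : D = 2 * wecc N.graph N.weight N.node1) (u : V) :
    (Q u).last (N.view β thr nhat coin u) = S.card + D := by
  have hdiam : (N.view β thr nhat coin u).diam = D := hD.symm
  simp [State.last, h.total u, hdiam]

theorem Finished.send_report (h : Finished N P S Q)
    (hD : D = 2 * wecc N.graph N.weight N.node1) (ht : t < D)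
    (hc : Common i (6 * D + 2 * S.card + 2 + t) old Q)
    (u v : V) : send (N.view β thr nhat coin u) (Q u) v =
      if u ≠ N.node1 ∧ v = N.treeParent u ∧ 0 < (Q u).acc then some (.count (Q u).acc)
      else none := by
  have hdiam : (N.view β thr nhat coin u).diam = D := hD.symm
  have hpar : (N.view β thr nhat coin u).treeParent = N.treeParent u := rfl
  rw [send, if_neg (by simp [hc.done]), hc.clock, hdiam, h.last hD, if_neg (by omega),
    if_neg (by omega), if_neg (by omega), if_neg (by omega), if_pos (by omega)]
  simp only [N.isNode1_iff, hpar, ne_eq]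

/-- Of the reports only the conserved total matters: it bounds every partial sum, and hence the
messages. -/
theorem Finished.next_report (h : Finished N P S Q)
    (hD : D = 2 * wecc N.graph N.weight N.node1) (ht : t < D)
    (hc : Common i (6 * D + 2 * S.card + 2 + t) old Q) :
    Common i (6 * D + 2 * S.card + 2 + (t + 1)) old (N.next (N.view β thr nhat coin) Q) ∧
      Finished N P S (N.next (N.view β thr nhat coin) Q) ∧
      ∑ u, (N.next (N.view β thr nhat coin) Q u).acc = ∑ u, (Q u).acc := by
  have hdiam : ∀ u, (N.view β thr nhat coin u).diam = D := fun u => hD.symm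
  have hlast : ∀ u, (Q u).last (N.view β thr nhat coin u) = S.card + D := fun u => h.last hD u
  have hstep : ∀ u, N.next (N.view β thr nhat coin) Q u =
      { (Q u).stepReport (N.view β thr nhat coin u) (N.inbox (N.view β thr nhat coin) Q u) with
        clock := 6 * D + 2 * S.card + 2 + (t + 1) } := fun u => by
    have h1 : ¬ 6 * D + 2 * S.card + 2 + t < D := by omega
    have h2 : ¬ 6 * D + 2 * S.card + 2 + t < 3 * D := by omega
    have h3 : ¬ 6 * D + 2 * S.card + 2 + t < 4 * D := by omega
    have h4 : ¬ 6 * D + 2 * S.card + 2 + t ≤ 4 * D + (S.card + D) := by omega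
    have h5 : ¬ 6 * D + 2 * S.card + 2 + t ≤ 4 * D + 2 * (S.card + D) + 1 := by omega
    have h6 : 6 * D + 2 * S.card + 2 + t < 5 * D + 2 * (S.card + D) + 2 := by omega
    simp only [Network.next, step, hc.done u, hc.clock u, hdiam u, hlast u, h1, h2, h3, h4, h5, h6,
      if_true, Bool.false_eq_true, if_false]
    rfl
  have hacc : ∀ u, (N.next (N.view β thr nhat coin) Q u).acc =
      (if u = N.node1 then (Q u).acc else 0) +
        ∑ v ∈ (N.view β thr nhat coin u).treeChildren, (Q v).acc := fun u => by
    rw [← N.stepCount_acc fun v hv => by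
      rw [h.send_report hD ht hc]
      simp [hv], hstep u]
    simp only [State.stepReport]
    split_ifs <;> rfl
  have hother : ∀ u, (N.next (N.view β thr nhat coin) Q u).done = false ∧
      (N.next (N.view β thr nhat coin) Q u).round = i ∧
      (N.next (N.view β thr nhat coin) Q u).isSampled = old u ∧
      (N.next (N.view β thr nhat coin) Q u).total = some S.card ∧
      (N.next (N.view β thr nhat coin) Q u).self = P (.node u) := by
    intro u
    rw [hstep]
    simp only [State.stepReport, State.stepCount]
    split_ifs <;> exact ⟨hc.done u, hc.round u, hc.isSampled u, h.total u, h.self u⟩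
  refine ⟨⟨fun u => ?_, fun u => (hother u).1, fun u => (hother u).2.1,
    fun u => (hother u).2.2.1⟩, ⟨fun u => (hother u).2.2.2.1, fun u => (hother u).2.2.2.2⟩, ?_⟩
  · rw [hstep]
  · rw [Finset.sum_congr rfl fun u _ => hacc u, N.sum_stepCount fun u => (Q u).acc]

theorem Finished.send_halt (h : Finished N P S Q)
    (hD : D = 2 * wecc N.graph N.weight N.node1)
    (hc : Common i (7 * D + 2 * S.card + 2 + t) old Q)
    (u v : V) : send (N.view β thr nhat coin u) (Q u) v =
      if v ∈ (N.view β thr nhat coin u).treeChildren ∧ (Q u).terminated then some .halt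
      else none := by
  have hdiam : (N.view β thr nhat coin u).diam = D := hD.symm
  rw [send, if_neg (by simp [hc.done]), hc.clock, hdiam, h.last hD, if_neg (by omega),
    if_neg (by omega), if_neg (by omega), if_neg (by omega), if_neg (by omega)]

theorem Finished.next_halt (h : Finished N P S Q)
    (hD : D = 2 * wecc N.graph N.weight N.node1)
    (hc : Common i (7 * D + 2 * S.card + 2 + t) old Q) :
    Finished N P S (N.next (N.view β thr nhat coin) Q) ∧ ∀ u,
      (N.next (N.view β thr nhat coin) Q u).clock = 7 * D + 2 * S.card + 2 + (t + 1) ∧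
      (N.next (N.view β thr nhat coin) Q u).isSampled = old u ∧
      (N.next (N.view β thr nhat coin) Q u).done = decide (t + 1 = D) ∧
      (N.next (N.view β thr nhat coin) Q u).round = if t + 1 = D then i + 1 else i := by
  have hdiam : ∀ u, (N.view β thr nhat coin u).diam = D := fun u => hD.symm
  have hlast : ∀ u, (Q u).last (N.view β thr nhat coin u) = S.card + D := fun u => h.last hD u
  have hstep : ∀ u, N.next (N.view β thr nhat coin) Q u =
      { (Q u).stepHalt (N.view β thr nhat coin u) (N.inbox (N.view β thr nhat coin) Q u) with
        clock := 7 * D + 2 * S.card + 2 + (t + 1) } := fun u => by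
    have h1 : ¬ 7 * D + 2 * S.card + 2 + t < D := by omega
    have h2 : ¬ 7 * D + 2 * S.card + 2 + t < 3 * D := by omega
    have h3 : ¬ 7 * D + 2 * S.card + 2 + t < 4 * D := by omega
    have h4 : ¬ 7 * D + 2 * S.card + 2 + t ≤ 4 * D + (S.card + D) := by omega
    have h5 : ¬ 7 * D + 2 * S.card + 2 + t ≤ 4 * D + 2 * (S.card + D) + 1 := by omega
    have h6 : ¬ 7 * D + 2 * S.card + 2 + t < 5 * D + 2 * (S.card + D) + 2 := by omega
    simp only [Network.next, step, hc.done u, hc.clock u, hdiam u, hlast u, h1, h2, h3, h4, h5, h6,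
      Bool.false_eq_true, if_false]
    rfl
  have hcond : ∀ u, (Q u).clock + 1 = 6 * (N.view β thr nhat coin u).diam +
      2 * (Q u).last (N.view β thr nhat coin u) + 2 ↔ t + 1 = D := fun u => by
    rw [hc.clock, hdiam, hlast]
    omega
  have key : ∀ u, (N.next (N.view β thr nhat coin) Q u).total = some S.card ∧
      (N.next (N.view β thr nhat coin) Q u).self = P (.node u) ∧
      (N.next (N.view β thr nhat coin) Q u).clock = 7 * D + 2 * S.card + 2 + (t + 1) ∧
      (N.next (N.view β thr nhat coin) Q u).isSampled = old u ∧
      (N.next (N.view β thr nhat coin) Q u).done = decide (t + 1 = D) ∧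
      (N.next (N.view β thr nhat coin) Q u).round = if t + 1 = D then i + 1 else i := by
    intro u
    rw [hstep]
    simp only [State.stepHalt, hcond u]
    by_cases h1 : t + 1 = D
    · simp only [h1, if_true, decide_true]
      split <;> exact ⟨h.total u, h.self u, trivial, hc.isSampled u, trivial, by rw [hc.round u]⟩
    · simp only [h1, if_false, decide_false]
      split <;> exact ⟨h.total u, h.self u, trivial, hc.isSampled u, hc.done u, hc.round u⟩
  exact ⟨⟨fun u => (key u).1, fun u => (key u).2.1⟩, fun u => (key u).2.2⟩

end Subroutines

end BCSetup

/-! ### A complete round, its messages, and the passage to the next round. -/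

namespace BCSetup

section Round

variable {V : Type*} [Fintype V] [LinearOrder V] {N : Network V}
variable {β : ℕ} {thr : ℚ} {nhat : ℕ} {coin : ℕ → V → Bool}
variable {S : Finset V} {D i t : ℕ} {q : V → State V}

/-- Round `i` starts in the state `q`, and `S` is its set of samples. -/
structure RoundStart (coin : ℕ → V → Bool) (S : Finset V) (i : ℕ) (q : V → State V) : Prop where
  round : ∀ u, (q u).round = i
  fresh : ∀ u, u ∈ S ↔ coin i u = true ∧ (q u).isSampled = false

theorem RoundStart.during_prob [Nontrivial V] (h : RoundStart coin S i q)
    (hD : D = 2 * wecc N.graph N.weight N.node1) (ht : t ≤ D) :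
    Common i t (fun u => (q u).isSampled) (N.during (N.view β thr nhat coin) q t) ∧
      ProbPhase N S (min (2 ^ (Nat.log 2 (2 * hopEcc N.graph N.node1) + i)) (Fintype.card V)) D t
        (N.during (N.view β thr nhat coin) q t) := by
  induction t with
  | zero =>
    have h0 : ∀ u, N.during (N.view β thr nhat coin) q 0 u =
        (q u).newRound (N.view β thr nhat coin u) := fun u => rfl
    have hprob : ∀ u, ((q u).newRound (N.view β thr nhat coin u)).prob = if u = N.node1 then
        some (min (2 ^ (Nat.log 2 (2 * hopEcc N.graph N.node1) + i)) (Fintype.card V))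
        else none := fun u => by
      rw [← h.round u]
      simp only [State.newRound, N.isNode1_iff]
      rfl
    have hpos := N.view_diam_pos
    refine ⟨⟨fun u => rfl, fun u => rfl, h.round, fun u => rfl⟩, ⟨fun u => rfl, fun u => ?_,
      fun u hu => ?_, fun u hu => by omega, fun u hu => by omega⟩⟩
    · rw [h0, hprob]
      split_ifs <;> simp
    · have hu' : N.node1 = u := N.connected.dist_eq_zero_iff.1 (Nat.le_zero.1 hu)
      rw [h0, hprob, if_pos hu'.symm]
  | succ t ih =>
    obtain ⟨h1, h2⟩ := ih (by omega)
    rw [N.during_succ]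
    exact h2.next hD h.fresh ht h1

theorem RoundStart.during_count [Nontrivial V] (h : RoundStart coin S i q)
    (hD : D = 2 * wecc N.graph N.weight N.node1) (ht : t ≤ 2 * D) :
    Common i (D + t) (fun u => (q u).isSampled) (N.during (N.view β thr nhat coin) q (D + t)) ∧
      CountPhase N S D t (N.during (N.view β thr nhat coin) q (D + t)) := by
  induction t with
  | zero =>
    obtain ⟨h1, h2⟩ := h.during_prob (β := β) (thr := thr) (nhat := nhat) hD le_rfl
    exact ⟨h1, h2.countPhase hD⟩
  | succ t ih =>
    obtain ⟨h1, h2⟩ := ih (by omega)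
    rw [← add_assoc D t 1, N.during_succ]
    exact h2.next hD ht h1

theorem RoundStart.during_total [Nontrivial V] (h : RoundStart coin S i q)
    (hD : D = 2 * wecc N.graph N.weight N.node1) (ht : t ≤ D) :
    Common i (3 * D + t) (fun u => (q u).isSampled)
        (N.during (N.view β thr nhat coin) q (3 * D + t)) ∧
      TotalPhase N S D t (N.during (N.view β thr nhat coin) q (3 * D + t)) := by
  induction t with
  | zero =>
    obtain ⟨h1, h2⟩ := h.during_count (β := β) (thr := thr) (nhat := nhat) hD le_rfl
    rw [show D + 2 * D = 3 * D + 0 by ring] at h1 h2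
    exact ⟨h1, h2.totalPhase hD N.view_diam_pos⟩
  | succ t ih =>
    obtain ⟨h1, h2⟩ := ih (by omega)
    rw [← add_assoc (3 * D) t 1, N.during_succ]
    exact h2.next hD ht h1

theorem RoundStart.during_wave [Nontrivial V] (h : RoundStart coin S i q)
    (hD : D = 2 * wecc N.graph N.weight N.node1) (ht : t ≤ S.card + D + 1) :
    Common i (4 * D + t) (fun u => (q u).isSampled)
        (N.during (N.view β thr nhat coin) q (4 * D + t)) ∧
      Simulates N (N.waveState S β D t) S (N.during (N.view β thr nhat coin) q (4 * D + t)) := by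
  induction t with
  | zero =>
    obtain ⟨h1, h2⟩ := h.during_total (β := β) (thr := thr) (nhat := nhat) hD le_rfl
    rw [show 3 * D + D = 4 * D + 0 by ring] at h1 h2
    exact ⟨h1, h2.simulates hD N.view_diam_pos⟩
  | succ t ih =>
    obtain ⟨h1, h2⟩ := ih (by omega)
    rw [← add_assoc (4 * D) t 1, N.during_succ]
    exact h2.next_wave hD (by omega) h1

theorem RoundStart.during_back [Nontrivial V] (h : RoundStart coin S i q)
    (hD : D = 2 * wecc N.graph N.weight N.node1) (ht : t ≤ S.card + D) :
    Common i (5 * D + S.card + 1 + t) (fun u => (q u).isSampled)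
        (N.during (N.view β thr nhat coin) q (5 * D + S.card + 1 + t)) ∧
      Simulates N (N.backState S β D t) S
        (N.during (N.view β thr nhat coin) q (5 * D + S.card + 1 + t)) := by
  induction t with
  | zero =>
    obtain ⟨h1, h2⟩ := h.during_wave (β := β) (thr := thr) (nhat := nhat) hD le_rfl
    rw [show 4 * D + (S.card + D + 1) = 5 * D + S.card + 1 + 0 by ring] at h1 h2
    rw [← show N.backState S β D 0 = N.waveState S β D (S.card + D + 1) from
      funext fun y => N.backState_zero] at h2
    exact ⟨h1, h2⟩
  | succ t ih =>
    obtain ⟨h1, h2⟩ := ih (by omega)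
    rw [← add_assoc (5 * D + S.card + 1) t 1, N.during_succ]
    obtain ⟨h3, h4, -⟩ := h2.next_back (thr := thr) (nhat := nhat) (coin := coin) hD (by omega) h1
    have hne : t ≠ S.card + D := by omega
    simp only [hne, decide_false, Bool.false_and, Bool.or_false] at h3
    exact ⟨h3, h4⟩

theorem RoundStart.during_report [Nontrivial V] (h : RoundStart coin S i q)
    (hD : D = 2 * wecc N.graph N.weight N.node1) (ht : t ≤ D) :
    Common i (6 * D + 2 * S.card + 2 + t) (fun u => (q u).isSampled || decide (u ∈ S))
        (N.during (N.view β thr nhat coin) q (6 * D + 2 * S.card + 2 + t)) ∧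
      Finished N (N.backState S β D (S.card + D + 1)) S
        (N.during (N.view β thr nhat coin) q (6 * D + 2 * S.card + 2 + t)) ∧
      ∑ u, (N.during (N.view β thr nhat coin) q (6 * D + 2 * S.card + 2 + t) u).acc ≤
        Fintype.card V := by
  induction t with
  | zero =>
    obtain ⟨h1, h2⟩ := h.during_back (β := β) (thr := thr) (nhat := nhat) hD le_rfl
    obtain ⟨h3, h4, h5⟩ := h2.next_back (thr := thr) (nhat := nhat) (coin := coin) hD le_rfl h1
    rw [← N.during_succ, add_assoc (5 * D + S.card + 1),
      show 5 * D + S.card + 1 + (S.card + D + 1) = 6 * D + 2 * S.card + 2 + 0 by ring] at h3 h4 h5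
    simp only [decide_true, Bool.true_and] at h3
    refine ⟨h3, h4.finished, (Finset.sum_le_sum fun u _ => h5 rfl u).trans ?_⟩
    simp
  | succ t ih =>
    obtain ⟨h1, h2, h3⟩ := ih (by omega)
    rw [← add_assoc (6 * D + 2 * S.card + 2) t 1, N.during_succ]
    obtain ⟨h4, h5, h6⟩ := h2.next_report (β := β) (thr := thr) (nhat := nhat) (coin := coin) hD
      (by omega) h1
    exact ⟨h4, h5, h6.trans_le h3⟩

theorem RoundStart.during_halt [Nontrivial V] (h : RoundStart coin S i q)
    (hD : D = 2 * wecc N.graph N.weight N.node1) (ht : t < D) :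
    Common i (7 * D + 2 * S.card + 2 + t) (fun u => (q u).isSampled || decide (u ∈ S))
        (N.during (N.view β thr nhat coin) q (7 * D + 2 * S.card + 2 + t)) ∧
      Finished N (N.backState S β D (S.card + D + 1)) S
        (N.during (N.view β thr nhat coin) q (7 * D + 2 * S.card + 2 + t)) := by
  induction t with
  | zero =>
    obtain ⟨h1, h2, -⟩ := h.during_report (β := β) (thr := thr) (nhat := nhat) hD le_rfl
    rw [show 6 * D + 2 * S.card + 2 + D = 7 * D + 2 * S.card + 2 + 0 by ring] at h1 h2
    exact ⟨h1, h2⟩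
  | succ t ih =>
    obtain ⟨h1, h2⟩ := ih (by omega)
    rw [← add_assoc (7 * D + 2 * S.card + 2) t 1, N.during_succ]
    obtain ⟨h3, h4⟩ := h2.next_halt (β := β) (thr := thr) (nhat := nhat) (coin := coin) hD h1
    have hne : t + 1 ≠ D := by omega
    simp only [hne, decide_false, if_false] at h4
    exact ⟨⟨fun u => (h4 u).1, fun u => (h4 u).2.2.1, fun u => (h4 u).2.2.2,
      fun u => (h4 u).2.1⟩, h3⟩

/-- The length adds up from 4D slots of tree phases, twice |S| + D + 1 for the two subroutines, and
2D slots for reports and termination. -/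
theorem RoundStart.at_end [Nontrivial V] (h : RoundStart coin S i q)
    (hD : D = 2 * wecc N.graph N.weight N.node1) (u : V) :
    let Q := N.during (N.view β thr nhat coin) q (8 * D + 2 * S.card + 2)
    (Q u).done = true ∧ (Q u).round = i + 1 ∧
      (Q u).isSampled = ((q u).isSampled || decide (u ∈ S)) ∧
      (Q u).self = N.backState S β D (S.card + D + 1) (.node u) := by
  have hpos := N.view_diam_pos
  obtain ⟨h1, h2⟩ := h.during_halt (β := β) (thr := thr) (nhat := nhat) (t := D - 1) hD (by omega)
  obtain ⟨h3, h4⟩ := h2.next_halt (β := β) (thr := thr) (nhat := nhat) (coin := coin) hD h1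
  rw [← N.during_succ,
    show 7 * D + 2 * S.card + 2 + (D - 1) + 1 = 8 * D + 2 * S.card + 2 by omega] at h3 h4
  have heq : D - 1 + 1 = D := by omega
  simp only [heq, decide_true, if_true] at h4
  exact ⟨(h4 u).2.2.1, (h4 u).2.2.2, (h4 u).2.1, h3.self u⟩

/-- The messages that are sent in a round with the set `S` of samples. -/
inductive Sent (N : Network V) (S : Finset V) (β D : ℕ) : Msg V → Prop
  | prob (m : ℕ) (h : m ≤ Fintype.card V) : Sent N S β D (.prob m)
  | count (m : ℕ) (h : m ≤ Fintype.card V) : Sent N S β D (.count m)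
  | total (m : ℕ) (h : m ≤ Fintype.card V) : Sent N S β D (.total m)
  | wave (y : Site V) (hy : N.Valid y) (r : V) (d : ℕ) (hd : d ≤ S.card + D + 1) :
      Sent N S β D (.wave r d (Flt.round β (N.tspVal β D y r)))
  | back (u r : V) : Sent N S β D
      (.back r (Flt.round β (N.depVal β D u r)) (Flt.round β (N.tspVal β D (.node u) r)))
  | halt : Sent N S β D .halt

/-- One walk through the phases yields both the form of all messages and the fact that no node
finishes early, which makes the duration exact. -/
theorem RoundStart.sent [Nontrivial V] (h : RoundStart coin S i q)
    (hD : D = 2 * wecc N.graph N.weight N.node1) (ht : t < 8 * D + 2 * S.card + 2) :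
    (∀ u, (N.during (N.view β thr nhat coin) q t u).done = false) ∧
    ∀ u v, N.graph.Adj u v →
      ∀ m ∈ send (N.view β thr nhat coin u) (N.during (N.view β thr nhat coin) q t u) v,
        Sent N S β D m := by
  have hcount : ∀ {Q : V → State V}, ∑ u, (Q u).acc ≤ Fintype.card V → ∀ u v m,
      m ∈ (if u ≠ N.node1 ∧ v = N.treeParent u ∧ 0 < (Q u).acc then some (Msg.count (Q u).acc)
        else none) → Sent N S β D m := by
    intro Q hQ u v m hm
    split_ifs at hm with h1
    · cases hm
      exact .count _ ((Finset.single_le_sum (f := fun u => (Q u).acc) (fun _ _ => Nat.zero_le _)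
        (Finset.mem_univ u)).trans hQ)
    · cases hm
  rcases lt_or_ge t D with h1 | h1
  · obtain ⟨hc, hp⟩ := h.during_prob (β := β) (thr := thr) (nhat := nhat) (t := t) hD h1.le
    refine ⟨hc.done, fun u v _ m hm => ?_⟩
    rw [ProbPhase.send_eq hD h1 hc] at hm
    split_ifs at hm
    · rcases hp.prob u with h2 | h2
      · rw [h2] at hm
        cases hm
      · rw [h2] at hm
        cases hm
        exact .prob _ (min_le_right _ _)
    · cases hm
  rcases lt_or_ge t (3 * D) with h2 | h2
  · obtain ⟨s, rfl⟩ := Nat.exists_eq_add_of_le h1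
    obtain ⟨hc, hp⟩ := h.during_count (β := β) (thr := thr) (nhat := nhat) (t := s) hD (by omega)
    refine ⟨hc.done, fun u v _ m hm => ?_⟩
    rw [CountPhase.send_eq hD (by omega) hc] at hm
    exact hcount (hp.sum.trans_le (Finset.card_le_univ S)) u v m hm
  rcases lt_or_ge t (4 * D) with h3 | h3
  · obtain ⟨s, rfl⟩ := Nat.exists_eq_add_of_le h2
    obtain ⟨hc, hp⟩ := h.during_total (β := β) (thr := thr) (nhat := nhat) (t := s) hD (by omega)
    refine ⟨hc.done, fun u v _ m hm => ?_⟩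
    rw [TotalPhase.send_eq hD (by omega) hc] at hm
    split_ifs at hm
    · rcases hp.total u with h2 | h2
      · rw [h2] at hm
        cases hm
      · rw [h2] at hm
        cases hm
        exact .total _ (Finset.card_le_univ S)
    · cases hm
  rcases lt_or_ge t (5 * D + S.card + 1) with h4 | h4
  · obtain ⟨s, rfl⟩ := Nat.exists_eq_add_of_le h3
    obtain ⟨hc, hp⟩ := h.during_wave (β := β) (thr := thr) (nhat := nhat) (t := s) hD (by omega)
    refine ⟨hc.done, fun u v huv m hm => ?_⟩
    obtain ⟨y, p, hy, hpy, hF⟩ :=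
      (hp.hosts_wave (thr := thr) (nhat := nhat) (coin := coin) hD (by omega) hc).exists_site huv hm
    obtain ⟨r, hr, rfl⟩ := N.waveOut_eq_some hy hpy hF
    obtain ⟨hrS, hrel, -⟩ := (N.mem_waveState_ready hy hpy).1 (Finset.mem_of_min hr)
    -- A relay on a heavy edge may be farther than D from the root. The distance it sends is bounded
    -- through the slot instead: its distance is at most the release slot.
    have := N.sdist_le_release (h := y) hrS
    exact .wave y hy r _ (by omega)
  rcases lt_or_ge t (6 * D + 2 * S.card + 2) with h5 | h5
  · obtain ⟨s, rfl⟩ := Nat.exists_eq_add_of_le h4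
    obtain ⟨hc, hp⟩ := h.during_back (β := β) (thr := thr) (nhat := nhat) (t := s) hD (by omega)
    refine ⟨hc.done, fun u v huv m hm => ?_⟩
    obtain ⟨y, p, hy, hpy, hF⟩ :=
      (hp.hosts_back (thr := thr) (nhat := nhat) (coin := coin) hD (by omega) hc).exists_site huv hm
    obtain ⟨r, hr, hpar, -, a, ha, rfl⟩ := (N.backState_backOut_iff hy (by omega) _).1 hF
    obtain ⟨w, -, rfl⟩ := N.exists_of_answer_eq_some hy ha (N.mem_parentPorts.1 hpar).2.2
    exact .back w r
  rcases lt_or_ge t (7 * D + 2 * S.card + 2) with h6 | h6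
  · obtain ⟨s, rfl⟩ := Nat.exists_eq_add_of_le h5
    obtain ⟨hc, hp, hacc⟩ := h.during_report (β := β) (thr := thr) (nhat := nhat) (t := s) hD
      (by omega)
    refine ⟨hc.done, fun u v _ m hm => ?_⟩
    rw [hp.send_report hD (by omega) hc] at hm
    exact hcount hacc u v m hm
  · obtain ⟨s, rfl⟩ := Nat.exists_eq_add_of_le h6
    obtain ⟨hc, hp⟩ := h.during_halt (β := β) (thr := thr) (nhat := nhat) (t := s) hD (by omega)
    refine ⟨hc.done, fun u v _ m hm => ?_⟩
    rw [hp.send_halt hD hc] at hm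
    split_ifs at hm
    · cases hm
      exact .halt
    · cases hm

theorem RoundStart.duration_eq [Nontrivial V] (h : RoundStart coin S i q)
    (hD : D = 2 * wecc N.graph N.weight N.node1) :
    N.duration (N.view β thr nhat coin) q = 8 * D + 2 * S.card + 2 := by
  have hmem : 8 * D + 2 * S.card + 2 ∈
      {t | ∀ u, (N.during (N.view β thr nhat coin) q t u).done = true} :=
    fun u => (h.at_end hD u).1
  refine le_antisymm (Nat.sInf_le hmem) (le_csInf ⟨_, hmem⟩ fun t ht => ?_)
  by_contra hlt
  have h1 := (h.sent (β := β) (thr := thr) (nhat := nhat) hD (not_le.1 hlt)).1 N.node1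
  rw [ht N.node1] at h1
  cases h1

/-- Round by round, a node's record of having been sampled agrees with the history of its coins, so
the nodes sampled now are those of `sampleSet`. -/
theorem Network.roundStart [Nontrivial V] (N : Network V) (i : ℕ) :
    RoundStart coin (sampleSet coin i) i (N.before (N.view β thr nhat coin) i) := by
  suffices h : ∀ u, (N.before (N.view β thr nhat coin) i u).round = i ∧
      ((N.before (N.view β thr nhat coin) i u).isSampled = false ↔ ∀ j < i, coin j u = false) from
    ⟨fun u => (h u).1, fun u => by simp [sampleSet, (h u).2]⟩
  induction i with
  | zero => exact fun u => ⟨rfl, by simp [Network.before, State.init]⟩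
  | succ i ih =>
    intro u
    have h : RoundStart coin (sampleSet coin i) i (N.before (N.view β thr nhat coin) i) :=
      ⟨fun u => (ih u).1, fun u => by simp [sampleSet, (ih u).2]⟩
    obtain ⟨-, h2, h3, -⟩ := h.at_end (N := N) (β := β) (thr := thr) (nhat := nhat) rfl u
    rw [← h.duration_eq rfl] at h2 h3
    refine ⟨h2, ?_⟩
    rw [Network.before, h3, Bool.or_eq_false_iff, (ih u).2, decide_eq_false_iff_not]
    simp only [sampleSet, Finset.mem_filter, Finset.mem_univ, true_and, not_and, Nat.lt_succ_iff_lt_or_eq]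
    constructor
    · rintro ⟨h4, h5⟩ j (hj | rfl)
      · exact h4 j hj
      · by_contra h6
        exact h5 (by simpa using h6) h4
    · intro h4
      refine ⟨fun j hj => h4 j (Or.inl hj), fun h5 => ?_⟩
      rw [h4 i (Or.inr rfl)] at h5
      cases h5

end Round

end BCSetup

/-! ### Message lengths. -/

namespace BCSetup

section Bits

variable {V : Type*} [Fintype V] [LinearOrder V] {N : Network V} {β k : ℕ} {r : V}

theorem Network.sigma_le_pow (N : Network V) (s u : V) :
    sigma N.graph N.weight s u ≤ Fintype.card V ^ Fintype.card V :=
  (sigma_le N.connected N.weight_pos s u).trans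
    (Nat.pow_le_pow_right (Fintype.card_pos_iff.2 ⟨s⟩) (rank_lt_card s u).le)

/-- A site sums over at most n ports, each with the count of a node; this also covers relays beyond
distance `k`. -/
theorem Network.tspVal_le (hβ : 1 ≤ β) (hk : ∀ v, wdist N.graph N.weight r v ≤ k) {y : Site V}
    (hy : N.Valid y) : N.tspVal β k y r ≤ (Fintype.card V : ℚ) ^ (Fintype.card V + 1) := by
  have hn : (1 : ℚ) ≤ Fintype.card V := by exact_mod_cast Fintype.card_pos_iff.2 ⟨r⟩
  by_cases hr : y = .node r
  · rw [hr, N.tspVal_root]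
    exact one_le_pow₀ hn
  · rw [N.tspVal_eq_sum_ports hβ hy hr, pow_succ']
    refine (Finset.sum_le_card_nsmul _ _ ((Fintype.card V : ℚ) ^ Fintype.card V)
      fun p _ => ?_).trans ?_
    · have h1 : 1 ≤ N.tspVal β k (.node p) r := N.one_le_tspVal (h := .node p) hβ trivial (hk p)
      refine (Flt.round_val_le (by linarith)).trans ((N.tspVal_le_sigma hβ hk p).trans ?_)
      exact_mod_cast N.sigma_le_pow r p
    · rw [nsmul_eq_mul]
      gcongr
      exact Finset.card_le_univ _

/-- Beyond distance `k` the sum is empty and the value zero, which needs no exponent. -/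
theorem Network.one_le_tspVal_of_pos (hβ : 1 ≤ β) {y : Site V} (hy : N.Valid y)
    (hpos : 0 < N.tspVal β k y r) : 1 ≤ N.tspVal β k y r := by
  rcases le_or_gt (N.sdist r y) k with h1 | h1
  · exact N.one_le_tspVal hβ hy h1
  · by_cases hr : y = .node r
    · rw [hr, N.tspVal_root]
    · rw [N.tspVal_eq_sum_ports hβ hy hr, Finset.sum_eq_zero] at hpos
      · exact absurd hpos (lt_irrefl 0)
      · intro p hp
        exact absurd (N.mem_parentPorts.1 hp).2.2 (not_le.2 h1)

/-- A positive dependency has a child's contribution, which is at least the reciprocal of a path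
count. Without this lower bound the negative exponents could be long. -/
theorem Network.one_le_depVal_mul (hβ : 1 ≤ β) (hk : ∀ v, wdist N.graph N.weight r v ≤ k) (u : V)
    (hpos : 0 < N.depVal β k u r) :
    1 ≤ N.depVal β k u r * (Fintype.card V : ℚ) ^ Fintype.card V := by
  classical
  have hr : u ≠ r := by
    rintro rfl
    rw [N.depVal_root_eq_zero] at hpos
    exact lt_irrefl 0 hpos
  have h1 := N.depVal_eq_sum_real (β := β) hr hk
  have hb := fun v => N.real_bounds hβ hk v
  simp only at hb
  have hterm : ∀ v, 0 ≤ (1 + ((Flt.round β (N.depVal β k v r)).val : ℝ)) /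
      ((Flt.round β (N.tspVal β k (.node v) r)).val : ℝ) := by
    intro v
    obtain ⟨-, -, h3, -, -, -, -, -, h9, -⟩ := hb v
    positivity
  have hsum : ∑ v ∈ Finset.univ.filter (fun v => IsParent N.graph N.weight r u v),
        (1 + ((Flt.round β (N.depVal β k v r)).val : ℝ)) /
          ((Flt.round β (N.tspVal β k (.node v) r)).val : ℝ) ≠ 0 := by
    intro h0
    rw [h0, mul_zero] at h1
    exact hpos.ne' (by exact_mod_cast h1)
  obtain ⟨v, hv, -⟩ := Finset.exists_ne_zero_of_sum_ne_zero hsum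
  have h2 := Finset.single_le_sum (fun v _ => hterm v) hv
  obtain ⟨-, h4, h5, h6, -, -, -, -, h7, -⟩ := hb v
  have h8 : ((Flt.round β (N.tspVal β k (.node v) r)).val : ℝ) ≤
      (Fintype.card V : ℝ) ^ Fintype.card V :=
    (h6.trans h4).trans (by exact_mod_cast N.sigma_le_pow r v)
  have h9 : 1 ≤ (1 + ((Flt.round β (N.depVal β k v r)).val : ℝ)) /
      ((Flt.round β (N.tspVal β k (.node v) r)).val : ℝ) *
      (Fintype.card V : ℝ) ^ Fintype.card V := by
    rw [div_mul_eq_mul_div, one_le_div (by linarith)]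
    nlinarith
  have h10 : (1 : ℝ) ≤ (N.depVal β k u r : ℝ) * (Fintype.card V : ℝ) ^ Fintype.card V := by
    refine h9.trans (mul_le_mul_of_nonneg_right ?_ (by positivity))
    rw [h1]
    exact h2.trans (le_mul_of_one_le_left ((hterm v).trans h2) (hb u).1)
  exact_mod_cast h10

theorem Network.depVal_le [Nontrivial V] {c : ℝ} (hc : 0 ≤ c)
    (hβ : β = ⌈(3 + c) * Real.logb 2 (Fintype.card V)⌉₊)
    (hk : ∀ v, wdist N.graph N.weight r v ≤ k) (u : V) :
    N.depVal β k u r ≤ 2 * Fintype.card V := by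
  have hn : (1 : ℝ) ≤ Fintype.card V := by exact_mod_cast Fintype.card_pos_iff.2 ⟨r⟩
  have h1 := (N.depVal_accurate hc hβ hk u).2
  have h2 : 1 / (Fintype.card V : ℝ) ^ c ≤ 1 :=
    div_le_one_of_le₀ (Real.one_le_rpow hn hc) (by positivity)
  have h3 := dependency_le_card (G := N.graph) (w := N.weight) r u
  have h4 := dependency_nonneg (G := N.graph) (w := N.weight) r u
  have h5 : (N.depVal β k u r : ℝ) ≤ 2 * Fintype.card V := by nlinarith
  exact_mod_cast h5

/-- The numbers of a round fit into few bits. -/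
theorem flt_bits_le {n L b : ℕ} (hn : n < 2 ^ (L + 1)) (hL : 1 ≤ L) (hb : β ≤ b * L) {x : ℚ}
    (h1 : x ≤ (n : ℚ) ^ (n + 1)) (h2 : 0 < x → 1 ≤ x * (n : ℚ) ^ n) :
    (Flt.round β x).bits ≤ (2 * b + 6) * L := by
  have hnq : (n : ℚ) ≤ 2 ^ (L + 1) := by exact_mod_cast hn.le
  have h1' : x < (2 : ℚ) ^ ((L + 1) * (n + 2)) := by
    refine h1.trans_lt ?_
    rw [pow_mul]
    refine (pow_le_pow_left₀ (by positivity) hnq _).trans_lt ?_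
    exact pow_lt_pow_right₀ (one_lt_pow₀ (by norm_num) (by omega)) (by omega)
  have h2' : 0 < x → 1 ≤ x * (2 : ℚ) ^ ((L + 1) * (n + 2)) := by
    intro hx
    refine (h2 hx).trans (mul_le_mul_of_nonneg_left ?_ hx.le)
    rw [pow_mul]
    refine (pow_le_pow_left₀ (by positivity) hnq _).trans ?_
    exact pow_le_pow_right₀ (one_le_pow₀ (by norm_num)) (by omega)
  have h3 := Flt.round_bits_le (β := β) h1' h2'
  -- The exponent is of order n log n in absolute value, so writing it down takes O(log n) bits.
  have h4 : ((L + 1) * (n + 2) + β).size ≤ 2 * L + b + 3 := by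
    rw [Nat.size_le]
    have hL2 : L < 2 ^ L := Nat.lt_two_pow_self
    have hb2 : b < 2 ^ b := Nat.lt_two_pow_self
    have hn2 : n + 2 ≤ 2 ^ (L + 2) := by
      have : 2 ≤ 2 ^ (L + 1) := by
        calc 2 = 2 ^ 1 := rfl
          _ ≤ _ := Nat.pow_le_pow_right (by norm_num) (by omega)
      rw [pow_succ 2 (L + 1)]
      omega
    have h5 : (L + 1) * (n + 2) ≤ 2 ^ (2 * L + b + 2) := by
      calc (L + 1) * (n + 2) ≤ 2 ^ L * 2 ^ (L + 2) := Nat.mul_le_mul hL2 hn2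
        _ = 2 ^ (2 * L + 2) := by rw [← pow_add]; congr 1; ring
        _ ≤ _ := Nat.pow_le_pow_right (by norm_num) (by omega)
    have h6 : β < 2 ^ (2 * L + b + 2) := by
      calc β ≤ b * L := hb
        _ ≤ b * 2 ^ L := Nat.mul_le_mul_left _ hL2.le
        _ < 2 ^ b * 2 ^ L := Nat.mul_lt_mul_of_pos_right hb2 (by positivity)
        _ = 2 ^ (b + L) := by rw [← pow_add]
        _ ≤ _ := Nat.pow_le_pow_right (by norm_num) (by omega)
    rw [pow_succ 2 (2 * L + b + 2)]
    omega
  have h7 : b ≤ b * L := Nat.le_mul_of_pos_right _ hL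
  calc _ ≤ _ := h3
    _ ≤ b * L + (2 * L + b + 3) + 1 := by omega
    _ ≤ b * L + (2 * L + b * L + 3 * L) + L := by omega
    _ = _ := by ring

theorem prec_le {n : ℕ} (hn : 2 ≤ n) {c : ℝ} (hc : 0 ≤ c) :
    ⌈(3 + c) * Real.logb 2 n⌉₊ ≤ ⌈2 * (3 + c)⌉₊ * Nat.log 2 n := by
  have hL : 1 ≤ Nat.log 2 n := Nat.log_pos (by norm_num) hn
  have hL' : (1 : ℝ) ≤ Nat.log 2 n := by exact_mod_cast hL
  rw [Nat.ceil_le]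
  have h1 : Real.logb 2 n ≤ Nat.log 2 n + 1 := by
    rw [Real.logb_le_iff_le_rpow (by norm_num) (by positivity)]
    have := (Nat.lt_pow_succ_log_self (b := 2) (by norm_num) n).le
    exact_mod_cast this
  have h2 : 2 * (3 + c) ≤ ⌈2 * (3 + c)⌉₊ := Nat.le_ceil _
  push_cast
  calc (3 + c) * Real.logb 2 n ≤ (3 + c) * (2 * Nat.log 2 n) := by
        apply mul_le_mul_of_nonneg_left _ (by linarith)
        linarith
    _ = 2 * (3 + c) * Nat.log 2 n := by ring
    _ ≤ _ := by gcongr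

variable {S : Finset V} {D : ℕ}

theorem Sent.bits_le [Nontrivial V] {c : ℝ} {a : ℕ} {ident : V → ℕ} {m : Msg V}
    (h : Sent N S β D m) (hc : 0 ≤ c)
    (hβ : β = ⌈(3 + c) * Real.logb 2 (Fintype.card V)⌉₊)
    (hD : D = 2 * wecc N.graph N.weight N.node1)
    (hident : ∀ v, ident v ≤ Fintype.card V ^ a) :
    m.bits ident ≤ (2 * a + 4 * ⌈2 * (3 + c)⌉₊ + 20) *
      (Nat.log 2 (Fintype.card V) + Nat.log 2 N.diam) := by
  have hn : 2 ≤ Fintype.card V := Fintype.one_lt_card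
  have hβ1 : 1 ≤ β := hβ ▸ one_le_prec hn hc
  have hb : β ≤ ⌈2 * (3 + c)⌉₊ * Nat.log 2 (Fintype.card V) := hβ ▸ prec_le hn hc
  have hL : 1 ≤ Nat.log 2 (Fintype.card V) := Nat.log_pos (by norm_num) hn
  have hlt : Fintype.card V < 2 ^ (Nat.log 2 (Fintype.card V) + 1) :=
    Nat.lt_pow_succ_log_self (by norm_num) _
  have hltD : N.diam < 2 ^ (Nat.log 2 N.diam + 1) := Nat.lt_pow_succ_log_self (by norm_num) _
  have hk : ∀ r v, wdist N.graph N.weight r v ≤ D := fun r v => hD ▸ N.wdist_le_diam r v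
  have hDd : D ≤ 2 * N.diam := by
    rw [hD]
    exact Nat.mul_le_mul_left _ (Finset.le_sup (f := fun u => wecc N.graph N.weight u)
      (Finset.mem_univ N.node1))
  have hpow : (Fintype.card V : ℚ) ^ 2 ≤ (Fintype.card V : ℚ) ^ (Fintype.card V + 1) :=
    pow_le_pow_right₀ (by exact_mod_cast (by omega : 1 ≤ Fintype.card V)) (by omega)
  have hone : (1 : ℚ) ≤ (Fintype.card V : ℚ) ^ Fintype.card V :=
    one_le_pow₀ (by exact_mod_cast (by omega : 1 ≤ Fintype.card V))
  have htsp : ∀ y r, N.Valid y → (Flt.round β (N.tspVal β D y r)).bits ≤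
      (2 * ⌈2 * (3 + c)⌉₊ + 6) * Nat.log 2 (Fintype.card V) := by
    intro y r hy
    refine flt_bits_le hlt hL hb (N.tspVal_le hβ1 (hk r) hy) fun hpos => ?_
    have := N.one_le_tspVal_of_pos hβ1 hy hpos
    nlinarith
  have hdep : ∀ u r, (Flt.round β (N.depVal β D u r)).bits ≤
      (2 * ⌈2 * (3 + c)⌉₊ + 6) * Nat.log 2 (Fintype.card V) := by
    intro u r
    refine flt_bits_le hlt hL hb ?_ (N.one_le_depVal_mul hβ1 (hk r) u)
    refine (N.depVal_le hc hβ (hk r) u).trans (le_trans ?_ hpow)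
    have : (2 : ℚ) ≤ Fintype.card V := by exact_mod_cast hn
    nlinarith
  have hid : ∀ v, (ident v).size ≤ a * (Nat.log 2 (Fintype.card V) + 1) + 1 := by
    intro v
    rw [Nat.size_le, mul_comm, pow_succ, pow_mul]
    have h1 := (hident v).trans (Nat.pow_le_pow_left hlt.le a)
    have h2 : 0 < (2 ^ (Nat.log 2 (Fintype.card V) + 1)) ^ a := by positivity
    omega
  have hsmall : ∀ j, j ≤ Fintype.card V → j.size ≤ Nat.log 2 (Fintype.card V) + 1 :=
    fun j hj => Nat.size_le.2 (hj.trans_lt hlt)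
  have hdist : ∀ d, d ≤ S.card + D + 1 →
      d.size ≤ Nat.log 2 (Fintype.card V) + Nat.log 2 N.diam + 3 := by
    intro d hd
    rw [Nat.size_le]
    have h1 : 2 ^ (Nat.log 2 (Fintype.card V) + 1) ≤
        2 ^ (Nat.log 2 (Fintype.card V) + Nat.log 2 N.diam + 1) :=
      Nat.pow_le_pow_right (by norm_num) (by omega)
    have h2 : 2 ^ (Nat.log 2 N.diam + 1) ≤
        2 ^ (Nat.log 2 (Fintype.card V) + Nat.log 2 N.diam + 1) :=
      Nat.pow_le_pow_right (by norm_num) (by omega)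
    have h3 : S.card ≤ Fintype.card V := Finset.card_le_univ S
    rw [pow_succ 2 (_ + 2), pow_succ 2 (_ + 1)]
    omega
  have ha : a ≤ a * Nat.log 2 (Fintype.card V) := Nat.le_mul_of_pos_right _ hL
  generalize ⌈2 * (3 + c)⌉₊ = b at *
  generalize Nat.log 2 (Fintype.card V) = L at *
  generalize Nat.log 2 N.diam = W at *
  -- For the short messages: L + 4 bits are at most 5L because L ≥ 1. In the bound, 2a pays for the
  -- identifier and 4b for the two floating-point numbers of an answer.
  have h0 : 5 * L + a * L + a * L + b * L ≤ (2 * a + 4 * b + 20) * (L + W) := by nlinarith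
  cases h with
  | prob j hj =>
    have := hsmall j hj
    simp only [Msg.bits]
    omega
  | count j hj =>
    have := hsmall j hj
    simp only [Msg.bits]
    omega
  | total j hj =>
    have := hsmall j hj
    simp only [Msg.bits]
    omega
  | wave y hy r d hd =>
    have h1 := htsp y r hy
    have h2 := hid r
    have h3 := hdist d hd
    simp only [Msg.bits]
    nlinarith
  | back u r =>
    have h1 := htsp (.node u) r trivial
    have h2 := hid r
    have h3 := hdep u r
    simp only [Msg.bits]
    nlinarith
  | halt =>
    simp only [Msg.bits]
    omega

end Bits

end BCSetup

/-! ### The lemma. -/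

theorem mainTheorem4 :
    ∃ A : ℕ, ∀ (c : ℝ) (a : ℕ), 0 ≤ c →
    ∃ B : ℕ, ∀ (V : Type*) [Fintype V] [LinearOrder V] [Nontrivial V]
      (ident : V → ℕ) (N : BCSetup.Network V) (thr : ℚ) (nhat : ℕ) (coin : ℕ → V → Bool) (i : ℕ),
      StrictMono ident → (∀ v, ident v ≤ Fintype.card V ^ a) →
      let n : ℕ := Fintype.card V
      let x : V → BCSetup.View V :=
        N.view ⌈(3 + c) * Real.logb 2 n⌉₊ thr nhat coin
      let start : V → BCSetup.State V := N.before x i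
      let T : ℕ := N.duration x start
      let S : Finset V := BCSetup.sampleSet coin i
      -- the round is executed, i.e. the algorithm has not been terminated before
      (∀ u, (start u).terminated = false) →
      -- after `T` slots all nodes have completed the round
      (∀ u, (N.during x start T u).done = true) ∧
      T ≤ A * (S.card + N.diam) ∧
      -- then every node knows its approximate dependencies
      (∀ s ∈ S, ∀ u,
        (1 - 1 / (n : ℝ) ^ c) * BCSetup.dependency N.graph N.weight s u
            ≤ (((N.during x start T u).self.dep s : ℚ) : ℝ) ∧
        (((N.during x start T u).self.dep s : ℚ) : ℝ)
            ≤ (1 + 1 / (n : ℝ) ^ c) * BCSetup.dependency N.graph N.weight s u) ∧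
      -- every message is short
      (∀ t < T, ∀ u v, N.graph.Adj u v →
        ∀ m ∈ (BCSetup.program V).send (x u) (N.during x start t u) v,
          m.bits ident ≤ B * (Nat.log 2 n + Nat.log 2 N.diam)) := by
  -- With e ≥ 1 the eccentricity of node 1, a round takes 16e + 2|S| + 2 ≤ 18e + 2|S| slots. The
  -- second constant is that of `Sent.bits_le`.
  refine ⟨18, fun c a hc => ⟨2 * a + 4 * ⌈2 * (3 + c)⌉₊ + 20, ?_⟩⟩
  intro V _ _ _ ident N thr nhat coin i _ hident n x start T S _
  have hround : BCSetup.RoundStart coin S i start := N.roundStart i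
  have hT : T = 8 * (2 * BCSetup.wecc N.graph N.weight N.node1) + 2 * S.card + 2 :=
    hround.duration_eq rfl
  have hend := fun u => hround.at_end (N := N) (β := ⌈(3 + c) * Real.logb 2 n⌉₊) (thr := thr)
    (nhat := nhat) rfl u
  rw [← hT] at hend
  refine ⟨fun u => (hend u).1, ?_, fun s hs u => ?_, fun t ht u v huv m hm => ?_⟩
  · have h1 : BCSetup.wecc N.graph N.weight N.node1 ≤ N.diam :=
      Finset.le_sup (f := fun u => BCSetup.wecc N.graph N.weight u) (Finset.mem_univ N.node1)
    have h2 := N.view_diam_pos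
    omega
  · have h1 := (hend u).2.2.2
    rw [h1, BCSetup.Network.backState_dep hs]
    exact N.depVal_accurate hc rfl (fun v => N.wdist_le_diam s v) u
  · exact ((hround.sent rfl (hT ▸ ht)).2 u v huv m hm).bits_le hc rfl rfl hident
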